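/- \textbf{Setting.} Let $R=(R_1,\dots,R_t)$ be a sequence of rectangles, $R_i=(\mu_i^{\eta_i})$ having $\eta_i\ge1$ rows and $\mu_i\ge0$ columns, let $n=\eta_1+\dots+\eta_t$, let $\lambda=(\lambda_1\ge\dots\ge\lambda_n\ge0)$ be a partition, and let $k$ be an integer with $k\ge\lambda_1$ and $k\ge\mu_i$ for all $i$. Put $\widetilde\lambda=(k-\lambda_n,\dots,k-\lambda_1)$ and $\widetilde R=(\widetilde R_1,\dots,\widetilde R_t)$ with $\widetilde R_i=((k-\mu_i)^{\eta_i})$. Let $A_1,\dots,A_t$ be the successive subintervals of $[n]=\{1,\dots,n\}$ of sizes $\eta_1,\dots,\eta_t$. \textbf{LR tableaux.} The word of a (skew) tableau reads its rows from bottom to top, each from left to right. $LRT(\lambda;R)$ is the set of column strict tableaux $T$ of shape $\lambda$ in the alphabet $[n]$ in which each letter of $A_i$ occurs exactly $\mu_i$ times and such that, for every $i$, the word of the restriction $T|_{A_i}$ is lattice in the alphabet $A_i$ (in every final subword, the multiplicities of the letters of $A_i$ are weakly decreasing along $A_i$). The same definition is used with $[n]$ replaced by any interval of $n$ consecutive integers.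 \textbf{Duality.} For a column strict tableau $T$ of shape $\lambda$ in the alphabet $[n]$, $\widetilde T$ is the tableau of shape $\widetilde\lambda$ whose $j$-th column is the complement in $[n]$ of the $(k+1-j)$-th column of $T$, for $1\le j\le k$. \textbf{Rectangle switching.} Let $1\le p<t$, $B=A_p\cup A_{p+1}$, $T\in LRT(\lambda;R)$, and let $(P,Q)$ be the insertion and recording tableaux of the word of $T|_B$ under column insertion (of the letters from right to left). Then $s_pT\in LRT(\lambda;s_pR)$ is the column strict tableau of shape $\lambda$ which agrees with $T$ outside the cells of $T|_B$ and whose restriction $U$ to $B$ has the same skew shape as $T|_B$, where the word of $U$ corresponds to the pair $(P',Q)$ and $P'$ is the unique LR tableau of type $(\mathrm{shape}(P);(R_{p+1},R_p))$ in the alphabet $B$. The group $\Sigma_t$ acts on sequences of rectangles by permuting positions, and for $u\in\Sigma_t$ with a chosen reduced word $a_1\cdots a_r$ one puts $uT=s_{a_1}s_{a_2}\cdots s_{a_r}T\in LRT(\lambda;uR)$. \textbf{Charge.} Let $d_{p,R}(T)$ be the number of cells of $P(T|_{A_p\cup A_{p+1}})$ strictly to the right of column number $\max(\mu_p,\mu_{p+1})$,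 let $d_R(T)=\sum_{p=1}^{t-1}(t-p)\,d_{p,R}(T)$, and let $$\mathrm{charge}_R(T)=\frac1{t!}\sum_{u\in\Sigma_t}d_{uR}(uT)\in\mathbb{Q},\qquad LRT_{\lambda;R}(q)=\sum_{T\in LRT(\lambda;R)}q^{\mathrm{charge}_R(T)},$$ the latter being a finite formal sum of powers of $q$ with rational exponents. \textbf{Proposition.} The map $T\mapsto\widetilde T$ is a bijection from the column strict tableaux of shape $\lambda$ in the alphabet $[n]$ onto those of shape $\widetilde\lambda$, and it restricts to a bijection $LRT(\lambda;R)\to LRT(\widetilde\lambda;\widetilde R)$. Moreover, for every choice of a reduced word for each $u\in\Sigma_t$ (the same choice being used for $R$ and for $\widetilde R$), $$\mathrm{charge}_R(T)=\mathrm{charge}_{\widetilde R}(\widetilde T)\quad\text{for all }T\in LRT(\lambda;R),\qquad\text{and hence}\qquad LRT_{\lambda;R}(q)=LRT_{\widetilde\lambda;\widetilde R}(q).$$ -/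

import Mathlib

namespace RectLR

/-! ### Shapes and column strict tableaux

Cells are zero-based (row, column) pairs, as in `YoungDiagram`; letters are positive integers,
so the value `0` which a `SemistandardYoungTableau` takes outside its shape is never a letter. -/

/-- Column strict tableaux of shape `Λ` with all their letters in the alphabet `A`. -/
def CST (A : Finset ℕ) (Λ : YoungDiagram) : Set (SemistandardYoungTableau Λ) :=
  {T | ∀ i j, (i, j) ∈ Λ → T i j ∈ A}

/-- The row-reading word: the rows are read from bottom to top, each one from left to right.
For an alphabet `A`, the row-reading word of the restriction `T|_A` is the subword of the letters
in `A`, that is, `(rowWord T).filter (· ∈ A)`. -/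
def rowWord {Λ : YoungDiagram} (T : SemistandardYoungTableau Λ) : List ℕ :=
  (List.range (Λ.colLen 0)).reverse.flatMap fun i => (List.range (Λ.rowLen i)).map fun j => T i j

/-- A word is lattice in the alphabet `A` (an interval) if the content of each of its final
subwords is weakly decreasing along `A`. -/
def IsLattice (A : Finset ℕ) (w : List ℕ) : Prop :=
  ∀ v, v <:+ w → ∀ x, x ∈ A → x + 1 ∈ A → v.count (x + 1) ≤ v.count x

/-- The multiplicity of the letter `x` in `T`. -/
def mult {Λ : YoungDiagram} (T : SemistandardYoungTableau Λ) (x : ℕ) : ℕ :=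
  (Λ.cells.filter fun c => T c.1 c.2 = x).card

/-! ### Sequences of rectangles and Littlewood-Richardson tableaux -/

/-- A rectangle with a positive number of rows and a possibly zero number of columns. -/
structure Rect where
  rows : ℕ
  cols : ℕ
  rows_pos : 0 < rows

/-- The total number `n` of rows of a sequence of rectangles. -/
def totalRows {t : ℕ} (R : Fin t → Rect) : ℕ := ∑ i, (R i).rows

/-- The number of letters before the `i`-th subalphabet. -/
def start {t : ℕ} (R : Fin t → Rect) (i : Fin t) : ℕ := ∑ j ∈ Finset.univ.filter (· < i), (R j).rows

/-- The `i`-th subalphabet `A_i`, inside the alphabet `[a + 1, a + n]`. -/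
def subalphabet {t : ℕ} (a : ℕ) (R : Fin t → Rect) (i : Fin t) : Finset ℕ :=
  Finset.Icc (a + start R i + 1) (a + start R i + (R i).rows)

/-- `LRTin a R Λ` is the set of LR tableaux of type `(Λ; R)` in the alphabet `[a + 1, a + n]`. -/
def LRTin {t : ℕ} (a : ℕ) (R : Fin t → Rect) (Λ : YoungDiagram) :
    Set (SemistandardYoungTableau Λ) :=
  {T | T ∈ CST (Finset.Icc (a + 1) (a + totalRows R)) Λ ∧
    (∀ i, ∀ x ∈ subalphabet a R i, mult T x = (R i).cols) ∧
    ∀ i, IsLattice (subalphabet a R i) ((rowWord T).filter (· ∈ subalphabet a R i))}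

/-- `LRT(Λ; R)`: the alphabet is `[n]`. -/
def LRT {t : ℕ} (R : Fin t → Rect) (Λ : YoungDiagram) : Set (SemistandardYoungTableau Λ) :=
  LRTin 0 R Λ

/-! ### Column insertion

A tableau is written here as the list of its columns, each column from top to bottom. -/

/-- Insert `x` into a column: it replaces the smallest letter `≥ x`, which is returned, or is
appended at the bottom if there is none. -/
def bumpColumn (x : ℕ) : List ℕ → List ℕ × Option ℕ
  | [] => ([x], none)
  | y :: ys => if x ≤ y then (x :: ys, some y) else (y :: (bumpColumn x ys).1, (bumpColumn x ys).2)

/-- Column insertion of `x` into a tableau, with the index of the column that gets the new cell. -/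
def columnInsert : ℕ → List (List ℕ) → List (List ℕ) × ℕ
  | x, [] => ([[x]], 0)
  | x, c :: cs =>
    match bumpColumn x c with
    | (c', none) => (c' :: cs, 0)
    | (c', some y) => (c' :: (columnInsert y cs).1, (columnInsert y cs).2 + 1)

/-- Append `m` at the bottom of the column with the given index. -/
def appendToColumn (m : ℕ) : ℕ → List (List ℕ) → List (List ℕ)
  | 0, [] => [[m]]
  | 0, c :: cs => (c ++ [m]) :: cs
  | j + 1, [] => [] :: appendToColumn m j []
  | j + 1, c :: cs => c :: appendToColumn m j cs

/-- The pair `(P, Q)` corresponding to a word under column insertion. The letters are inserted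
from right to left; `Q` records by `m` the cell created by the `m`-th insertion. -/
def columnRSK : List ℕ → List (List ℕ) × List (List ℕ)
  | [] => ([], [])
  | x :: w =>
    ((columnInsert x (columnRSK w).1).1,
      appendToColumn (w.length + 1) (columnInsert x (columnRSK w).1).2 (columnRSK w).2)

/-- The insertion tableau `P(w)`. -/
def insertionTableau (w : List ℕ) : List (List ℕ) := (columnRSK w).1

/-- The recording tableau `Q(w)`. -/
def recordingTableau (w : List ℕ) : List (List ℕ) := (columnRSK w).2

/-- The list of columns `C` describes the tableau `T`. -/
def IsColumnsOf {Λ : YoungDiagram} (C : List (List ℕ)) (T : SemistandardYoungTableau Λ) : Prop :=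
  ∀ i j, T i j = (C.getD j []).getD i 0

/-! ### Rectangle switching -/

/-- The position `p`, for an adjacent pair of positions `p`, `p + 1` (zero-based). -/
def lo {t : ℕ} (p : Fin (t - 1)) : Fin t := ⟨p.1, by omega⟩

/-- The position `p + 1`. -/
def hi {t : ℕ} (p : Fin (t - 1)) : Fin t := ⟨p.1 + 1, by omega⟩

/-- The adjacent transposition `s_p`. -/
def adj {t : ℕ} (p : Fin (t - 1)) : Equiv.Perm (Fin t) := Equiv.swap (lo p) (hi p)

/-- The action `u R` of permutations on sequences of rectangles, by permuting positions. -/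
def permute {t : ℕ} (u : Equiv.Perm (Fin t)) (R : Fin t → Rect) : Fin t → Rect :=
  fun i => R (u⁻¹ i)

/-- The alphabet `B = A_p ∪ A_{p+1}`. -/
def pairAlphabet {t : ℕ} (R : Fin t → Rect) (p : Fin (t - 1)) : Finset ℕ :=
  subalphabet 0 R (lo p) ∪ subalphabet 0 R (hi p)

/-- The row-reading word of `T|_B`, where `B = A_p ∪ A_{p+1}`. -/
def pairWord {t : ℕ} (R : Fin t → Rect) (p : Fin (t - 1)) {Λ : YoungDiagram}
    (T : SemistandardYoungTableau Λ) : List ℕ :=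
  (rowWord T).filter (· ∈ pairAlphabet R p)

/-- `T'` is the result of switching the rectangles `R_p` and `R_{p+1}` in `T`: it agrees with `T`
outside the alphabet `B`, its restriction to `B` has the same skew shape as that of `T`, the
row-reading words of the two restrictions have the same recording tableau, and the insertion
tableau of the new one is an LR tableau for `(R_{p+1}, R_p)` in the alphabet `B`. -/
def IsSwitch {t : ℕ} (R : Fin t → Rect) (p : Fin (t - 1)) {Λ : YoungDiagram}
    (T T' : SemistandardYoungTableau Λ) : Prop :=
  (∀ i j, (i, j) ∈ Λ → T i j ∉ pairAlphabet R p → T' i j = T i j) ∧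
  (∀ i j, (i, j) ∈ Λ → T i j ∈ pairAlphabet R p → T' i j ∈ pairAlphabet R p) ∧
  recordingTableau (pairWord R p T') = recordingTableau (pairWord R p T) ∧
  ∃ (ρ : YoungDiagram) (P' : SemistandardYoungTableau ρ),
    P' ∈ LRTin (start R (lo p)) ![R (hi p), R (lo p)] ρ ∧
    IsColumnsOf (insertionTableau (pairWord R p T')) P'

open Classical in
/-- The rectangle-switching bijection `s_p : LRT(Λ; R) → LRT(Λ; s_p R)`
(with an irrelevant value on tableaux that cannot be switched). -/
noncomputable def switch {t : ℕ} (R : Fin t → Rect) (p : Fin (t - 1)) {Λ : YoungDiagram}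
    (T : SemistandardYoungTableau Λ) : SemistandardYoungTableau Λ :=
  if h : ∃ T', IsSwitch R p T T' then h.choose else T

/-- The permutation `s_{a_1} s_{a_2} ⋯ s_{a_r}`. -/
def wordPerm {t : ℕ} (w : List (Fin (t - 1))) : Equiv.Perm (Fin t) := (w.map adj).prod

/-- `w` is a reduced word of `u`: a shortest expression of `u` by adjacent transpositions. -/
def IsReducedWord {t : ℕ} (w : List (Fin (t - 1))) (u : Equiv.Perm (Fin t)) : Prop :=
  wordPerm w = u ∧ ∀ w' : List (Fin (t - 1)), wordPerm w' = u → w.length ≤ w'.length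

/-- The composition `s_{a_1} ∘ s_{a_2} ∘ ⋯ ∘ s_{a_r}` of switching bijections, on `LRT(Λ; R)`. -/
noncomputable def switchWord {t : ℕ} (R : Fin t → Rect) {Λ : YoungDiagram} :
    List (Fin (t - 1)) → SemistandardYoungTableau Λ → SemistandardYoungTableau Λ
  | [], T => T
  | p :: w, T => switch (permute (wordPerm w) R) p (switchWord R w T)

/-! ### The statistics -/

/-- `d_{p,R}(T)`: the number of cells of `P(T|_{A_p ∪ A_{p+1}})` strictly to the right of the column
number `max(μ_p, μ_{p+1})`. -/
def dPair {t : ℕ} (R : Fin t → Rect) (p : Fin (t - 1)) {Λ : YoungDiagram}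
    (T : SemistandardYoungTableau Λ) : ℕ :=
  (((insertionTableau (pairWord R p T)).drop (max (R (lo p)).cols (R (hi p)).cols)).map
    List.length).sum

/-- `d_R(T) = ∑_p (t - p) d_{p,R}(T)`; the index is zero-based here, so `t - p` reads
`t - (p + 1)`. -/
def dStat {t : ℕ} (R : Fin t → Rect) {Λ : YoungDiagram} (T : SemistandardYoungTableau Λ) : ℕ :=
  ∑ p : Fin (t - 1), (t - (p.1 + 1)) * dPair R p T

/-- `charge_R(T)`, the average over `u` of `d_{uR}(uT)`, where `u T` is computed with the
word `a u` of `u`. -/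
noncomputable def charge {t : ℕ} (a : Equiv.Perm (Fin t) → List (Fin (t - 1)))
    (R : Fin t → Rect) {Λ : YoungDiagram} (T : SemistandardYoungTableau Λ) : ℚ :=
  (∑ u : Equiv.Perm (Fin t), (dStat (permute u R) (switchWord R (a u) T) : ℚ)) / (t.factorial : ℚ)

theorem CST_finite (A : Finset ℕ) (Λ : YoungDiagram) : (CST A Λ).Finite := by
  have h : Set.InjOn (fun (T : SemistandardYoungTableau Λ) (c : Λ.cells) => T c.1.1 c.1.2)
      (CST A Λ) := by
    intro T _ T' _ hT
    ext i j
    by_cases hc : (i, j) ∈ Λ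
    · exact congrFun hT ⟨(i, j), hc⟩
    · rw [T.zeros hc, T'.zeros hc]
  refine Set.Finite.of_finite_image ?_ h
  refine (Set.Finite.pi' (fun _ : Λ.cells => A.finite_toSet)).subset ?_
  rintro _ ⟨T, hT, rfl⟩ c
  exact hT _ _ c.2

theorem LRT_finite {t : ℕ} (R : Fin t → Rect) (Λ : YoungDiagram) : (LRT R Λ).Finite :=
  (CST_finite _ Λ).subset fun _ h => h.1

/-- `LRT_{Λ;R}(q) = ∑_{T ∈ LRT(Λ;R)} q ^ charge_R(T)`, a finite formal sum of powers of `q` with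
rational exponents. -/
noncomputable def LRTgen {t : ℕ} (a : Equiv.Perm (Fin t) → List (Fin (t - 1)))
    (R : Fin t → Rect) (Λ : YoungDiagram) : AddMonoidAlgebra ℤ ℚ :=
  ∑ T ∈ (LRT_finite R Λ).toFinset, AddMonoidAlgebra.single (charge a R T) 1

/-! ### Duality in the `n × k` rectangle -/

/-- The rectangles `((k - μ_i) ^ η_i)`. -/
def dualRects {t : ℕ} (k : ℕ) (R : Fin t → Rect) : Fin t → Rect :=
  fun i => ⟨(R i).rows, k - (R i).cols, (R i).rows_pos⟩

/-- The shape `(k - λ_n, …, k - λ_1)`: the complement of `Λ` in the rectangle with `n` rows and `k`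
columns, rotated by 180 degrees. -/
def dualShape (n k : ℕ) (Λ : YoungDiagram) : YoungDiagram where
  cells := (Finset.range n ×ˢ Finset.range k).filter fun c => (n - 1 - c.1, k - 1 - c.2) ∉ Λ
  isLowerSet := by
    rintro ⟨a, b⟩ ⟨c, d⟩ ⟨h₁, h₂⟩ h
    simp only [Finset.coe_filter, Finset.mem_product, Finset.mem_range, Set.mem_ofPred_eq] at *
    refine ⟨⟨by omega, by omega⟩, fun h' => h.2 (Λ.up_left_mem ?_ ?_ h')⟩ <;> omega

theorem mem_dualShape {n k : ℕ} {Λ : YoungDiagram} {i j : ℕ} :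
    (i, j) ∈ dualShape n k Λ ↔ (i < n ∧ j < k) ∧ (n - 1 - i, k - 1 - j) ∉ Λ := by
  rw [← YoungDiagram.mem_cells]
  simp [dualShape]

/-- The set of letters in column `j` of `T`. -/
def columnSet {Λ : YoungDiagram} (T : SemistandardYoungTableau Λ) (j : ℕ) : Finset ℕ :=
  (Finset.range (Λ.colLen j)).image fun i => T i j

/-- The entries of the dual tableau: `Nat.nth p i` is the `i`-th smallest number (zero-based) with
property `p`, so the `j`-th of the `k` columns holds in increasing order the complement in `[n]` of
the letters in column `k - 1 - j` of `T`. -/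
noncomputable def dualEntry (n k : ℕ) {Λ : YoungDiagram} (T : SemistandardYoungTableau Λ)
    (i j : ℕ) : ℕ :=
  if (i, j) ∈ dualShape n k Λ then
    Nat.nth (fun x => x ∈ Finset.Icc 1 n \ columnSet T (k - 1 - j)) i
  else 0

theorem lt_card_compl {n k : ℕ} {Λ : YoungDiagram} (T : SemistandardYoungTableau Λ) {i j : ℕ}
    (h : (i, j) ∈ dualShape n k Λ) :
    i < (Finset.Icc 1 n \ columnSet T (k - 1 - j)).card := by
  rw [mem_dualShape] at h
  have h1 : Λ.colLen (k - 1 - j) ≤ n - 1 - i := by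
    by_contra hc
    exact h.2 (YoungDiagram.mem_iff_lt_colLen.2 (by omega))
  have h2 : (columnSet T (k - 1 - j)).card ≤ Λ.colLen (k - 1 - j) :=
    Finset.card_image_le.trans (by simp)
  have h3 := Finset.le_card_sdiff (columnSet T (k - 1 - j)) (Finset.Icc 1 n)
  simp only [Nat.card_Icc] at h3
  omega

theorem card_columnSet_filter_le {n : ℕ} {Λ : YoungDiagram} {T : SemistandardYoungTableau Λ}
    (hT : T ∈ CST (Finset.Icc 1 n) Λ) {c₁ c₂ : ℕ} (hc : c₂ ≤ c₁) (b : ℕ) :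
    ((columnSet T c₁).filter (· ≤ b)).card ≤ ((columnSet T c₂).filter (· ≤ b)).card := by
  unfold columnSet
  rw [Finset.filter_image, Finset.filter_image]
  refine Finset.card_image_le.trans ?_
  rw [Finset.card_image_of_injOn]
  · apply Finset.card_le_card
    intro i hi
    simp only [Finset.mem_filter, Finset.mem_range] at hi ⊢
    have hm := YoungDiagram.mem_iff_lt_colLen.2 hi.1
    exact ⟨YoungDiagram.mem_iff_lt_colLen.1 (Λ.up_left_mem le_rfl hc hm),
      (T.row_weak_of_le hc hm).trans hi.2⟩
  · intro x hx y hy hxy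
    simp only [Finset.coe_filter, Finset.mem_range, Set.mem_ofPred_eq] at hx hy
    rcases lt_trichotomy x y with h | h | h
    · exact absurd hxy (T.col_strict h (YoungDiagram.mem_iff_lt_colLen.2 hy.1)).ne
    · exact h
    · exact absurd hxy (T.col_strict h (YoungDiagram.mem_iff_lt_colLen.2 hx.1)).ne'

open Classical in
/-- The dual tableau of `T` with respect to the `n × k` rectangle
(with an irrelevant value if `T` has letters outside `[n]`). -/
noncomputable def dualTableau (n k : ℕ) {Λ : YoungDiagram} (T : SemistandardYoungTableau Λ) :
    SemistandardYoungTableau (dualShape n k Λ) :=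
  if hT : T ∈ CST (Finset.Icc 1 n) Λ then
    { entry := dualEntry n k T
      row_weak' := by
        intro i j₁ j₂ hj h
        have h' : (i, j₁) ∈ dualShape n k Λ := (dualShape n k Λ).up_left_mem le_rfl hj.le h
        unfold dualEntry
        rw [if_pos h, if_pos h']
        set S₁ := Finset.Icc 1 n \ columnSet T (k - 1 - j₁) with hS₁
        set S₂ := Finset.Icc 1 n \ columnSet T (k - 1 - j₂) with hS₂
        have hf : (Set.ofPred fun x => x ∈ S₂).Finite := S₂.finite_toSet
        have hi : i < hf.toFinset.card := by
          have : hf.toFinset = S₂ := by ext; simp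
          rw [this]; exact lt_card_compl T h
        set b := Nat.nth (fun x => x ∈ S₂) i with hb
        have hbS : b ∈ S₂ := Nat.nth_mem_of_lt_card hf hi
        have hbn : 1 ≤ b ∧ b ≤ n := Finset.mem_Icc.1 (Finset.mem_sdiff.1 hbS).1
        have hcount : Nat.count (fun x => x ∈ S₂) (b + 1) = i + 1 := by
          rw [Nat.count_succ, if_pos hbS, hb, Nat.count_nth fun _ => hi]
        have key : ∀ c, Nat.count (fun x => x ∈ Finset.Icc 1 n \ columnSet T c) (b + 1) +
            ((columnSet T c).filter (· ≤ b)).card = b := by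
          intro c
          rw [Nat.count_eq_card_filter_range, ← Finset.card_union_of_disjoint]
          · have : (Finset.range (b + 1)).filter (fun x => x ∈ Finset.Icc 1 n \ columnSet T c) ∪
                (columnSet T c).filter (· ≤ b) = Finset.Icc 1 b := by
              ext x
              simp only [Finset.mem_union, Finset.mem_filter, Finset.mem_range, Finset.mem_sdiff,
                Finset.mem_Icc]
              constructor
              · rintro (hx | hx)
                · omega
                · refine ⟨?_, hx.2⟩
                  obtain ⟨r, hr, rfl⟩ := Finset.mem_image.1 hx.1
                  exact (Finset.mem_Icc.1 (hT _ _
                    (YoungDiagram.mem_iff_lt_colLen.2 (Finset.mem_range.1 hr)))).1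
              · intro hx
                by_cases hxc : x ∈ columnSet T c
                · exact Or.inr ⟨hxc, hx.2⟩
                · exact Or.inl ⟨by omega, ⟨by omega, by omega⟩, hxc⟩
            rw [this]; simp
          · rw [Finset.disjoint_left]
            intro x hx hx'
            exact (Finset.mem_sdiff.1 (Finset.mem_filter.1 hx).2).2 (Finset.mem_filter.1 hx').1
        have hle := card_columnSet_filter_le hT
          (show k - 1 - j₂ ≤ k - 1 - j₁ by omega) b
        have k1 := key (k - 1 - j₁)
        have k2 := key (k - 1 - j₂)
        rw [← hS₁] at k1
        rw [← hS₂, hcount] at k2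
        have : Nat.nth (fun x => x ∈ S₁) i < b + 1 := Nat.nth_lt_of_lt_count (by omega)
        omega
      col_strict' := by
        intro i₁ i₂ j hi h
        have h' : (i₁, j) ∈ dualShape n k Λ := (dualShape n k Λ).up_left_mem hi.le le_rfl h
        unfold dualEntry
        rw [if_pos h, if_pos h']
        set S := Finset.Icc 1 n \ columnSet T (k - 1 - j)
        have hf : (Set.ofPred fun x => x ∈ S).Finite := S.finite_toSet
        have hi' : i₂ < hf.toFinset.card := by
          have : hf.toFinset = S := by ext; simp
          rw [this]; exact lt_card_compl T h
        exact Nat.nth_lt_nth_of_lt_card hf hi hi'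
      zeros' := by
        intro i j h
        exact if_neg h }
  else SemistandardYoungTableau.highestWeight _

end RectLR

/-! Everything is expressed through the type A crystal structure on words. For a letter i, bracket
each i + 1 with an i to its right; `sig` counts the unmatched i + 1 and i, and `Lower` is the
operator f_i. The lattice condition on A_j says that no i + 1 is unmatched when i and i + 1 both lie
in A_j. As all letters of A_j are equally frequent, no i is unmatched either, so the word is
extremal in both directions (`IsRectWord`).

Column insertion commutes with f_i and the recording tableau does not change
(`Lower.insertionTableau`). The row word of a tableau inserts to that tableau, with a recording
tableau that depends on the shape only. Hence the operators act on tableaux, and two tableaux that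
agree outside an interval of letters are connected by the operators of that interval exactly when
their restricted words have the same recording tableau (`Agree.conn`, `Conn.recordingTableau_eq`). A
column strict tableau extremal for two adjacent rectangles is determined by its shape
(`SS.two_rectangles_unique`). Therefore s_p T is the only tableau in the component of T that is
extremal for the exchanged rectangles (`isSwitch_iff`, `IsSwitch.unique`); it exists because
reversing a word and its alphabet preserves the shape of the insertion tableau
(`lens_insertionTableau_star`).

Complementing the columns and reversing their order swaps the unmatched i with the unmatched i + 1
and turns f_i into its inverse (`sig_dualCols`, `Lower.dualCols`). So duality preserves LR tableaux
and components, and by uniqueness it commutes with switching (`switch_dualTableau`).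

It remains to compare d_p. Let ρ be the shape of the insertion tableau of T restricted to A_p ∪
A_{p+1}, with m = η_p + η_{p+1} rows, some possibly empty. The dual of a highest weight tableau is a
lowest weight one, and comparing contents shows that the dual shape has rows k - ρ_m, …, k - ρ_1
(`rowLength_dualTableau`). Write μ, ν for the widths of R_p, R_{p+1} and suppose ν ≤ μ. Since |ρ| =
η_p μ + η_{p+1} ν, and for ν < μ the first η_p rows of ρ are at least μ and the others at most ν,
the total surplus over μ equals the total deficit below ν (`sum_sub_eq_sum_sub`). The surplus is d_p
of T and the deficit is d_p of the dual; if μ ≤ ν, the same argument starts from the dual. The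
charges then agree term by term. -/

namespace RectLR

/-! ### The signature of a word -/

/-- The product of the bicyclic monoid, on pairs (unmatched `i + 1`, unmatched `i`). -/
def sigMul (a b : ℕ × ℕ) : ℕ × ℕ := (b.1 + (a.1 - b.2), a.2 + (b.2 - a.1))

/-- The signature of a letter. -/
def letterSig (i x : ℕ) : ℕ × ℕ := if x = i then (0, 1) else if x = i + 1 then (1, 0) else (0, 0)

/-- The numbers of unmatched letters `i + 1` and `i` in a word, where each `i + 1` is matched with
an `i` to its right. -/
def sig (i : ℕ) : List ℕ → ℕ × ℕ
  | [] => (0, 0)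
  | x :: w => sigMul (letterSig i x) (sig i w)

/-- Associativity in the bicyclic monoid: bracketing does not depend on the order in which pairs are
cancelled. -/
theorem sigMul_assoc (a b c : ℕ × ℕ) : sigMul (sigMul a b) c = sigMul a (sigMul b c) := by
  ext <;> simp only [sigMul] <;> omega

@[simp] theorem sigMul_one (a : ℕ × ℕ) : sigMul a (0, 0) = a := by ext <;> simp [sigMul]

@[simp] theorem one_sigMul (a : ℕ × ℕ) : sigMul (0, 0) a = a := by ext <;> simp [sigMul]

@[simp] theorem sig_nil (i : ℕ) : sig i [] = (0, 0) := rfl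

theorem sig_cons (i x : ℕ) (w : List ℕ) : sig i (x :: w) = sigMul (letterSig i x) (sig i w) := rfl

theorem sig_append (i : ℕ) (u v : List ℕ) : sig i (u ++ v) = sigMul (sig i u) (sig i v) := by
  induction u with
  | nil => simp
  | cons x u ih => rw [List.cons_append, sig_cons, sig_cons, ih, sigMul_assoc]

theorem letterSig_self (i : ℕ) : letterSig i i = (0, 1) := by simp [letterSig]

theorem letterSig_succ (i : ℕ) : letterSig i (i + 1) = (1, 0) := by simp [letterSig]

theorem letterSig_ne {i x : ℕ} (h : x ≠ i) (h' : x ≠ i + 1) : letterSig i x = (0, 0) := by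
  simp [letterSig, h, h']

theorem sig_singleton (i x : ℕ) : sig i [x] = letterSig i x := by simp [sig_cons]

theorem sig_eq_one {i : ℕ} {w : List ℕ} (h : ∀ x ∈ w, x ≠ i ∧ x ≠ i + 1) : sig i w = (0, 0) := by
  induction w with
  | nil => rfl
  | cons x w ih =>
    rw [sig_cons, letterSig_ne (h x (by simp)).1 (h x (by simp)).2,
      ih fun y hy => h y (by simp [hy])]
    simp

/-- Letters other than i and i + 1 have trivial signature. This is how restrictions to a subalphabet
are replaced by the full word throughout. -/
theorem sig_filter (i : ℕ) (p : ℕ → Bool) (hi : p i) (hi' : p (i + 1)) (w : List ℕ) :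
    sig i (w.filter p) = sig i w := by
  induction w with
  | nil => rfl
  | cons x w ih =>
    by_cases hx : p x
    · rw [List.filter_cons_of_pos hx, sig_cons, sig_cons, ih]
    · rw [List.filter_cons_of_neg hx, sig_cons, ih, letterSig_ne, one_sigMul]
      · rintro rfl; exact hx hi
      · rintro rfl; exact hx hi'

/-- Each matched pair removes one i and one i + 1, so the difference of multiplicities is the
difference of the unmatched ones. -/
theorem sig_count (i : ℕ) (w : List ℕ) :
    w.count (i + 1) + (sig i w).2 = w.count i + (sig i w).1 := by
  induction w with
  | nil => rfl
  | cons x w ih =>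
    rw [sig_cons, List.count_cons, List.count_cons]
    unfold letterSig sigMul
    by_cases h1 : x = i
    · subst h1; simp; omega
    · by_cases h2 : x = i + 1
      · subst h2; simp; omega
      · simp [h1, h2]; omega

/-- An i + 1 is unmatched exactly when some suffix has more i + 1 than i; this links the lattice
condition with the crystal. -/
theorem sig_fst_eq_zero_iff (i : ℕ) (w : List ℕ) :
    (sig i w).1 = 0 ↔ ∀ v, v <:+ w → v.count (i + 1) ≤ v.count i := by
  constructor
  · rintro h v ⟨u, rfl⟩
    rw [sig_append] at h
    have := sig_count i v
    simp only [sigMul] at h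
    omega
  · induction w with
    | nil => intro; rfl
    | cons x w ih =>
      intro h
      have h1 := ih fun v hv => h v (hv.trans (List.suffix_cons x w))
      have h2 := h _ List.suffix_rfl
      have h3 := sig_count i w
      rw [sig_cons]
      rw [List.count_cons, List.count_cons] at h2
      unfold letterSig sigMul
      by_cases h4 : x = i
      · subst h4; simp; omega
      · by_cases h5 : x = i + 1
        · subst h5; simp at h2 ⊢; omega
        · simp [h4, h5]; omega

theorem sig_snd_eq_zero_iff (i : ℕ) (w : List ℕ) :
    (sig i w).2 = 0 ↔ ∀ v, v <+: w → v.count i ≤ v.count (i + 1) := by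
  constructor
  · rintro h v ⟨u, rfl⟩
    rw [sig_append] at h
    have := sig_count i v
    simp only [sigMul] at h
    omega
  · induction w using List.reverseRecOn with
    | nil => intro; rfl
    | append_singleton w x ih =>
      intro h
      have h1 := ih fun v hv => h v (hv.trans (List.prefix_append w _))
      have h2 := h _ List.prefix_rfl
      have h3 := sig_count i w
      rw [sig_append, sig_singleton]
      rw [List.count_append, List.count_append, List.count_singleton, List.count_singleton] at h2
      unfold letterSig sigMul
      by_cases h4 : x = i
      · subst h4; simp at h2 ⊢; omega
      · by_cases h5 : x = i + 1
        · subst h5; simp; omega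
        · simp [h4, h5]; omega

theorem isLattice_filter_iff (A : Finset ℕ) (w : List ℕ) :
    IsLattice A (w.filter (· ∈ A)) ↔ ∀ x, x ∈ A → x + 1 ∈ A → (sig x w).1 = 0 := by
  constructor
  · intro h x hx hx'
    rw [← sig_filter x (· ∈ A) (by simpa) (by simpa), sig_fst_eq_zero_iff]
    exact fun v hv => h v hv x hx hx'
  · intro h v hv x hx hx'
    have := h x hx hx'
    rw [← sig_filter x (· ∈ A) (by simpa) (by simpa), sig_fst_eq_zero_iff] at this
    exact this v hv

/-! ### The lowering operators -/

/-- `w'` is obtained from `w` by the crystal lowering operator `f_i`: the rightmost unmatched `i`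
is replaced by `i + 1`. -/
def Lower (i : ℕ) (w w' : List ℕ) : Prop :=
  ∃ u v, w = u ++ i :: v ∧ w' = u ++ (i + 1) :: v ∧ (sig i u).1 = 0 ∧ (sig i v).2 = 0

theorem Lower.sig_eq {i : ℕ} {w w' : List ℕ} (h : Lower i w w') :
    ∃ e f, sig i w = (e, f + 1) ∧ sig i w' = (e + 1, f) := by
  obtain ⟨u, v, rfl, rfl, hu, hv⟩ := h
  refine ⟨(sig i v).1, (sig i u).2, ?_, ?_⟩ <;>
  · rw [sig_append, sig_cons]
    simp only [letterSig_self, letterSig_succ]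
    ext <;> simp only [sigMul] <;> omega

theorem Lower.snd_pos {i : ℕ} {w w' : List ℕ} (h : Lower i w w') : 0 < (sig i w).2 := by
  obtain ⟨e, f, h, -⟩ := h.sig_eq; simp [h]

/-- The tensor product rule: under `hu` the unmatched i + 1 of `u` cannot use up all the unmatched i
of `v`, so the rightmost i left over lies in `v`. `Lower.append_right` is the complementary case,
and `lower_append` says that there are no others. -/
theorem Lower.append_left {i : ℕ} {u v v' : List ℕ} (h : Lower i v v')
    (hu : (sig i u).1 < (sig i v).2) : Lower i (u ++ v) (u ++ v') := by
  obtain ⟨a, b, rfl, rfl, ha, hb⟩ := h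
  refine ⟨u ++ a, b, by simp, by simp, ?_, hb⟩
  rw [sig_append, sig_cons, letterSig_self] at hu
  rw [sig_append]
  simp only [sigMul] at *
  omega

theorem Lower.append_right {i : ℕ} {u u' v : List ℕ} (h : Lower i u u')
    (hv : (sig i v).2 ≤ (sig i u).1) : Lower i (u ++ v) (u' ++ v) := by
  obtain ⟨a, b, rfl, rfl, ha, hb⟩ := h
  refine ⟨a, b ++ v, by simp, by simp, ha, ?_⟩
  rw [sig_append, sig_cons, letterSig_self] at hv
  rw [sig_append]
  simp only [sigMul] at *
  omega

theorem lower_append {i : ℕ} {u v z : List ℕ} (h : Lower i (u ++ v) z) :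
    ((sig i u).1 < (sig i v).2 ∧ ∃ v', Lower i v v' ∧ z = u ++ v') ∨
    ((sig i v).2 ≤ (sig i u).1 ∧ ∃ u', Lower i u u' ∧ z = u' ++ v) := by
  obtain ⟨a, b, hab, rfl, ha, hb⟩ := h
  rcases List.append_eq_append_iff.1 hab with ⟨a', rfl, rfl⟩ | ⟨b', rfl, h2⟩
  · left
    rw [sig_append] at ha
    refine ⟨?_, a' ++ (i + 1) :: b, ⟨a', b, rfl, rfl, ?_, hb⟩, by simp⟩
    · rw [sig_append, sig_cons, letterSig_self]
      simp only [sigMul] at *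
      omega
    · simp only [sigMul] at *
      omega
  · cases b' with
    | nil =>
      simp at h2
      subst h2
      left
      refine ⟨?_, (i + 1) :: b, ⟨[], b, rfl, rfl, rfl, hb⟩, by simp⟩
      rw [sig_cons, letterSig_self]
      simp only [sigMul, List.append_nil] at *
      omega
    | cons y b' =>
      simp at h2
      obtain ⟨rfl, rfl⟩ := h2
      right
      rw [sig_append] at hb
      refine ⟨?_, a ++ (i + 1) :: b', ⟨a, b', rfl, rfl, ha, ?_⟩, by simp⟩
      · rw [sig_append, sig_cons, letterSig_self]
        simp only [sigMul] at *
        omega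
      · simp only [sigMul] at *
        omega

theorem lower_cons {i x : ℕ} {w z : List ℕ} (h : Lower i (x :: w) z) :
    (∃ w', z = x :: w' ∧ Lower i w w') ∨ (x = i ∧ z = (i + 1) :: w ∧ (sig i w).2 = 0) := by
  obtain ⟨u, v, h1, rfl, hu, hv⟩ := h
  cases u with
  | nil => simp at h1; obtain ⟨rfl, rfl⟩ := h1; exact .inr ⟨rfl, rfl, hv⟩
  | cons y u =>
    simp at h1
    obtain ⟨rfl, rfl⟩ := h1
    refine .inl ⟨_, rfl, u, v, rfl, rfl, ?_, hv⟩
    rw [sig_cons] at hu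
    simp only [sigMul] at hu
    omega

theorem Lower.unique {i : ℕ} {w a b : List ℕ} (ha : Lower i w a) (hb : Lower i w b) : a = b := by
  induction w generalizing a b with
  | nil => obtain ⟨u, v, h, -⟩ := ha; simp at h
  | cons x w ih =>
    rcases lower_cons ha with ⟨a', rfl, ha'⟩ | ⟨rfl, rfl, ha'⟩ <;>
    rcases lower_cons hb with ⟨b', rfl, hb'⟩ | ⟨h, rfl, hb'⟩
    · rw [ih ha' hb']
    · have := ha'.snd_pos; omega
    · have := hb'.snd_pos; omega
    · rfl

theorem exists_lower {i : ℕ} {w : List ℕ} (h : 0 < (sig i w).2) : ∃ w', Lower i w w' := by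
  induction w with
  | nil => simp at h
  | cons x w ih =>
    by_cases hw : (letterSig i x).1 < (sig i w).2
    · obtain ⟨w', hw'⟩ := ih (by omega)
      exact ⟨[x] ++ w', Lower.append_left (u := [x]) hw' (by rwa [sig_singleton])⟩
    · have hx : x = i := by
        by_contra hx
        rw [sig_cons] at h
        unfold letterSig sigMul at *
        split_ifs at h hw <;> simp at h hw <;> omega
      subst hx
      refine ⟨(x + 1) :: w, [], w, rfl, rfl, rfl, ?_⟩
      rw [letterSig_self] at hw
      omega

/-- The operator e_i, inverse to f_i: it applies to the leftmost unmatched i + 1. -/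
theorem exists_raise {i : ℕ} {w : List ℕ} (h : 0 < (sig i w).1) : ∃ w', Lower i w' w := by
  induction w with
  | nil => simp at h
  | cons x w ih =>
    by_cases hx : x = i + 1 ∧ (sig i w).2 = 0
    · obtain ⟨rfl, hw⟩ := hx
      exact ⟨i :: w, [], w, rfl, rfl, rfl, hw⟩
    · have hw : 0 < (sig i w).1 := by
        rw [sig_cons] at h
        unfold letterSig sigMul at h
        split_ifs at h <;> simp at h <;> omega
      obtain ⟨w', hw'⟩ := ih hw
      refine ⟨[x] ++ w', Lower.append_left (u := [x]) hw' ?_⟩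
      obtain ⟨e, f, h1, h2⟩ := hw'.sig_eq
      rw [sig_singleton, h1]
      rw [h2] at hx
      unfold letterSig
      split_ifs <;> simp
      omega

theorem Lower.filter {i : ℕ} {w w' : List ℕ} (h : Lower i w w') (p : ℕ → Bool) (hi : p i)
    (hi' : p (i + 1)) : Lower i (w.filter p) (w'.filter p) := by
  obtain ⟨u, v, rfl, rfl, hu, hv⟩ := h
  refine ⟨u.filter p, v.filter p, by simp [hi], by simp [hi'], ?_, ?_⟩ <;>
  rwa [sig_filter i p hi hi']

theorem Lower.forall₂ {i : ℕ} {w w' : List ℕ} (h : Lower i w w') :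
    List.Forall₂ (fun x x' => x' = x ∨ (x = i ∧ x' = i + 1)) w w' := by
  obtain ⟨u, v, rfl, rfl, -, -⟩ := h
  refine List.rel_append (List.forall₂_same.2 fun _ _ => .inl rfl) ?_
  exact .cons (.inr ⟨rfl, rfl⟩) (List.forall₂_same.2 fun _ _ => .inl rfl)

theorem Lower.length_eq {i : ℕ} {w w' : List ℕ} (h : Lower i w w') : w.length = w'.length :=
  h.forall₂.length_eq

theorem Lower.sum_eq {i : ℕ} {w w' : List ℕ} (h : Lower i w w') : w'.sum = w.sum + 1 := by
  obtain ⟨u, v, rfl, rfl, -, -⟩ := h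
  simp; omega

/-! ### Column insertion and the crystal operators -/

/-! ### Insertion into a single column. -/

theorem sig_fst_of_notMem {i : ℕ} {w : List ℕ} (h : i + 1 ∉ w) : (sig i w).1 = 0 := by
  rw [sig_fst_eq_zero_iff]
  intro v hv
  rw [List.count_eq_zero.2 fun h' => h (hv.subset h')]
  exact Nat.zero_le _

theorem sig_snd_of_notMem {i : ℕ} {w : List ℕ} (h : i ∉ w) : (sig i w).2 = 0 := by
  rw [sig_snd_eq_zero_iff]
  intro v hv
  rw [List.count_eq_zero.2 fun h' => h (hv.subset h')]
  exact Nat.zero_le _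

theorem bumpColumn_of_lt {x : ℕ} {c : List ℕ} (h : ∀ z ∈ c, z < x) :
    bumpColumn x c = (c ++ [x], none) := by
  induction c with
  | nil => rfl
  | cons y c ih =>
    rw [bumpColumn, if_neg (by have := h y (by simp); omega), ih fun z hz => h z (by simp [hz])]
    rfl

theorem bumpColumn_append {x y : ℕ} {a b : List ℕ} (h : ∀ z ∈ a, z < x) (hy : x ≤ y) :
    bumpColumn x (a ++ y :: b) = (a ++ x :: b, some y) := by
  induction a with
  | nil => simp [bumpColumn, hy]
  | cons z a ih =>
    rw [List.cons_append, bumpColumn, if_neg (by have := h z (by simp); omega),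
      ih fun z hz => h z (by simp [hz])]
    rfl

theorem exists_split (x : ℕ) (c : List ℕ) :
    (∀ z ∈ c, z < x) ∨ ∃ a y b, c = a ++ y :: b ∧ (∀ z ∈ a, z < x) ∧ x ≤ y := by
  induction c with
  | nil => simp
  | cons z c ih =>
    by_cases hz : x ≤ z
    · exact .inr ⟨[], z, c, rfl, by simp, hz⟩
    · rcases ih with h | ⟨a, y, b, rfl, ha, hy⟩
      · left; simp only [List.mem_cons]; rintro w (rfl | hw)
        · omega
        · exact h w hw
      · refine .inr ⟨z :: a, y, b, rfl, ?_, hy⟩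
        simp only [List.mem_cons]; rintro w (rfl | hw)
        · omega
        · exact ha w hw

/-- Strictly increasing lists. -/
abbrev Sorted (c : List ℕ) : Prop := c.Pairwise (· < ·)

theorem sorted_split {a b : List ℕ} {y : ℕ} (h : Sorted (a ++ y :: b)) :
    Sorted a ∧ Sorted b ∧ (∀ z ∈ a, z < y) ∧ (∀ z ∈ b, y < z) := by
  rw [Sorted, List.pairwise_append, List.pairwise_cons] at h
  exact ⟨h.1, h.2.1.2, fun z hz => h.2.2 z hz y (by simp), h.2.1.1⟩

theorem sorted_of_split {a b : List ℕ} {y : ℕ} (ha : Sorted a) (hb : Sorted b)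
    (h1 : ∀ z ∈ a, z < y) (h2 : ∀ z ∈ b, y < z) : Sorted (a ++ y :: b) := by
  rw [Sorted, List.pairwise_append, List.pairwise_cons]
  refine ⟨ha, ⟨h2, hb⟩, fun z hz w hw => ?_⟩
  rcases List.mem_cons.1 hw with rfl | hw
  · exact h1 z hz
  · exact (h1 z hz).trans (h2 w hw)

/-- The two possible outcomes of inserting a letter into a column. -/
theorem bumpColumn_cases (x : ℕ) {c : List ℕ} (hc : Sorted c) :
    (bumpColumn x c = (c ++ [x], none) ∧ Sorted (c ++ [x]) ∧ ∀ z ∈ c, z < x) ∨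
    ∃ a y b, c = a ++ y :: b ∧ bumpColumn x c = (a ++ x :: b, some y) ∧
      Sorted (a ++ x :: b) ∧ (∀ z ∈ a, z < x) ∧ x ≤ y ∧ (∀ z ∈ b, y < z) := by
  rcases exists_split x c with h | ⟨a, y, b, rfl, ha, hy⟩
  · exact .inl ⟨bumpColumn_of_lt h, sorted_of_split hc .nil h (by simp), h⟩
  · obtain ⟨h1, h2, h3, h4⟩ := sorted_split hc
    exact .inr ⟨a, y, b, rfl, bumpColumn_append ha hy,
      sorted_of_split h1 h2 ha fun z hz => hy.trans_lt (h4 z hz), ha, hy, h4⟩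

/-- The two words are Knuth equivalent. Since a < x ≤ y < b, the signatures of `a` and `b` are so
restricted (A1–A3, B1–B3) that only a finite comparison of the values of x and y with i and i + 1
remains. -/
theorem sig_bump (i : ℕ) {x y : ℕ} {a b : List ℕ} (h : Sorted (a ++ y :: b))
    (ha : ∀ z ∈ a, z < x) (hy : x ≤ y) :
    sig i (x :: (a ++ y :: b).reverse) = sig i ((a ++ x :: b).reverse ++ [y]) := by
  obtain ⟨-, -, -, hb⟩ := sorted_split h
  simp only [List.reverse_append, List.reverse_cons, List.append_assoc, List.cons_append,
    sig_append, sig_cons, sig_nil, List.nil_append]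
  have A1 : i + 1 < x ∨ sig i a.reverse = (0, (sig i a.reverse).2) := by
    by_contra! hc
    exact hc.2 (Prod.ext (sig_fst_of_notMem fun hm => by
      have := ha _ (List.mem_reverse.1 hm); omega) rfl)
  have A2 : x ≤ i → sig i a.reverse = (0, 0) := fun hx => sig_eq_one fun z hz => by
    have := ha z (List.mem_reverse.1 hz); omega
  have B1 : y < i ∨ sig i b.reverse = ((sig i b.reverse).1, 0) := by
    by_contra! hc
    exact hc.2 (Prod.ext rfl (sig_snd_of_notMem fun hm => by
      have := hb _ (List.mem_reverse.1 hm); omega))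
  have B2 : i + 1 ≤ y → sig i b.reverse = (0, 0) := fun hx => sig_eq_one fun z hz => by
    have := hb z (List.mem_reverse.1 hz); omega
  have B3 : y = i → (sig i b.reverse).1 ≤ 1 := by
    rintro rfl
    have h1 := sig_count y b.reverse
    have h2 : b.reverse.count (y + 1) ≤ 1 :=
      List.nodup_iff_count_le_one.1 (List.nodup_reverse.2 ((sorted_split h).2.1.imp
        fun h => h.ne)) _
    have h3 : b.reverse.count y = 0 := List.count_eq_zero.2 fun hm => by
      have := hb _ (List.mem_reverse.1 hm); omega
    have h4 : (sig y b.reverse).2 = 0 := sig_snd_of_notMem fun hm => by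
      have := hb _ (List.mem_reverse.1 hm); omega
    omega
  have A3 : x = i + 1 → (sig i a.reverse).2 ≤ 1 := by
    rintro rfl
    have h1 := sig_count i a.reverse
    have h2 : a.reverse.count i ≤ 1 :=
      List.nodup_iff_count_le_one.1 (List.nodup_reverse.2 ((sorted_split h).1.imp
        fun h => h.ne)) _
    have h3 : a.reverse.count (i + 1) = 0 := List.count_eq_zero.2 fun hm => by
      have := ha _ (List.mem_reverse.1 hm); omega
    have h4 : (sig i a.reverse).1 = 0 := sig_fst_of_notMem fun hm => by
      have := ha _ (List.mem_reverse.1 hm); omega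
    omega
  generalize sig i a.reverse = p at *
  generalize sig i b.reverse = q at *
  obtain ⟨p1, p2⟩ := p
  obtain ⟨q1, q2⟩ := q
  simp only [Prod.mk.injEq, true_and, and_true] at *
  unfold letterSig sigMul
  split_ifs <;> ext <;> simp <;> omega

/-- One bumping step commutes with f_i. The lowered letter may be the inserted one or one of the
column, and after the bump it may have become the bumped letter; the word "new column, bumped
letter" covers all these cases at once. -/
theorem Lower.bump {i x x2 : ℕ} {c c2 : List ℕ} (hc : Sorted c) (hc2 : Sorted c2)
    (h : Lower i (x :: c.reverse) (x2 :: c2.reverse)) :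
    (bumpColumn x c = (c ++ [x], none) ∧ bumpColumn x2 c2 = (c2 ++ [x2], none)) ∨
    ∃ y y2 c1 c1', bumpColumn x c = (c1, some y) ∧ bumpColumn x2 c2 = (c1', some y2) ∧
      Lower i (c1.reverse ++ [y]) (c1'.reverse ++ [y2]) := by
  obtain ⟨u, v, h1, h2, hu, hv⟩ := h
  cases u with
  | nil =>
    simp only [List.nil_append, List.cons.injEq] at h1 h2
    obtain ⟨rfl, rfl⟩ := h1
    obtain ⟨rfl, h2⟩ := h2
    obtain rfl := List.reverse_injective h2
    rcases exists_split x c2 with h | ⟨a, y, b, rfl, ha, hy⟩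
    · exact .inl ⟨bumpColumn_of_lt h, bumpColumn_of_lt fun z hz => (h z hz).trans (by omega)⟩
    · obtain ⟨-, hb', -, hb⟩ := sorted_split hc
      right
      rcases hy.eq_or_lt with rfl | hy
      -- The inserted letter is the i to be lowered, so the i in the column must be matched, which
      -- forces an i + 1 just below it. Then i bumps i while i + 1 bumps i + 1: the columns coincide
      -- and the bumped letter is the lowered one.
      · have hm : x + 1 ∈ b := by
          by_contra hm
          have : sig x b.reverse = (0, 0) := sig_eq_one fun z hz => by
            have := hb z (List.mem_reverse.1 hz)
            refine ⟨by omega, ?_⟩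
            rintro rfl
            exact hm (List.mem_reverse.1 hz)
          have h3 : (sig x a.reverse).1 = 0 := sig_fst_of_notMem fun hm => by
            have := ha _ (List.mem_reverse.1 hm); omega
          simp [sig_append, this, letterSig_self, sigMul, sig_cons] at hv
        cases b with
        | nil => simp at hm
        | cons z b =>
          have hz : z = x + 1 := by
            have h1 := hb z (by simp)
            rw [List.mem_cons] at hm
            rcases hm with hm | hm
            · exact hm.symm
            · have := (List.pairwise_cons.1 hb').1 _ hm
              omega
          subst hz
          have e : ∀ z ∈ a ++ [x], z < x + 1 := by
            intro z hz
            rcases List.mem_append.1 hz with hz | hz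
            · have := ha z hz; omega
            · simp at hz; omega
          refine ⟨_, _, _, _, bumpColumn_append ha le_rfl,
            by simpa using bumpColumn_append (b := b) e le_rfl, ?_⟩
          refine ⟨(a ++ x :: (x + 1) :: b).reverse, [], by simp, by simp, ?_, rfl⟩
          simp only [List.reverse_append, List.reverse_cons, List.append_assoc]
          have h3 : sig x b.reverse = (0, 0) := sig_eq_one fun z hz => by
            have := (List.pairwise_cons.1 hb').1 z (List.mem_reverse.1 hz)
            omega
          have h4 : (sig x a.reverse).1 = 0 := sig_fst_of_notMem fun hm => by
            have := ha _ (List.mem_reverse.1 hm); omega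
          simp [sig_append, sig_cons, h3, letterSig_self, letterSig_succ, sigMul, h4]
      · refine ⟨_, _, _, _, bumpColumn_append ha hy.le, bumpColumn_append
          (fun z hz => (ha z hz).trans (by omega)) (show x + 1 ≤ y by omega), ?_⟩
        refine ⟨b.reverse, a.reverse ++ [y], by simp, by simp, ?_, ?_⟩
        · exact sig_fst_of_notMem fun hm => by
            have := hb _ (List.mem_reverse.1 hm); omega
        · refine sig_snd_of_notMem fun hm => ?_
          rcases List.mem_append.1 hm with hm | hm
          · have := ha _ (List.mem_reverse.1 hm); omega
          · simp at hm; omega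
  | cons x' u =>
    simp only [List.cons_append, List.cons.injEq] at h1 h2
    obtain ⟨rfl, h1⟩ := h1
    obtain ⟨rfl, h2⟩ := h2
    obtain rfl : c = v.reverse ++ i :: u.reverse := by
      apply List.reverse_injective; simp [h1]
    obtain rfl : c2 = v.reverse ++ (i + 1) :: u.reverse := by
      apply List.reverse_injective; simp [h2]
    generalize ha : v.reverse = a at *
    generalize hb : u.reverse = b at *
    obtain rfl : u = b.reverse := by simp [← hb]
    obtain rfl : v = a.reverse := by simp [← ha]
    obtain ⟨-, -, ha1, -⟩ := sorted_split hc
    obtain ⟨-, -, -, hb1⟩ := sorted_split hc2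
    have hbs : sig i b.reverse = (0, 0) := sig_eq_one fun z hz => by
      have := hb1 z (List.mem_reverse.1 hz); omega
    -- An inserted i + 1 would be unmatched to the left of the lowered i, as the part of the column
    -- read in between contains neither i nor i + 1.
    have hx : x2 ≠ i + 1 := by
      rintro rfl
      simp [sig_cons, hbs, letterSig_succ] at hu
    rcases lt_or_ge i x2 with hlt | hge
    · rcases exists_split x2 b with h | ⟨a', y, b', rfl, ha', hy⟩
      · left
        constructor <;>
        · apply bumpColumn_of_lt
          intro z hz
          rcases List.mem_append.1 hz with hz | hz
          · have := ha1 z hz; omega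
          · rcases List.mem_cons.1 hz with rfl | hz
            · omega
            · exact h z hz
      · right
        have e : ∀ q : ℕ, (∀ z ∈ a, z < q) → q < x2 →
            bumpColumn x2 (a ++ q :: (a' ++ y :: b')) = (a ++ q :: (a' ++ x2 :: b'), some y) := by
          intro q hq hq'
          have := bumpColumn_append (x := x2) (y := y) (a := a ++ q :: a') (b := b') ?_ hy
          · simpa using this
          · intro z hz
            rcases List.mem_append.1 hz with hz | hz
            · exact (hq z hz).trans hq'
            · rcases List.mem_cons.1 hz with rfl | hz
              · exact hq'
              · exact ha' z hz
        refine ⟨_, _, _, _, e i ha1 hlt, e (i + 1) (fun z hz => (ha1 z hz).trans (by omega))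
          (by omega), (a' ++ x2 :: b').reverse, a.reverse ++ [y], by simp, by simp, ?_, ?_⟩
        · refine sig_fst_of_notMem fun hm => ?_
          simp only [List.mem_reverse, List.mem_append, List.mem_cons] at hm
          rcases hm with hm | hm | hm
          · have := hb1 (i + 1) (by simp [hm]); omega
          · omega
          · have := hb1 (i + 1) (by simp [hm]); omega
        · refine sig_snd_of_notMem fun hm => ?_
          simp only [List.mem_reverse, List.mem_append, List.mem_singleton] at hm
          rcases hm with hm | hm
          · have := ha1 _ hm; omega
          · omega
    · right
      rcases exists_split x2 a with h | ⟨a', y, b', rfl, ha', hy⟩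
      · refine ⟨_, _, _, _, bumpColumn_append h hge, bumpColumn_append h (by omega),
          (a ++ x2 :: b).reverse, [], by simp, by simp, ?_, rfl⟩
        refine sig_fst_of_notMem fun hm => ?_
        simp only [List.mem_reverse, List.mem_append, List.mem_cons] at hm
        rcases hm with hm | hm | hm
        · have := ha1 _ hm; omega
        · omega
        · have := hb1 _ hm; omega
      · have e : ∀ q : ℕ, bumpColumn x2 ((a' ++ y :: b') ++ q :: b) =
            (a' ++ x2 :: (b' ++ q :: b), some y) := by
          intro q
          simpa using bumpColumn_append (b := b' ++ q :: b) ha' hy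
        refine ⟨_, _, _, _, e i, e (i + 1), b.reverse, (a' ++ x2 :: b').reverse ++ [y], by simp,
          by simp, by simp [hbs], ?_⟩
        refine sig_snd_of_notMem fun hm => ?_
        have h3 := ha1 y (by simp)
        simp only [List.mem_reverse, List.mem_append, List.mem_cons,
          List.not_mem_nil, or_false] at hm
        rcases hm with (hm | hm | hm) | hm
        · have := ha' _ hm; omega
        · omega
        · have := ha1 i (by simp [hm]); omega
        · omega

/-- The column-reading word of a tableau given by its columns: the columns are read from left to
right, each one from bottom to top. -/
def colWord (cs : List (List ℕ)) : List ℕ := cs.flatMap List.reverse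

@[simp] theorem colWord_nil : colWord [] = [] := rfl

@[simp] theorem colWord_cons (c : List ℕ) (cs : List (List ℕ)) :
    colWord (c :: cs) = c.reverse ++ colWord cs := rfl

@[simp] theorem colWord_append (cs ds : List (List ℕ)) :
    colWord (cs ++ ds) = colWord cs ++ colWord ds := by
  simp [colWord]

/-- The lengths of the columns. -/
abbrev lens (cs : List (List ℕ)) : List ℕ := cs.map List.length

/-- All columns are strictly increasing. -/
abbrev SortedCols (cs : List (List ℕ)) : Prop := ∀ c ∈ cs, Sorted c

/-! ### Insertion into a whole tableau. -/

theorem columnInsert_cons_none {x : ℕ} {c c' : List ℕ} {cs : List (List ℕ)}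
    (h : bumpColumn x c = (c', none)) : columnInsert x (c :: cs) = (c' :: cs, 0) := by
  rw [columnInsert, h]

theorem columnInsert_cons_some {x y : ℕ} {c c' : List ℕ} {cs : List (List ℕ)}
    (h : bumpColumn x c = (c', some y)) : columnInsert x (c :: cs) =
      (c' :: (columnInsert y cs).1, (columnInsert y cs).2 + 1) := by
  rw [columnInsert, h]

theorem sortedCols_columnInsert (x : ℕ) {cs : List (List ℕ)} (h : SortedCols cs) :
    SortedCols (columnInsert x cs).1 := by
  induction cs generalizing x with
  | nil => simp [columnInsert, SortedCols]
  | cons c cs ih =>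
    simp only [SortedCols, List.forall_mem_cons] at h ih ⊢
    rcases bumpColumn_cases x h.1 with ⟨e, h1, -⟩ | ⟨a, y, b, rfl, e, h1, -⟩
    · rw [columnInsert_cons_none e]; exact List.forall_mem_cons.2 ⟨h1, h.2⟩
    · rw [columnInsert_cons_some e]; exact List.forall_mem_cons.2 ⟨h1, ih y h.2⟩

/-- Apply `sig_bump` column after column: the letter in transit moves to the right through the
column word. -/
theorem sig_columnInsert (i x : ℕ) {cs : List (List ℕ)} (h : SortedCols cs) :
    sig i (colWord (columnInsert x cs).1) = sig i (x :: colWord cs) := by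
  induction cs generalizing x with
  | nil => simp [columnInsert]
  | cons c cs ih =>
    simp only [SortedCols, List.forall_mem_cons] at h ih
    rcases bumpColumn_cases x h.1 with ⟨e, h1, -⟩ | ⟨a, y, b, rfl, e, h1, ha, hy, -⟩
    · rw [columnInsert_cons_none e]; simp
    · rw [columnInsert_cons_some e, colWord_cons, sig_append, ih y h.2, ← sig_append,
        List.append_cons, sig_append, ← sig_bump i h.1 ha hy, ← sig_append]
      rfl

theorem perm_columnInsert (x : ℕ) {cs : List (List ℕ)} (h : SortedCols cs) :
    (colWord (columnInsert x cs).1).Perm (x :: colWord cs) := by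
  induction cs generalizing x with
  | nil => simp [columnInsert]
  | cons c cs ih =>
    simp only [SortedCols, List.forall_mem_cons] at h ih
    rcases bumpColumn_cases x h.1 with ⟨e, h1, -⟩ | ⟨a, y, b, rfl, e, h1, ha, hy, -⟩
    · rw [columnInsert_cons_none e]; simp
    · rw [columnInsert_cons_some e, colWord_cons, colWord_cons]
      refine ((ih y h.2).append_left _).trans ?_
      rw [List.perm_iff_count]
      intro z
      simp only [List.count_append, List.count_reverse, List.count_cons]
      omega

theorem nonempty_columnInsert (x : ℕ) {cs : List (List ℕ)} (h : [] ∉ cs) :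
    [] ∉ (columnInsert x cs).1 := by
  induction cs generalizing x with
  | nil => simp [columnInsert]
  | cons c cs ih =>
    rw [List.mem_cons, not_or] at h
    rcases exists_split x c with h1 | ⟨a, y, b, rfl, ha, hy⟩
    · rw [columnInsert_cons_none (bumpColumn_of_lt h1)]; simp [h.2]
    · rw [columnInsert_cons_some (bumpColumn_append ha hy)]; simp [ih y h.2]

/-- Add one to the entry with the given index, or append an entry `1`. -/
def addCell : ℕ → List ℕ → List ℕ
  | 0, [] => [1]
  | 0, l :: ls => (l + 1) :: ls
  | j + 1, [] => 0 :: addCell j []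
  | j + 1, l :: ls => l :: addCell j ls

theorem lens_columnInsert (x : ℕ) (cs : List (List ℕ)) :
    lens (columnInsert x cs).1 = addCell (columnInsert x cs).2 (lens cs) := by
  induction cs generalizing x with
  | nil => simp [columnInsert, addCell]
  | cons c cs ih =>
    rcases exists_split x c with h1 | ⟨a, y, b, rfl, ha, hy⟩
    · rw [columnInsert_cons_none (bumpColumn_of_lt h1)]; simp [addCell]
    · rw [columnInsert_cons_some (bumpColumn_append ha hy)]
      simpa [addCell] using ih y

theorem lens_appendToColumn (m j : ℕ) (cs : List (List ℕ)) :
    lens (appendToColumn m j cs) = addCell j (lens cs) := by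
  induction j generalizing cs with
  | zero => cases cs <;> simp [appendToColumn, addCell]
  | succ j ih =>
    cases cs with
    | nil => exact congrArg (0 :: ·) (ih [])
    | cons c cs => exact congrArg (c.length :: ·) (ih cs)

theorem colWord_inj {cs ds : List (List ℕ)} (h : lens cs = lens ds)
    (hw : colWord cs = colWord ds) : cs = ds := by
  induction cs generalizing ds with
  | nil => simpa using h.symm
  | cons c cs ih =>
    cases ds with
    | nil => simp at h
    | cons d ds =>
      simp only [List.map_cons, List.cons.injEq] at h
      obtain ⟨h1, h2⟩ := List.append_inj hw (by simpa using h.1)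
      rw [List.reverse_injective h1, ih h.2 h2]

/-- By the tensor product rule f_i acts either on the first column together with the inserted
letter, where `Lower.bump` applies, or on the later columns. Since bumping preserves signatures, the
rule makes the same choice after the bump, and the induction continues with the bumped letter. The
path of insertion ends in the same column for both words. -/
theorem Lower.columnInsert {i x x2 : ℕ} {cs cs2 : List (List ℕ)} (hc : SortedCols cs)
    (hc2 : SortedCols cs2) (hl : lens cs = lens cs2)
    (h : Lower i (x :: colWord cs) (x2 :: colWord cs2)) :
    (columnInsert x cs).2 = (columnInsert x2 cs2).2 ∧
      Lower i (colWord (columnInsert x cs).1) (colWord (columnInsert x2 cs2).1) := by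
  induction cs generalizing x x2 cs2 with
  | nil =>
    obtain rfl : cs2 = [] := by simpa using hl.symm
    simpa [RectLR.columnInsert] using h
  | cons c cs ih =>
    cases cs2 with
    | nil => simp at hl
    | cons c2 cs2 =>
    simp only [SortedCols, List.forall_mem_cons] at hc hc2 ih
    simp only [List.map_cons, List.cons.injEq] at hl
    have h' : Lower i ((x :: c.reverse) ++ colWord cs) ((x2 :: c2.reverse) ++ colWord cs2) := h
    rcases lower_append h' with ⟨hlt, v', hv', e⟩ | ⟨hle, u', hu', e⟩
    · obtain ⟨e1, rfl⟩ := List.append_inj e (by simp [hl])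
      simp only [List.cons.injEq] at e1
      obtain ⟨rfl, e1⟩ := e1
      obtain rfl := List.reverse_injective e1
      rcases bumpColumn_cases x2 hc.1 with ⟨e, h1, -⟩ | ⟨a, y, b, rfl, e, h1, ha, hy, -⟩
      · rw [columnInsert_cons_none e, columnInsert_cons_none e]
        simpa using h
      · rw [columnInsert_cons_some e, columnInsert_cons_some e]
        rw [sig_bump i hc.1 ha hy] at hlt
        have hM := hv'.append_left hlt
        rw [List.append_assoc, List.append_assoc] at hM
        rcases lower_append hM with ⟨hlt2, v2, hv2, e2⟩ | ⟨hle2, u2, hu2, e2⟩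
        · obtain rfl := List.append_cancel_left e2
          obtain ⟨i1, i2⟩ := ih hc.2 hc2.2 hl.2 hv2
          refine ⟨by simp [i1], i2.append_left ?_⟩
          rwa [sig_columnInsert i y hc.2]
        -- Excluded: the later columns would be unchanged, although f_i has raised their sum by one.
        · obtain ⟨e3, e4⟩ := List.append_inj e2 (by rw [hu2.length_eq])
          simp only [List.singleton_append, List.cons.injEq, true_and] at e4
          have := hv'.sum_eq
          rw [e4] at this
          omega
    · obtain ⟨rfl, e1⟩ := List.append_inj e (by rw [← hu'.length_eq]; simp [hl])
      obtain rfl := colWord_inj hl.2 e1.symm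
      rcases hu'.bump hc.1 hc2.1 with ⟨b1, b2⟩ | ⟨y, y2, c1, c1', b1, b2, h3⟩
      · rw [columnInsert_cons_none b1, columnInsert_cons_none b2]
        simpa using h
      · rw [columnInsert_cons_some b1, columnInsert_cons_some b2]
        have hs : sig i (x :: c.reverse) = sig i (c1.reverse ++ [y]) := by
          rcases bumpColumn_cases x hc.1 with ⟨e, h1, -⟩ | ⟨a, y, b, rfl, e, h1, ha, hy, -⟩
          · rw [e] at b1; simp at b1
          · rw [e] at b1
            simp only [Prod.mk.injEq, Option.some.injEq] at b1
            obtain ⟨rfl, rfl⟩ := b1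
            exact sig_bump i hc.1 ha hy
        rw [hs] at hle
        have hM := h3.append_right hle
        rw [List.append_assoc, List.append_assoc] at hM
        rcases lower_append hM with ⟨hlt2, v2, hv2, e2⟩ | ⟨hle2, u2, hu2, e2⟩
        · have h4 : c1.length = c1'.length := by
            have := hM.length_eq
            simpa using this
          obtain ⟨e3, rfl⟩ := List.append_inj e2 (by simp [h4])
          obtain rfl := List.reverse_injective e3
          obtain ⟨i1, i2⟩ := ih hc.2 hc2.2 rfl hv2
          refine ⟨by simp [i1], i2.append_left ?_⟩
          rwa [sig_columnInsert i y hc.2]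
        · have h4 : c1.length = c1'.length := by
            have := hM.length_eq
            simpa using this
          obtain ⟨rfl, e4⟩ := List.append_inj e2 (by rw [← hu2.length_eq]; simp [h4])
          simp only [List.singleton_append, List.cons.injEq, and_true] at e4
          subst e4
          refine ⟨rfl, hu2.append_right (v := colWord (RectLR.columnInsert y2 cs).1) ?_⟩
          rwa [sig_columnInsert i y2 hc.2]

/-! ### The insertion tableau -/

theorem insertionTableau_cons (x : ℕ) (w : List ℕ) :
    insertionTableau (x :: w) = (columnInsert x (insertionTableau w)).1 := rfl

theorem recordingTableau_cons (x : ℕ) (w : List ℕ) :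
    recordingTableau (x :: w) = appendToColumn (w.length + 1)
      (columnInsert x (insertionTableau w)).2 (recordingTableau w) := rfl

@[simp] theorem insertionTableau_nil : insertionTableau [] = [] := rfl

@[simp] theorem recordingTableau_nil : recordingTableau [] = [] := rfl

theorem sortedCols_insertionTableau (w : List ℕ) : SortedCols (insertionTableau w) := by
  induction w with
  | nil => simp [SortedCols]
  | cons x w ih => exact sortedCols_columnInsert x ih

theorem sig_insertionTableau (i : ℕ) (w : List ℕ) :
    sig i (colWord (insertionTableau w)) = sig i w := by
  induction w with
  | nil => rfl
  | cons x w ih =>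
    rw [insertionTableau_cons, sig_columnInsert i x (sortedCols_insertionTableau w), sig_cons, ih,
      sig_cons]

theorem perm_insertionTableau (w : List ℕ) : (colWord (insertionTableau w)).Perm w := by
  induction w with
  | nil => exact .nil
  | cons x w ih =>
    exact (perm_columnInsert x (sortedCols_insertionTableau w)).trans (ih.cons x)

theorem nonempty_insertionTableau (w : List ℕ) : [] ∉ insertionTableau w := by
  induction w with
  | nil => simp
  | cons x w ih => exact nonempty_columnInsert x ih

theorem lens_recordingTableau (w : List ℕ) :
    lens (recordingTableau w) = lens (insertionTableau w) := by
  induction w with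
  | nil => rfl
  | cons x w ih =>
    rw [recordingTableau_cons, insertionTableau_cons, lens_appendToColumn, lens_columnInsert, ih]

/-- Either f_i acts on the word already inserted, or it changes only the letter now being inserted;
both are instances of `Lower.columnInsert`, where the position of the new cell is the same. -/
theorem Lower.insertionTableau {i : ℕ} {w w' : List ℕ} (h : Lower i w w') :
    recordingTableau w = recordingTableau w' ∧
      Lower i (colWord (insertionTableau w)) (colWord (insertionTableau w')) := by
  induction w generalizing w' with
  | nil => obtain ⟨u, v, h, -⟩ := h; simp at h
  | cons x w ih =>
    rcases lower_append (u := [x]) h with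
      ⟨h1, v', hv', rfl⟩ | ⟨h1, u', ⟨u, v, e1, rfl, e2, e3⟩, rfl⟩
    · obtain ⟨i1, i2⟩ := ih hv'
      have hl : lens (RectLR.insertionTableau w) = lens (RectLR.insertionTableau v') := by
        rw [← lens_recordingTableau, i1, lens_recordingTableau]
      have h3 := i2.append_left (u := [x]) (by rwa [sig_insertionTableau])
      obtain ⟨h4, h5⟩ := Lower.columnInsert (sortedCols_insertionTableau w)
        (sortedCols_insertionTableau v') hl h3
      refine ⟨?_, h5⟩
      rw [List.singleton_append, recordingTableau_cons, recordingTableau_cons, i1, h4,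
        hv'.length_eq]
    · rw [eq_comm, List.append_eq_singleton_iff] at e1
      rcases e1 with ⟨rfl, e1⟩ | ⟨-, e1⟩
      · simp only [List.cons.injEq] at e1
        obtain ⟨rfl, rfl⟩ := e1
        have h3 : Lower i (i :: colWord (RectLR.insertionTableau w))
            ((i + 1) :: colWord (RectLR.insertionTableau w)) := by
          refine ⟨[], _, rfl, rfl, rfl, ?_⟩
          rw [sig_insertionTableau]
          rw [sig_singleton, letterSig_self] at h1
          omega
        obtain ⟨h4, h5⟩ := Lower.columnInsert (sortedCols_insertionTableau w)
          (sortedCols_insertionTableau w) rfl h3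
        refine ⟨?_, h5⟩
        rw [List.nil_append, List.singleton_append, recordingTableau_cons, recordingTableau_cons,
          h4]
      · simp at e1

theorem Lower.lens_eq {i : ℕ} {w w' : List ℕ} (h : Lower i w w') :
    lens (RectLR.insertionTableau w) = lens (RectLR.insertionTableau w') := by
  rw [← lens_recordingTableau, h.insertionTableau.1, lens_recordingTableau]

/-! ### Column strict tableaux as lists of columns -/

/-- The rows weakly increase from the column `c` to the column `d`. -/
def Dom (c d : List ℕ) : Prop :=
  d.length ≤ c.length ∧ ∀ i, i < d.length → c.getD i 0 ≤ d.getD i 0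

theorem Dom.trans {c d e : List ℕ} (h : Dom c d) (h' : Dom d e) : Dom c e :=
  ⟨h'.1.trans h.1, fun i hi => (h.2 i (hi.trans_le h'.1)).trans (h'.2 i hi)⟩

/-- The list of columns is column strict. -/
def SS (cs : List (List ℕ)) : Prop := SortedCols cs ∧ cs.Pairwise Dom

theorem ss_nil : SS [] := ⟨by simp [SortedCols], .nil⟩

theorem ss_cons_iff {c : List ℕ} {cs : List (List ℕ)} :
    SS (c :: cs) ↔ Sorted c ∧ (∀ d ∈ cs, Dom c d) ∧ SS cs := by
  simp only [SS, SortedCols, List.forall_mem_cons, List.pairwise_cons]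
  tauto

theorem ss_append_iff {cs ds : List (List ℕ)} :
    SS (cs ++ ds) ↔ SS cs ∧ SS ds ∧ ∀ c ∈ cs, ∀ d ∈ ds, Dom c d := by
  simp only [SS, SortedCols, List.forall_mem_append, List.pairwise_append]
  tauto

theorem getD_mem {a : List ℕ} {i : ℕ} (h : i < a.length) : a.getD i 0 ∈ a := by
  rw [List.getD_eq_getElem _ _ h]; exact List.getElem_mem h

theorem getD_split (a b : List ℕ) (x i : ℕ) : (a ++ x :: b).getD i 0 =
    if i < a.length then a.getD i 0 else if i = a.length then x else
      b.getD (i - (a.length + 1)) 0 := by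
  split_ifs with h1 h2
  · rw [List.getD_append _ _ _ _ h1]
  · subst h2; rw [List.getD_append_right _ _ _ _ le_rfl]; simp
  · rw [List.getD_append_right _ _ _ _ (by omega),
      show i - a.length = (i - (a.length + 1)) + 1 by omega]
    rfl

/-- Bumping routes move weakly upwards: the entry to the right of y, if any, is at least y, so y
enters the next column at the row of x or higher, where the left neighbour is now at most y. -/
theorem dom_bumpColumn {x y : ℕ} {a b d : List ℕ} (ha : ∀ z ∈ a, z < x) (hy : x ≤ y)
    (h : Dom (a ++ y :: b) d) : Dom (a ++ x :: b) (bumpColumn y d).1 := by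
  have key : ∀ i, (a ++ x :: b).getD i 0 ≤ (a ++ y :: b).getD i 0 := by
    intro i; rw [getD_split, getD_split]; split_ifs <;> omega
  have key2 : ∀ i, i ≤ a.length → (a ++ x :: b).getD i 0 ≤ y := by
    intro i hi; rw [getD_split]; split_ifs with h1 h2
    · exact (ha _ (getD_mem h1)).le.trans hy
    · exact hy
    · omega
  obtain ⟨h1, h2⟩ := h
  have key3 : (a ++ y :: b).getD a.length 0 = y := by rw [getD_split]; simp
  rcases exists_split y d with h | ⟨a', y', b', rfl, ha', hy'⟩
  · rw [bumpColumn_of_lt h]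
    have hl : d.length ≤ a.length := by
      by_contra! hc
      have := h2 _ hc
      have := h _ (getD_mem hc)
      omega
    refine ⟨by simp; omega, fun i hi => ?_⟩
    simp only [List.length_append, List.length_singleton] at hi
    rw [getD_split d]
    split_ifs with h3 h4
    · exact (key i).trans (h2 i h3)
    · exact key2 i (by omega)
    · omega
  · rw [bumpColumn_append ha' hy']
    have hl : a'.length ≤ a.length := by
      by_contra! hc
      have := h2 a.length (by simp; omega)
      rw [key3, getD_split, if_pos hc] at this
      have := ha' _ (getD_mem hc)
      omega
    refine ⟨by simpa using h1, fun i hi => ?_⟩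
    have := h2 i (by simpa using hi)
    have := key i
    rw [getD_split a' b']
    rw [getD_split a' b'] at *
    split_ifs at * with h3 h4
    · omega
    · exact key2 i (by omega)
    · omega

theorem ss_columnInsert (x : ℕ) {cs : List (List ℕ)} (h : SS cs) : SS (columnInsert x cs).1 := by
  induction cs generalizing x with
  | nil => simp [columnInsert, SS, SortedCols]
  | cons c cs ih =>
    obtain ⟨h1, h2, h3⟩ := ss_cons_iff.1 h
    rcases bumpColumn_cases x h1 with ⟨e, h4, -⟩ | ⟨a, y, b, rfl, e, h4, ha, hy, -⟩
    · rw [columnInsert_cons_none e]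
      refine ss_cons_iff.2 ⟨h4, fun d hd => ⟨?_, fun i hi => ?_⟩, h3⟩
      · have := (h2 d hd).1; simp; omega
      · have := (h2 d hd).1
        rw [List.getD_append _ _ _ _ (by omega)]
        exact (h2 d hd).2 i hi
    · rw [columnInsert_cons_some e]
      refine ss_cons_iff.2 ⟨h4, ?_, ih y h3⟩
      cases cs with
      | nil =>
        have := dom_bumpColumn (b := b) ha hy (d := []) ⟨by simp, by simp⟩
        simpa [columnInsert, bumpColumn] using this
      | cons c2 cs =>
        have hd := dom_bumpColumn ha hy (h2 c2 (by simp))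
        have hs := ih y h3
        rcases bumpColumn_cases y (ss_cons_iff.1 h3).1 with
          ⟨e, h4, -⟩ | ⟨a', y', b', rfl, e, h4, ha', hy', -⟩
        · rw [columnInsert_cons_none e] at hs ⊢
          rw [e] at hd
          exact List.forall_mem_cons.2 ⟨hd, fun d hd' => hd.trans ((ss_cons_iff.1 hs).2.1 d hd')⟩
        · rw [columnInsert_cons_some e] at hs ⊢
          rw [e] at hd
          exact List.forall_mem_cons.2 ⟨hd, fun d hd' => hd.trans ((ss_cons_iff.1 hs).2.1 d hd')⟩

theorem ss_insertionTableau (w : List ℕ) : SS (insertionTableau w) := by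
  induction w with
  | nil => exact ss_nil
  | cons x w ih => exact ss_columnInsert x ih

/-! ### Injectivity of the correspondence -/

/-- Reverse bumping: the inserted letter is the largest entry of the new column that is at most the
bumped letter y. -/
theorem bump_inj {a b a' b' : List ℕ} {x x' y : ℕ} (h : a ++ x :: b = a' ++ x' :: b')
    (hx : x ≤ y) (ha : ∀ z ∈ a, z < x) (hb : ∀ z ∈ b, y < z)
    (hx' : x' ≤ y) (ha' : ∀ z ∈ a', z < x') (hb' : ∀ z ∈ b', y < z) :
    a = a' ∧ x = x' ∧ b = b' := by
  have key : ∀ {a b : List ℕ} {x : ℕ}, x ≤ y → (∀ z ∈ a, z < x) → (∀ z ∈ b, y < z) →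
      (a ++ x :: b).filter (· ≤ y) = a ++ [x] := by
    intro a b x hx ha hb
    rw [List.filter_append, List.filter_cons_of_pos (by simpa),
      List.filter_eq_self.2 (by intro z hz; have := ha z hz; simp; omega),
      List.filter_eq_nil_iff.2 (by intro z hz; have := hb z hz; simp; omega)]
  have h1 := congrArg (List.filter (· ≤ y)) h
  rw [key hx ha hb, key hx' ha' hb'] at h1
  obtain ⟨rfl, h2⟩ := List.append_inj' h1 rfl
  simp only [List.cons.injEq, and_true] at h2
  subst h2
  simpa using h

theorem columnInsert_inj {x x' : ℕ} {cs cs' : List (List ℕ)} (hc : SortedCols cs)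
    (hc' : SortedCols cs') (hn : [] ∉ cs) (hn' : [] ∉ cs')
    (h : columnInsert x cs = columnInsert x' cs') : x = x' ∧ cs = cs' := by
  induction cs generalizing x x' cs' with
  | nil =>
    cases cs' with
    | nil => simpa [columnInsert] using h
    | cons c' cs' =>
      rcases exists_split x' c' with h1 | ⟨a, y, b, rfl, ha, hy⟩
      · rw [columnInsert_cons_none (bumpColumn_of_lt h1)] at h
        simp only [columnInsert, Prod.mk.injEq, List.cons.injEq, and_true] at h
        obtain ⟨h, -⟩ := h
        rw [eq_comm, List.append_eq_singleton_iff] at h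
        simp at h
        simp [h.1] at hn'
      · rw [columnInsert_cons_some (bumpColumn_append ha hy)] at h
        simp [columnInsert] at h
  | cons c cs ih =>
    rw [SortedCols, List.forall_mem_cons] at hc
    rw [List.mem_cons, not_or] at hn
    cases cs' with
    | nil =>
      rcases exists_split x c with h1 | ⟨a, y, b, rfl, ha, hy⟩
      · rw [columnInsert_cons_none (bumpColumn_of_lt h1)] at h
        simp only [columnInsert, Prod.mk.injEq, List.cons.injEq, and_true] at h
        obtain ⟨h, -⟩ := h
        rw [List.append_eq_singleton_iff] at h
        simp at h
        simp [h.1] at hn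
      · rw [columnInsert_cons_some (bumpColumn_append ha hy)] at h
        simp [columnInsert] at h
    | cons c' cs' =>
      rw [SortedCols, List.forall_mem_cons] at hc'
      rw [List.mem_cons, not_or] at hn'
      rcases bumpColumn_cases x hc.1 with ⟨e, -⟩ | ⟨a, y, b, rfl, e, -, ha, hy, hb⟩ <;>
      rcases bumpColumn_cases x' hc'.1 with ⟨e', -⟩ | ⟨a', y', b', rfl, e', -, ha', hy', hb'⟩
      · rw [columnInsert_cons_none e, columnInsert_cons_none e'] at h
        simp only [Prod.mk.injEq, List.cons.injEq, and_true] at h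
        obtain ⟨h1, rfl⟩ := h
        obtain ⟨rfl, h2⟩ := List.append_inj' h1 rfl
        simpa using h2
      · rw [columnInsert_cons_none e, columnInsert_cons_some e'] at h
        simp at h
      · rw [columnInsert_cons_some e, columnInsert_cons_none e'] at h
        simp at h
      · rw [columnInsert_cons_some e, columnInsert_cons_some e'] at h
        simp only [Prod.mk.injEq, List.cons.injEq, add_left_inj] at h
        obtain ⟨⟨h1, h2⟩, h3⟩ := h
        obtain ⟨rfl, rfl⟩ := ih hc.2 hc'.2 hn.2 hn'.2 (Prod.ext h2 h3)
        obtain ⟨rfl, rfl, rfl⟩ := bump_inj h1 hy ha hb hy' ha' hb'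
        exact ⟨rfl, rfl⟩

/-- The label m is new, so its position reveals the column; excluding empty columns avoids confusing
a missing column with an empty one. -/
theorem appendToColumn_inj {m j j' : ℕ} {q q' : List (List ℕ)} (hm : ∀ c ∈ q, m ∉ c)
    (hm' : ∀ c ∈ q', m ∉ c) (hn : [] ∉ q) (hn' : [] ∉ q')
    (h : appendToColumn m j q = appendToColumn m j' q') : j = j' ∧ q = q' := by
  induction j generalizing j' q q' with
  | zero =>
    cases q with
    | nil =>
      cases j' with
      | zero =>
        cases q' with
        | nil => simp
        | cons c' q' =>
          simp only [appendToColumn, List.cons.injEq] at h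
          have h1 := congrArg List.length h.1
          simp only [List.length_append, List.length_singleton] at h1
          rw [List.eq_nil_of_length_eq_zero (l := c') (by omega)] at hn'
          simp at hn'
      | succ j' =>
        cases q' with
        | nil => simp [appendToColumn] at h
        | cons c' q' =>
          simp only [appendToColumn, List.cons.injEq] at h
          simp [← h.1] at hm'
    | cons c q =>
      cases j' with
      | zero =>
        cases q' with
        | nil =>
          simp only [appendToColumn, List.cons.injEq] at h
          have h1 := congrArg List.length h.1
          simp only [List.length_append, List.length_singleton] at h1
          rw [List.eq_nil_of_length_eq_zero (l := c) (by omega)] at hn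
          simp at hn
        | cons c' q' =>
          simp only [appendToColumn, List.cons.injEq] at h
          obtain ⟨h1, rfl⟩ := h
          simpa using h1
      | succ j' =>
        cases q' with
        | nil => simp [appendToColumn] at h
        | cons c' q' =>
          simp only [appendToColumn, List.cons.injEq] at h
          simp [← h.1] at hm'
  | succ j ih =>
    cases q with
    | nil =>
      cases j' with
      | zero =>
        cases q' with
        | nil => simp [appendToColumn] at h
        | cons c' q' => simp [appendToColumn] at h
      | succ j' =>
        cases q' with
        | nil => simpa using ih hm hm' hn hn' (by simpa [appendToColumn] using h)
        | cons c' q' =>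
          simp only [appendToColumn, List.cons.injEq] at h
          simp [← h.1] at hn'
    | cons c q =>
      cases j' with
      | zero =>
        cases q' with
        | nil =>
          simp only [appendToColumn, List.cons.injEq] at h
          simp [h.1] at hm
        | cons c' q' =>
          simp only [appendToColumn, List.cons.injEq] at h
          simp [h.1] at hm
      | succ j' =>
        cases q' with
        | nil =>
          simp only [appendToColumn, List.cons.injEq] at h
          simp [h.1] at hn
        | cons c' q' =>
          simp only [appendToColumn, List.cons.injEq] at h
          rw [List.forall_mem_cons] at hm hm'
          rw [List.mem_cons, not_or] at hn hn'
          obtain ⟨rfl, rfl⟩ := ih hm.2 hm'.2 hn.2 hn'.2 h.2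
          simp [h.1]

theorem mem_appendToColumn {m j : ℕ} {q : List (List ℕ)} {c : List ℕ} {z : ℕ}
    (hc : c ∈ appendToColumn m j q) (hz : z ∈ c) : z = m ∨ ∃ c ∈ q, z ∈ c := by
  induction j generalizing q with
  | zero =>
    cases q with
    | nil => simp_all [appendToColumn]
    | cons d q =>
      simp only [appendToColumn, List.mem_cons] at hc
      rcases hc with rfl | hc
      · rcases List.mem_append.1 hz with hz | hz
        · exact .inr ⟨d, by simp, hz⟩
        · exact .inl (by simpa using hz)
      · exact .inr ⟨c, by simp [hc], hz⟩
  | succ j ih =>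
    cases q with
    | nil =>
      simp only [appendToColumn, List.mem_cons] at hc
      rcases hc with rfl | hc
      · simp at hz
      · exact ih hc
    | cons d q =>
      simp only [appendToColumn, List.mem_cons] at hc
      rcases hc with rfl | hc
      · exact .inr ⟨c, by simp, hz⟩
      · rcases ih hc with h | ⟨e, he, hz⟩
        · exact .inl h
        · exact .inr ⟨e, by simp [he], hz⟩

theorem le_length_of_mem_recordingTableau {w : List ℕ} {c : List ℕ} {z : ℕ}
    (hc : c ∈ recordingTableau w) (hz : z ∈ c) : z ≤ w.length := by
  induction w generalizing c with
  | nil => simp at hc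
  | cons x w ih =>
    rw [recordingTableau_cons] at hc
    rcases mem_appendToColumn hc hz with rfl | ⟨d, hd, hz⟩
    · simp
    · exact (ih hd hz).trans (by simp)

theorem nonempty_recordingTableau (w : List ℕ) : [] ∉ recordingTableau w := by
  intro h
  have h1 : 0 ∈ lens (recordingTableau w) := List.mem_map.2 ⟨[], h, rfl⟩
  rw [lens_recordingTableau] at h1
  obtain ⟨c, hc, h2⟩ := List.mem_map.1 h1
  rw [List.length_eq_zero_iff] at h2
  exact nonempty_insertionTableau w (h2 ▸ hc)

/-- The largest label of the recording tableau tells which cell came last, and reverse insertion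
from it recovers the first letter of the word. -/
theorem columnRSK_inj {w w' : List ℕ} (hl : w.length = w'.length)
    (hP : insertionTableau w = insertionTableau w')
    (hQ : recordingTableau w = recordingTableau w') : w = w' := by
  induction w generalizing w' with
  | nil => simpa [eq_comm] using hl
  | cons x w ih =>
    cases w' with
    | nil => simp at hl
    | cons x' w' =>
      simp only [List.length_cons, add_left_inj] at hl
      rw [recordingTableau_cons, recordingTableau_cons, hl] at hQ
      obtain ⟨h1, h2⟩ := appendToColumn_inj
        (fun c hc hm => by have := le_length_of_mem_recordingTableau hc hm; omega)
        (fun c hc hm => by have := le_length_of_mem_recordingTableau hc hm; omega)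
        (nonempty_recordingTableau w) (nonempty_recordingTableau w') hQ
      obtain ⟨rfl, h3⟩ := columnInsert_inj (sortedCols_insertionTableau w)
        (sortedCols_insertionTableau w') (nonempty_insertionTableau w)
        (nonempty_insertionTableau w') (Prod.ext hP h1)
      rw [ih hl h3 h2]

/-! ### Extremal tableaux -/

/-- Locates the first place where a column departs from s + 1, s + 2, …; `eq_range'_or_of_end` does
the same from the bottom, where a column should end with …, t - 1, t. -/
theorem eq_range'_or (s : ℕ) (c : List ℕ) : c = List.range' (s + 1) c.length ∨
    ∃ r v q, c = List.range' (s + 1) r ++ v :: q ∧ v ≠ s + 1 + r := by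
  induction c generalizing s with
  | nil => simp
  | cons x c ih =>
    by_cases hx : x = s + 1
    · subst hx
      rcases ih (s + 1) with h | ⟨r, v, q, rfl, hv⟩
      · left
        rw [List.length_cons, List.range'_succ, ← h]
      · refine .inr ⟨r + 1, v, q, ?_, by omega⟩
        rw [List.range'_succ]; rfl
    · exact .inr ⟨0, x, c, by simp, by simpa using hx⟩

theorem eq_range'_or_of_end {t : ℕ} {c : List ℕ} (hl : c.length ≤ t) :
    c = List.range' (t + 1 - c.length) c.length ∨
    ∃ p v r, c = p ++ v :: List.range' (t + 1 - r) r ∧ v ≠ t - r := by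
  induction c with
  | nil => simp
  | cons x c ih =>
    simp only [List.length_cons] at hl
    rcases ih (by omega) with h | ⟨p, v, r, rfl, hv⟩
    · by_cases hx : x = t - c.length
      · left
        rw [List.length_cons, List.range'_succ,
          show t + 1 - (c.length + 1) + 1 = t + 1 - c.length by omega, ← h]
        congr 1
        omega
      · exact .inr ⟨[], x, c.length, by rw [← h]; rfl, hx⟩
    · exact .inr ⟨x :: p, v, r, rfl, hv⟩

theorem getD_range' {s n i : ℕ} (h : i < n) : (List.range' s n).getD i 0 = s + i := by
  rw [List.getD_eq_getElem _ _ (by simpa)]; simp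

theorem mem_colWord {cs : List (List ℕ)} {z : ℕ} : z ∈ colWord cs ↔ ∃ c ∈ cs, z ∈ c := by
  simp [colWord]

/-- The columns of a highest weight tableau. -/
theorem SS.eq_range' {s : ℕ} {cs : List (List ℕ)} (h : SS cs) (hs : ∀ c ∈ cs, ∀ z ∈ c, s < z)
    (hw : ∀ i, s < i → (sig i (colWord cs)).1 = 0) :
    ∀ c ∈ cs, c = List.range' (s + 1) c.length := by
  induction cs with
  | nil => simp
  | cons c cs ih =>
    obtain ⟨h1, h2, h3⟩ := ss_cons_iff.1 h
    rw [List.forall_mem_cons] at hs ⊢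
    have ih := ih h3 hs.2 fun i hi => by
      have := hw i hi
      rw [colWord_cons, sig_append] at this
      simp only [sigMul] at this
      omega
    refine ⟨?_, ih⟩
    rcases eq_range'_or s c with h4 | ⟨r, v, q, rfl, hv⟩
    · exact h4
    · exfalso
      obtain ⟨-, -, h5, -⟩ := sorted_split h1
      have hvs := hs.1 v (by simp)
      have hv' : s + 1 + r < v := by
        rcases Nat.eq_zero_or_pos r with rfl | hr
        · omega
        · have := h5 (s + r) (by simp; omega)
          omega
      obtain ⟨i, rfl⟩ : ∃ i, v = i + 1 := ⟨v - 1, by omega⟩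
      have h6 := hw i (by omega)
      -- No v - 1 is read after v: a later column containing it has more than r entries and carries
      -- s + 1 + r < v in row r, against weak increase of rows. So v would be unmatched.
      have h7 : (sig i ((List.range' (s + 1) r).reverse ++ colWord cs)).2 = 0 := by
        refine sig_snd_of_notMem fun hm => ?_
        rw [List.mem_append, List.mem_reverse, mem_colWord] at hm
        rcases hm with hm | ⟨d, hd, hm⟩
        · simp at hm; omega
        · have h8 := ih d hd
          rw [h8] at hm
          simp at hm
          have h9 := (h2 d hd).2 r (by omega)
          have h10 : d.getD r 0 = s + 1 + r := by rw [h8, getD_range' (by omega)]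
          rw [getD_split, if_neg (by simp), if_pos (by simp), h10] at h9
          omega
      rw [colWord_cons, List.reverse_append, List.reverse_cons, List.append_assoc,
        List.append_assoc, sig_append, sig_append, sig_singleton, letterSig_succ] at h6
      simp only [sigMul] at h6
      omega

theorem length_le_of_sorted {s t : ℕ} {c : List ℕ} (h : Sorted c)
    (hs : ∀ z ∈ c, s < z ∧ z ≤ t) : c.length ≤ t - s := by
  have h1 : c.toFinset ⊆ Finset.Ioc s t := fun z hz => by
    simpa using hs z (by simpa using hz)
  have h2 := Finset.card_le_card h1
  rwa [List.toFinset_card_of_nodup (h.imp fun h => h.ne), Nat.card_Ioc] at h2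

theorem count_colWord (cs : List (List ℕ)) (z : ℕ) :
    (colWord cs).count z = (cs.map (List.count z)).sum := by
  induction cs with
  | nil => rfl
  | cons c cs ih => simp [ih]

/-- The columns of a lowest weight tableau. -/
theorem SS.eq_range'_of_end {s t : ℕ} {cs : List (List ℕ)} (h : SS cs)
    (hs : ∀ c ∈ cs, ∀ z ∈ c, s < z ∧ z ≤ t)
    (hw : ∀ i, s < i → i < t → (sig i (colWord cs)).2 = 0) :
    ∀ c ∈ cs, c = List.range' (t + 1 - c.length) c.length := by
  induction cs using List.reverseRecOn with
  | nil => simp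
  | append_singleton cs c ih =>
    obtain ⟨h1, h2, h3⟩ := ss_append_iff.1 h
    rw [List.forall_mem_append] at hs ⊢
    have ih := ih h1 hs.1 fun i hi hi' => by
      have := hw i hi hi'
      rw [colWord_append, sig_append] at this
      simp only [sigMul] at this
      omega
    refine ⟨ih, ?_⟩
    simp only [List.mem_singleton, forall_eq] at h3 hs ⊢
    have h4 := (ss_cons_iff.1 h2).1
    have hlc := length_le_of_sorted h4 hs.2
    rcases eq_range'_or_of_end (t := t) (c := c) (by omega) with h5 | ⟨p, v, r, rfl, hv⟩
    · exact h5
    · exfalso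
      obtain ⟨-, -, -, h5⟩ := sorted_split h4
      have hvs := hs.2 v (by simp)
      simp only [List.length_append, List.length_cons, List.length_range'] at hlc
      have hv' : v < t - r := by
        rcases Nat.eq_zero_or_pos r with rfl | hr
        · omega
        · have := h5 (t + 1 - r) (by simp; omega)
          omega
      have h6 := hw v (by omega) (by omega)
      rw [colWord_append, colWord_cons, List.reverse_append, List.reverse_cons, colWord_nil,
        List.append_nil, ← List.append_assoc, ← List.append_assoc, sig_append, sig_append,
        sig_singleton, letterSig_self] at h6
      have h7 := sig_count v (colWord cs ++ (List.range' (t + 1 - r) r).reverse)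
      -- Each earlier column consists of the last letters of the alphabet and has an entry at most v
      -- in the row of v, so it contains both v and v + 1; the letters of c below v contain neither.
      -- With equal counts in front of it, v cannot be matched without leaving another v unmatched.
      have h8 : (colWord cs ++ (List.range' (t + 1 - r) r).reverse).count (v + 1) =
          (colWord cs ++ (List.range' (t + 1 - r) r).reverse).count v := by
        rw [List.count_append, List.count_append, List.count_reverse, List.count_reverse,
          List.count_eq_zero (a := v + 1) (l := List.range' _ _) |>.2,
          List.count_eq_zero (a := v) (l := List.range' _ _) |>.2, count_colWord, count_colWord]
        · congr 2
          refine List.map_congr_left fun d hd => ?_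
          have h9 := h3 d hd
          have h10 := ih d hd
          have h11 := h9.1
          have h12 := h9.2 p.length (by simp)
          simp only [List.length_append, List.length_cons, List.length_range'] at h11
          rw [getD_split, if_neg (by omega), if_pos rfl, h10, getD_range' (by omega)] at h12
          have h13 : d.Nodup := h10 ▸ List.nodup_range'
          have h14 := length_le_of_sorted (h1.1 d hd) (hs.1 d hd)
          rw [List.count_eq_one_of_mem h13, List.count_eq_one_of_mem h13]
          · rw [h10]; simp; omega
          · rw [h10]; simp; omega
        · simp; omega
        · simp; omega
      simp only [sigMul] at h6
      omega

/-! ### Highest weight words -/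

theorem lens_append (cs ds : List (List ℕ)) : lens (cs ++ ds) = lens cs ++ lens ds :=
  List.map_append

theorem sorted_range' (s n : ℕ) : Sorted (List.range' s n) := List.pairwise_lt_range'

theorem mem_insertionTableau {w : List ℕ} {z : ℕ} :
    (∃ c ∈ insertionTableau w, z ∈ c) ↔ z ∈ w := by
  rw [← mem_colWord]; exact (perm_insertionTableau w).mem_iff

theorem forall_mem_insertionTableau {w : List ℕ} {p : ℕ → Prop} (h : ∀ z ∈ w, p z) :
    ∀ c ∈ insertionTableau w, ∀ z ∈ c, p z :=
  fun c hc z hz => h z (mem_insertionTableau.1 ⟨c, hc, hz⟩)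

theorem insertionTableau_eq_of_highest {s : ℕ} {y : List ℕ} (hs : ∀ z ∈ y, s < z)
    (hw : ∀ i, s < i → (sig i y).1 = 0) :
    insertionTableau y = (lens (insertionTableau y)).map (List.range' (s + 1)) := by
  have := (ss_insertionTableau y).eq_range' (forall_mem_insertionTableau hs)
    (fun i hi => by rw [sig_insertionTableau]; exact hw i hi)
  rw [List.map_map]
  exact (List.map_id' _).symm.trans (List.map_congr_left this)

/-! ### Row lengths as multiplicities in extremal words. -/

theorem count_eq_countP {cs : List (List ℕ)} (h : SortedCols cs) (z : ℕ) :
    (colWord cs).count z = cs.countP (z ∈ ·) := by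
  induction cs with
  | nil => rfl
  | cons c cs ih =>
    rw [SortedCols, List.forall_mem_cons] at h
    rw [colWord_cons, List.count_append, List.count_reverse, ih h.2, List.countP_cons]
    by_cases hz : z ∈ c
    · rw [List.count_eq_one_of_mem (h.1.imp fun h => h.ne) hz]; simp [hz, add_comm]
    · rw [List.count_eq_zero.2 hz]; simp [hz]

theorem count_eq_countP_lens {w : List ℕ} (z : ℕ) {r : ℕ}
    (h : ∀ c ∈ insertionTableau w, z ∈ c ↔ r ≤ c.length) :
    w.count z = (lens (insertionTableau w)).countP (r ≤ ·) := by
  rw [← (perm_insertionTableau w).count_eq, count_eq_countP (sortedCols_insertionTableau w),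
    List.countP_map]
  refine List.countP_congr fun c hc => ?_
  simpa using h c hc

theorem count_of_highest {s : ℕ} {y : List ℕ} (hs : ∀ z ∈ y, s < z)
    (hw : ∀ i, s < i → (sig i y).1 = 0) {r : ℕ} (hr : 0 < r) :
    y.count (s + r) = (lens (insertionTableau y)).countP (r ≤ ·) := by
  refine count_eq_countP_lens _ fun c hc => ?_
  rw [(ss_insertionTableau y).eq_range' (forall_mem_insertionTableau hs)
    (fun i hi => by rw [sig_insertionTableau]; exact hw i hi) c hc]
  simp; omega

theorem count_of_lowest {s t : ℕ} {y : List ℕ} (hs : ∀ z ∈ y, s < z ∧ z ≤ t)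
    (hw : ∀ i, s < i → i < t → (sig i y).2 = 0) {r : ℕ} (hr : 0 < r) (hrt : r ≤ t) :
    y.count (t + 1 - r) = (lens (insertionTableau y)).countP (r ≤ ·) := by
  refine count_eq_countP_lens _ fun c hc => ?_
  have h1 := forall_mem_insertionTableau hs
  have h2 := length_le_of_sorted (sortedCols_insertionTableau y c hc) (h1 c hc)
  rw [(ss_insertionTableau y).eq_range'_of_end h1
    (fun i hi hi' => by rw [sig_insertionTableau]; exact hw i hi hi') c hc]
  simp; omega

/-! ### Two rectangles -/

theorem exists_append_of_pairwise {α : Type*} {q : α → Prop} {l : List α}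
    (h : l.Pairwise fun c d => q d → q c) :
    ∃ l₁ l₂, l = l₁ ++ l₂ ∧ (∀ c ∈ l₁, q c) ∧ ∀ c ∈ l₂, ¬ q c := by
  induction l with
  | nil => exact ⟨[], [], rfl, by simp, by simp⟩
  | cons c l ih =>
    rw [List.pairwise_cons] at h
    by_cases hc : q c
    · obtain ⟨l₁, l₂, rfl, h1, h2⟩ := ih h.2
      exact ⟨c :: l₁, l₂, rfl, List.forall_mem_cons.2 ⟨hc, h1⟩, h2⟩
    · exact ⟨[], c :: l, rfl, by simp,
        List.forall_mem_cons.2 ⟨hc, fun d hd hq => hc (h.1 d hd hq)⟩⟩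

/-- A subset that is at least as large is everything; used to show that a column with the first
letter of a rectangle contains its last letter. -/
theorem forall_of_countP_le {α : Type*} {p q : α → Bool} {l : List α}
    (h : ∀ c ∈ l, p c → q c) (hc : l.countP q ≤ l.countP p) : ∀ c ∈ l, q c → p c := by
  induction l with
  | nil => simp
  | cons c l ih =>
    rw [List.forall_mem_cons] at h ⊢
    have h1 := List.countP_mono_left h.2
    rw [List.countP_cons, List.countP_cons] at hc
    have h2 := h.1
    refine ⟨fun hq => ?_, ih h.2 ?_⟩
    · by_contra hp
      simp only [hq, hp, if_true] at hc
      simp at hc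
      omega
    · split_ifs at hc with h3 h4 h4
      · omega
      · omega
      · exact absurd (h2 h4) h3
      · omega

/-! ### Restricting columns to small letters. -/

theorem sorted_eq_append {c : List ℕ} (h : Sorted c) (t : ℕ) :
    c = c.filter (· ≤ t) ++ c.filter (t < ·) := by
  induction c with
  | nil => rfl
  | cons x c ih =>
    rw [Sorted, List.pairwise_cons] at h
    by_cases hx : x ≤ t
    · rw [List.filter_cons_of_pos (by simpa), List.filter_cons_of_neg (by simpa), List.cons_append,
        ← ih h.2]
    · rw [List.filter_cons_of_neg (by simpa using hx), List.filter_cons_of_pos (by simpa using hx),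
        List.filter_eq_nil_iff.2, List.filter_eq_self.2]
      · rfl
      · intro z hz; have := h.1 z hz; simp; omega
      · intro z hz; have := h.1 z hz; simp; omega

theorem Dom.filter_le {c d : List ℕ} (hc : Sorted c) (hd : Sorted d) (h : Dom c d) (t : ℕ) :
    Dom (c.filter (· ≤ t)) (d.filter (· ≤ t)) := by
  have ec := sorted_eq_append hc t
  have ed := sorted_eq_append hd t
  set p := c.filter (· ≤ t) with hp
  set p' := d.filter (· ≤ t) with hp'
  set q := c.filter (t < ·) with hq
  set q' := d.filter (t < ·) with hq'
  have hlc : c.length = p.length + q.length := by rw [ec, List.length_append]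
  have hld : d.length = p'.length + q'.length := by rw [ed, List.length_append]
  have key : ∀ i, i < p'.length → i < p.length ∧ p.getD i 0 ≤ p'.getD i 0 := by
    intro i hi
    have h1 := h.2 i (by omega)
    have h0 := h.1
    have h2 : d.getD i 0 = p'.getD i 0 := by rw [ed, List.getD_append _ _ _ _ hi]
    have h3 : p'.getD i 0 ≤ t := by
      have := getD_mem hi
      rw [hp', List.mem_filter] at this
      simpa using this.2
    have h4 : i < p.length := by
      by_contra! h4
      have h5 : i - p.length < q.length := by omega
      have h6 : c.getD i 0 = q.getD (i - p.length) 0 := by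
        rw [ec, List.getD_append_right _ _ _ _ h4]
      have := getD_mem h5
      rw [hq, List.mem_filter, ← hq] at this
      simp only [decide_eq_true_eq] at this
      omega
    have h7 : c.getD i 0 = p.getD i 0 := by rw [ec, List.getD_append _ _ _ _ h4]
    exact ⟨h4, by omega⟩
  refine ⟨?_, fun i hi => (key i hi).2⟩
  by_contra! hlt
  exact absurd (key _ hlt).1 (lt_irrefl _)

theorem colWord_map_filter (p : ℕ → Bool) (cs : List (List ℕ)) :
    colWord (cs.map (List.filter p)) = (colWord cs).filter p := by
  induction cs with
  | nil => rfl
  | cons c cs ih => simp [ih]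

theorem SS.map_filter_le {cs : List (List ℕ)} (h : SS cs) (t : ℕ) :
    SS (cs.map (List.filter (· ≤ t))) := by
  refine ⟨?_, ?_⟩
  · intro c hc
    obtain ⟨d, hd, rfl⟩ := List.mem_map.1 hc
    exact (h.1 d hd).filter _
  · rw [List.pairwise_map]
    refine (List.pairwise_iff_forall_sublist.2 fun {a b} hab => ?_)
    have h1 := List.pairwise_iff_forall_sublist.1 h.2 hab
    exact h1.filter_le (h.1 _ (hab.subset (by simp))) (h.1 _ (hab.subset (by simp))) t

theorem Dom.drop {c d : List ℕ} (h : Dom c d) (n : ℕ) : Dom (c.drop n) (d.drop n) := by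
  refine ⟨by have := h.1; simp; omega, fun i hi => ?_⟩
  have := h.2 (n + i) (by simp at hi; omega)
  simpa [List.getD_eq_getElem?_getD, List.getElem?_drop] using this

/-- The words that are extremal of rectangular weight `(μ ^ a)` in the alphabet
`[s + 1, s + a]`. -/
structure IsRectWord (s a μ : ℕ) (w : List ℕ) : Prop where
  count : ∀ z, s < z → z ≤ s + a → w.count z = μ
  fst : ∀ i, s < i → i < s + a → (sig i w).1 = 0

theorem IsRectWord.snd {s a μ : ℕ} {w : List ℕ} (h : IsRectWord s a μ w) (i : ℕ) (hi : s < i)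
    (hi' : i < s + a) : (sig i w).2 = 0 := by
  have h1 := sig_count i w
  rw [h.count i hi hi'.le, h.count (i + 1) (by omega) (by omega), h.fst i hi hi'] at h1
  omega

/-- The column strict tableaux of two rectangles. -/
theorem SS.two_rectangles {s a b μ ν : ℕ} {cs : List (List ℕ)} (ha : 0 < a) (h : SS cs)
    (hs : ∀ c ∈ cs, ∀ z ∈ c, s < z ∧ z ≤ s + a + b)
    (h1 : IsRectWord s a μ (colWord cs)) (h2 : IsRectWord (s + a) b ν (colWord cs)) :
    ∃ l r, cs = l ++ r ∧ l.length = μ ∧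
      (∀ c ∈ l, a ≤ c.length ∧ c = List.range' (s + 1) a ++
        List.range' (s + a + b + 1 - (c.length - a)) (c.length - a)) ∧
      ∀ c ∈ r, c = List.range' (s + a + 1) c.length := by
  -- the letters of the first alphabet
  have hf := (h.map_filter_le (s + a)).eq_range' (s := s)
    (by
      intro c hc z hz
      obtain ⟨d, hd, rfl⟩ := List.mem_map.1 hc
      exact (hs d hd z (List.mem_filter.1 hz).1).1)
    (by
      intro i hi
      rw [colWord_map_filter]
      by_cases hia : i + 1 ≤ s + a
      · rw [sig_filter _ _ (by simp; omega) (by simpa)]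
        exact h1.fst i hi (by omega)
      · refine sig_fst_of_notMem fun hm => ?_
        rw [List.mem_filter] at hm
        simp at hm
        omega)
  simp only [List.mem_map, forall_exists_index, and_imp, forall_apply_eq_imp_iff₂] at hf
  have hmem : ∀ c ∈ cs, ∀ z, z ≤ s + a →
      (z ∈ c ↔ s < z ∧ z ≤ s + (c.filter (· ≤ s + a)).length) := by
    intro c hc z hz
    have : z ∈ c ↔ z ∈ c.filter (· ≤ s + a) := by simp [hz]
    rw [this, hf c hc]
    simp; omega
  -- The small letters of a column form an initial run, so s + a in a column implies s + 1; both
  -- occur μ times, hence in the same columns.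
  have hiff : ∀ c ∈ cs, s + 1 ∈ c → s + a ∈ c := by
    have := forall_of_countP_le (l := cs) (p := (s + a ∈ ·)) (q := (s + 1 ∈ ·)) ?_ ?_
    · simpa using this
    · simp only [decide_eq_true_eq]
      intro c hc hm
      rw [hmem c hc _ (by omega)] at hm ⊢
      omega
    · rw [← count_eq_countP h.1, ← count_eq_countP h.1, h1.count _ (by omega) (by omega),
        h1.count _ (by omega) (by omega)]
  -- The columns containing s + 1 come first, since top entries weakly increase to the right. They
  -- contain the whole first alphabet, and the remaining columns none of it.
  obtain ⟨l, r, rfl, hl, hr⟩ := exists_append_of_pairwise (q := fun c => s + 1 ∈ c) (l := cs) (by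
    refine (List.pairwise_iff_forall_sublist.2 fun {c d} hab => ?_)
    have h1 := List.pairwise_iff_forall_sublist.1 h.2 hab
    intro hm
    have hc := hab.subset (a := c) (by simp)
    have hd := hab.subset (a := d) (by simp)
    have hpos : 0 < d.length := List.length_pos_of_mem hm
    have h3 := h1.2 0 hpos
    have h4 : d.getD 0 0 ≤ s + 1 := by
      cases d with
      | nil => simp at hm
      | cons x d =>
        rw [List.mem_cons] at hm
        rcases hm with rfl | hm
        · simp
        · have := (List.pairwise_cons.1 (h.1 _ hd)).1 _ hm
          simp; omega
    have h5 := getD_mem (a := c) (i := 0) (by have := h1.1; omega)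
    have h6 := hs c hc _ h5
    rwa [show c.getD 0 0 = s + 1 by omega] at h5)
  refine ⟨l, r, rfl, ?_, ?_, ?_⟩
  · have := h1.count (s + 1) (by omega) (by omega)
    rw [count_eq_countP h.1, List.countP_append, List.countP_eq_length.2 (by simpa using hl),
      List.countP_eq_zero.2 (by simpa using hr)] at this
    simpa using this
  · have hL : ∀ c ∈ l, c = List.range' (s + 1) a ++ c.drop a := by
      intro c hc
      have hc' : c ∈ l ++ r := List.mem_append_left _ hc
      have h3 := hiff c hc' (hl c hc)
      rw [hmem c hc' _ le_rfl] at h3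
      have h5 := sorted_eq_append (h.1 c hc') (s + a)
      have h6 := hf c hc'
      have h4 : (c.filter (· ≤ s + a)).length ≤ a := by
        by_contra! h4
        have h7 : s + a + 1 ∈ c.filter (· ≤ s + a) := by
          rw [h6]; simp; omega
        rw [List.mem_filter] at h7
        simp at h7
      have h7 : (c.filter (· ≤ s + a)).length = a := by omega
      rw [h7] at h6
      rw [h6] at h5
      conv_rhs => rw [h5]
      rw [List.drop_left' (by simp)]
      exact h5
    obtain ⟨hsl, -, -⟩ := ss_append_iff.1 h
    have hSS : SS (l.map (List.drop a)) := by
      refine ⟨?_, ?_⟩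
      · intro c hc
        obtain ⟨d, hd, rfl⟩ := List.mem_map.1 hc
        exact (hsl.1 d hd).sublist (List.drop_sublist _ _)
      · rw [List.pairwise_map]
        exact hsl.2.imp fun h => h.drop a
    have hlt : ∀ c ∈ l, ∀ z ∈ c.drop a, s + a < z ∧ z ≤ s + a + b := by
      intro c hc z hz
      refine ⟨?_, (hs c (List.mem_append_left _ hc) z (List.mem_of_mem_drop hz)).2⟩
      have h3 := hsl.1 c hc
      rw [hL c hc, Sorted, List.pairwise_append] at h3
      exact h3.2.2 (s + a) (by simp; omega) z hz
    have hw : colWord (l.map (List.drop a)) = (colWord l).filter (s + a < ·) := by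
      rw [← colWord_map_filter]
      congr 1
      refine List.map_congr_left fun c hc => ?_
      conv_rhs => rw [hL c hc]
      rw [List.filter_append, List.filter_eq_nil_iff.2, List.filter_eq_self.2]
      · rfl
      · intro z hz; simpa using (hlt c hc z hz).1
      · intro z hz; simp at hz ⊢; omega
    -- The second-alphabet letters of the left columns come from a prefix of the column word, so
    -- they inherit the absence of unmatched i and form a lowest weight tableau. The right columns
    -- form a suffix and are of highest weight.
    have hend := hSS.eq_range'_of_end (s := s + a) (t := s + a + b)
      (by
        intro c hc z hz
        obtain ⟨d, hd, rfl⟩ := List.mem_map.1 hc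
        exact hlt d hd z hz)
      (by
        intro i hi hi'
        rw [hw, sig_filter _ _ (by simpa) (by simp; omega)]
        have := h2.snd i hi hi'
        rw [colWord_append, sig_append] at this
        simp only [sigMul] at this
        omega)
    intro c hc
    have h3 := hend (c.drop a) (List.mem_map_of_mem hc)
    have h4 := hL c hc
    have h5 := congrArg List.length h4
    rw [List.length_append, List.length_range'] at h5
    refine ⟨by omega, ?_⟩
    rw [h3, List.length_drop] at h4
    exact h4
  · obtain ⟨-, hsr, -⟩ := ss_append_iff.1 h
    refine hsr.eq_range' ?_ ?_
    · intro c hc z hz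
      have hc' : c ∈ l ++ r := List.mem_append_right _ hc
      by_contra! hza
      rw [hmem c hc' z hza] at hz
      exact hr c hc ((hmem c hc' _ (by omega)).2 (by omega))
    · intro i hi
      by_cases hib : i < s + a + b
      · have := h2.fst i hi hib
        rw [colWord_append, sig_append] at this
        simp only [sigMul] at this
        omega
      · refine sig_fst_of_notMem fun hm => ?_
        rw [mem_colWord] at hm
        obtain ⟨c, hc, hm⟩ := hm
        have := hs c (List.mem_append_right _ hc) _ hm
        omega

/-- In the description of `SS.two_rectangles` each column is a function of its length and of being
among the first μ ones. This is the multiplicity-freeness of a product of two rectangles. -/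
theorem SS.two_rectangles_unique {s a b μ ν : ℕ} {cs ds : List (List ℕ)} (ha : 0 < a)
    (hc : SS cs) (hd : SS ds)
    (hcs : ∀ c ∈ cs, ∀ z ∈ c, s < z ∧ z ≤ s + a + b)
    (hds : ∀ c ∈ ds, ∀ z ∈ c, s < z ∧ z ≤ s + a + b)
    (hc1 : IsRectWord s a μ (colWord cs)) (hc2 : IsRectWord (s + a) b ν (colWord cs))
    (hd1 : IsRectWord s a μ (colWord ds)) (hd2 : IsRectWord (s + a) b ν (colWord ds))
    (hl : lens cs = lens ds) : cs = ds := by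
  obtain ⟨l, r, rfl, h1, h2, h3⟩ := hc.two_rectangles ha hcs hc1 hc2
  obtain ⟨l', r', rfl, h1', h2', h3'⟩ := hd.two_rectangles ha hds hd1 hd2
  rw [lens_append, lens_append] at hl
  obtain ⟨e1, e2⟩ := List.append_inj hl (by simp [h1, h1'])
  congr 1
  · have k : ∀ l : List (List ℕ), (∀ c ∈ l, a ≤ c.length ∧ c = List.range' (s + 1) a ++
        List.range' (s + a + b + 1 - (c.length - a)) (c.length - a)) →
        l = (lens l).map fun n => List.range' (s + 1) a ++
        List.range' (s + a + b + 1 - (n - a)) (n - a) := by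
      intro l h
      rw [List.map_map]
      exact (List.map_id' _).symm.trans (List.map_congr_left fun c hc => (h c hc).2)
    rw [k l h2, k l' h2', e1]
  · have k : ∀ l : List (List ℕ), (∀ c ∈ l, c = List.range' (s + a + 1) c.length) →
        l = (lens l).map (List.range' (s + a + 1)) := by
      intro l h
      rw [List.map_map]
      exact (List.map_id' _).symm.trans (List.map_congr_left fun c hc => h c hc)
    rw [k r h3, k r' h3', e2]

theorem SS.two_rectangles_rows {s a b μ ν : ℕ} {cs : List (List ℕ)} (ha : 0 < a) (h : SS cs)
    (hs : ∀ c ∈ cs, ∀ z ∈ c, s < z ∧ z ≤ s + a + b)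
    (h1 : IsRectWord s a μ (colWord cs)) (h2 : IsRectWord (s + a) b ν (colWord cs)) :
    μ ≤ (lens cs).countP (a ≤ ·) ∧ (0 < b → ν < μ → (lens cs).countP (a + 1 ≤ ·) ≤ ν) := by
  obtain ⟨l, r, rfl, h3, h4, h5⟩ := h.two_rectangles ha hs h1 h2
  refine ⟨?_, fun hb hνμ => ?_⟩
  · rw [lens_append, List.countP_append, List.countP_eq_length.2]
    · simp [h3]
    · simpa using fun c hc => (h4 c hc).1
  -- Every left column longer than a ends with the last letter s + a + b, which occurs only ν times.
  -- As ν < μ, some left column has length exactly a, and then no right column is longer.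
  · have hl : (lens l).countP (a + 1 ≤ ·) ≤ ν := by
      rw [← h2.count (s + a + b) (by omega) le_rfl, count_eq_countP h.1, List.countP_append,
        List.countP_map]
      refine (List.countP_mono_left fun c hc hac => ?_).trans (Nat.le_add_right _ _)
      simp only [Function.comp_apply, decide_eq_true_eq] at hac ⊢
      rw [(h4 c hc).2]
      have := length_le_of_sorted (h.1 c (List.mem_append_left _ hc))
        (hs c (List.mem_append_left _ hc))
      simp; omega
    have hr : (lens r).countP (a + 1 ≤ ·) = 0 := by
      obtain ⟨c, hc, hca⟩ : ∃ c ∈ l, ¬ a + 1 ≤ c.length := by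
        by_contra! hcon
        rw [List.countP_eq_length.2 (by simpa using hcon)] at hl
        simp at hl
        omega
      rw [List.countP_eq_zero]
      simp only [List.mem_map, forall_exists_index, and_imp, forall_apply_eq_imp_iff₂,
        decide_eq_true_eq]
      intro d hd
      have := ((ss_append_iff.1 h).2.2 c hc d hd).1
      omega
    rw [lens_append, List.countP_append, hr]
    exact hl

/-! ### The number of cells to the right of a column -/

theorem countP_drop {l : List ℕ} (h : l.Pairwise (· ≥ ·)) (M r : ℕ) :
    (l.drop M).countP (r ≤ ·) = l.countP (r ≤ ·) - M := by
  induction M generalizing l with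
  | zero => rfl
  | succ M ih =>
    cases l with
    | nil => simp
    | cons x l =>
      rw [List.pairwise_cons] at h
      rw [List.drop_succ_cons, ih h.2, List.countP_cons]
      by_cases hx : r ≤ x
      · simp [hx]
      · have : l.countP (r ≤ ·) = 0 := by
          rw [List.countP_eq_zero]
          intro y hy
          have := h.1 y hy
          simp; omega
        simp [this, hx]

theorem sum_eq_sum_countP {l : List ℕ} {m : ℕ} (h : ∀ x ∈ l, x ≤ m) :
    l.sum = ∑ r ∈ Finset.range m, l.countP (r + 1 ≤ ·) := by
  induction l with
  | nil => simp
  | cons x l ih =>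
    rw [List.forall_mem_cons] at h
    simp only [List.sum_cons, List.countP_cons, Finset.sum_add_distrib, ← ih h.2,
      decide_eq_true_eq]
    rw [add_comm]
    congr 1
    rw [← Finset.sum_filter, Finset.sum_const, smul_eq_mul, mul_one]
    have : (Finset.range m).filter (fun r => r + 1 ≤ x) = Finset.range x := by
      ext; simp; omega
    rw [this, Finset.card_range]

/-- Counts the cells beyond column M by rows instead of columns: a row of length ρ contributes ρ -
M, truncated at zero. -/
theorem sum_drop_lens {cs : List (List ℕ)} (h : SS cs) {m : ℕ} (hm : ∀ c ∈ cs, c.length ≤ m)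
    (M : ℕ) : ((cs.drop M).map List.length).sum =
      ∑ r ∈ Finset.range m, ((lens cs).countP (r + 1 ≤ ·) - M) := by
  rw [List.map_drop, sum_eq_sum_countP (m := m)]
  · refine Finset.sum_congr rfl fun r _ => countP_drop ?_ M _
    rw [List.pairwise_map]
    exact h.2.imp fun h => h.1
  · intro x hx
    obtain ⟨c, hc, rfl⟩ := List.mem_map.1 (List.mem_of_mem_drop hx)
    exact hm c hc

/-! ### Reading words of tableaux -/

/-- The cells of a diagram in the order of the row-reading word. -/
def rowCells (Λ : YoungDiagram) : List (ℕ × ℕ) :=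
  (List.range (Λ.colLen 0)).reverse.flatMap fun i => (List.range (Λ.rowLen i)).map fun j => (i, j)

theorem mem_rowCells {Λ : YoungDiagram} {c : ℕ × ℕ} : c ∈ rowCells Λ ↔ c ∈ Λ := by
  obtain ⟨i, j⟩ := c
  simp only [rowCells, List.mem_flatMap, List.mem_reverse, List.mem_range, List.mem_map,
    Prod.mk.injEq]
  constructor
  · rintro ⟨i', -, j', hj, rfl, rfl⟩
    exact YoungDiagram.mem_iff_lt_rowLen.2 hj
  · intro h
    refine ⟨i, ?_, j, YoungDiagram.mem_iff_lt_rowLen.1 h, rfl, rfl⟩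
    exact YoungDiagram.mem_iff_lt_colLen.1 (Λ.up_left_mem le_rfl (Nat.zero_le j) h)

theorem nodup_rowCells (Λ : YoungDiagram) : (rowCells Λ).Nodup := by
  unfold rowCells
  rw [List.nodup_flatMap]
  constructor
  · intro i _
    exact List.nodup_range.map fun a b h => (Prod.mk.inj h).2
  · refine (List.nodup_reverse.2 List.nodup_range).imp ?_
    intro a b hab
    rw [Function.onFun, List.disjoint_left]
    simp only [List.mem_map, not_exists, not_and]
    rintro _ ⟨j, -, rfl⟩ j' - h
    exact hab (Prod.mk.inj h).1.symm

variable {Λ : YoungDiagram}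

theorem rowWord_eq_map (T : SemistandardYoungTableau Λ) :
    rowWord T = (rowCells Λ).map fun c => T c.1 c.2 := by
  simp [rowWord, rowCells, List.map_flatMap, Function.comp_def]

theorem mult_eq_count (T : SemistandardYoungTableau Λ) (x : ℕ) :
    mult T x = (rowWord T).count x := by
  rw [rowWord_eq_map, List.count, List.countP_map, List.countP_eq_length_filter, mult,
    ← List.toFinset_card_of_nodup ((nodup_rowCells Λ).filter _)]
  congr 1
  ext c
  simp [mem_rowCells]

theorem mem_rowWord {T : SemistandardYoungTableau Λ} {x : ℕ} :
    x ∈ rowWord T ↔ ∃ i j, (i, j) ∈ Λ ∧ T i j = x := by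
  rw [rowWord_eq_map, List.mem_map]
  simp [mem_rowCells]

theorem mem_CST_iff {A : Finset ℕ} {T : SemistandardYoungTableau Λ} :
    T ∈ CST A Λ ↔ ∀ x ∈ rowWord T, x ∈ A := by
  simp only [mem_rowWord, CST, Set.mem_ofPred_eq]
  exact ⟨fun h x ⟨i, j, hc, e⟩ => e ▸ h i j hc, fun h i j hc => h _ ⟨i, j, hc, rfl⟩⟩

theorem rowWord_injective {T T' : SemistandardYoungTableau Λ} (h : rowWord T = rowWord T') :
    T = T' := by
  rw [rowWord_eq_map, rowWord_eq_map, List.map_inj_left] at h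
  ext i j
  by_cases hc : (i, j) ∈ Λ
  · exact h (i, j) (mem_rowCells.2 hc)
  · rw [T.zeros hc, T'.zeros hc]

theorem length_rowWord (T T' : SemistandardYoungTableau Λ) :
    (rowWord T).length = (rowWord T').length := by
  rw [rowWord_eq_map, rowWord_eq_map, List.length_map, List.length_map]

/-- The letters of a column of a tableau, from top to bottom. -/
def colList (T : SemistandardYoungTableau Λ) (j : ℕ) : List ℕ :=
  (List.range (Λ.colLen j)).map fun i => T i j

/-- The first `k` columns of a tableau. -/
def colsOf (k : ℕ) (T : SemistandardYoungTableau Λ) : List (List ℕ) :=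
  (List.range k).map (colList T)

/-! ### The insertion tableau of a row-reading word -/

/-- Append the letters of a row at the bottoms of the first columns. -/
def appendRow : List ℕ → List (List ℕ) → List (List ℕ)
  | [], cs => cs
  | x :: xs, [] => [x] :: appendRow xs []
  | x :: xs, c :: cs => (c ++ [x]) :: appendRow xs cs

theorem length_appendRow (xs : List ℕ) (cs : List (List ℕ)) :
    (appendRow xs cs).length = max xs.length cs.length := by
  induction xs generalizing cs with
  | nil => simp [appendRow]
  | cons x xs ih => cases cs <;> simp [appendRow, ih]

theorem getD_appendRow (xs : List ℕ) (cs : List (List ℕ)) (j : ℕ) :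
    (appendRow xs cs).getD j [] =
      cs.getD j [] ++ if j < xs.length then [xs.getD j 0] else [] := by
  induction xs generalizing cs j with
  | nil => simp [appendRow]
  | cons x xs ih =>
    cases cs <;> cases j
    · simp [appendRow]
    · simp only [appendRow, List.getD_cons_succ, ih]
      simp
    · simp [appendRow]
    · simp only [appendRow, List.getD_cons_succ, ih]
      simp

/-- A weakly increasing row which can be placed below the given columns. -/
def RowFits (xs : List ℕ) (cs : List (List ℕ)) : Prop :=
  xs.Pairwise (· ≤ ·) ∧ ∀ j, j < xs.length → ∀ z ∈ cs.getD j [], z < xs.getD j 0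

theorem RowFits.tail {x : ℕ} {xs : List ℕ} {cs : List (List ℕ)} (h : RowFits (x :: xs) cs) :
    RowFits xs cs := by
  refine ⟨(List.pairwise_cons.1 h.1).2, fun j hj z hz => ?_⟩
  refine (h.2 j (by simp; omega) z hz).trans_le ?_
  have h1 := List.pairwise_iff_getElem.1 h.1 j (j + 1) (by simp; omega) (by simpa) (by omega)
  rw [List.getD_eq_getElem _ _ (by simp; omega), List.getD_eq_getElem _ _ hj]
  simpa using h1

/-- Each inserted letter bumps the bottom entry of the first column into the next one, and so on:
the partial bottom row shifts one column to the right. -/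
theorem columnInsert_appendRow {x : ℕ} {xs : List ℕ} {cs : List (List ℕ)}
    (h : RowFits (x :: xs) cs) :
    columnInsert x (appendRow xs cs) = (appendRow (x :: xs) cs, xs.length) := by
  induction xs generalizing x cs with
  | nil =>
    cases cs with
    | nil => simp [appendRow, columnInsert]
    | cons c cs =>
      have := h.2 0 (by simp)
      simp only [appendRow]
      rw [columnInsert_cons_none (bumpColumn_of_lt (by simpa using this))]
      rfl
  | cons y ys ih =>
    have hxy : x ≤ y := (List.pairwise_cons.1 h.1).1 y (by simp)
    cases cs with
    | nil =>
      simp only [appendRow]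
      have e : bumpColumn x [y] = ([x], some y) :=
        bumpColumn_append (a := []) (b := []) (by simp) hxy
      rw [columnInsert_cons_some e, ih ⟨h.tail.1, by simp⟩]
      rfl
    | cons c cs =>
      have h0 := h.2 0 (by simp)
      simp only [appendRow]
      rw [columnInsert_cons_some (bumpColumn_append (a := c) (b := []) (by simpa using h0) hxy), ih]
      · rfl
      · refine ⟨h.tail.1, fun j hj z hz => ?_⟩
        have := h.2 (j + 1) (by simpa using hj) z (by simpa using hz)
        simpa using this

theorem insertionTableau_row {xs w : List ℕ} (h : RowFits xs (insertionTableau w)) :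
    insertionTableau (xs ++ w) = appendRow xs (insertionTableau w) := by
  induction xs with
  | nil => rfl
  | cons x xs ih =>
    rw [List.cons_append, insertionTableau_cons, ih h.tail, columnInsert_appendRow h]

theorem recordingTableau_row {xs w xs' w' : List ℕ} (h : RowFits xs (insertionTableau w))
    (h' : RowFits xs' (insertionTableau w')) (hx : xs.length = xs'.length)
    (hw : w.length = w'.length) (hQ : recordingTableau w = recordingTableau w') :
    recordingTableau (xs ++ w) = recordingTableau (xs' ++ w') := by
  induction xs generalizing xs' with
  | nil => rw [List.eq_nil_of_length_eq_zero hx.symm]; exact hQ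
  | cons x xs ih =>
    cases xs' with
    | nil => simp at hx
    | cons x' xs' =>
      simp only [List.length_cons, add_left_inj] at hx
      rw [List.cons_append, List.cons_append, recordingTableau_cons, recordingTableau_cons,
        ih h.tail h'.tail hx, insertionTableau_row h.tail, insertionTableau_row h'.tail,
        columnInsert_appendRow h, columnInsert_appendRow h', List.length_append,
        List.length_append, hx, hw]

/-- The row-reading word of the first `r` rows. -/
def rowWordTop (T : SemistandardYoungTableau Λ) (r : ℕ) : List ℕ :=
  (List.range r).reverse.flatMap fun i => (List.range (Λ.rowLen i)).map fun j => T i j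

theorem rowWordTop_succ (T : SemistandardYoungTableau Λ) (r : ℕ) : rowWordTop T (r + 1) =
    ((List.range (Λ.rowLen r)).map fun j => T r j) ++ rowWordTop T r := by
  simp [rowWordTop, List.range_succ]

theorem rowFits_of_getD {T : SemistandardYoungTableau Λ} {r : ℕ} {cs : List (List ℕ)}
    (h : ∀ j, cs.getD j [] = (List.range (min r (Λ.colLen j))).map fun i => T i j) :
    RowFits ((List.range (Λ.rowLen r)).map fun j => T r j) cs := by
  constructor
  · rw [List.pairwise_map]
    refine List.pairwise_lt_range.imp_of_mem fun {a b} _ hb hab => ?_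
    exact T.row_weak_of_le hab.le (YoungDiagram.mem_iff_lt_rowLen.2 (List.mem_range.1 hb))
  · intro j hj z hz
    rw [h, List.mem_map] at hz
    obtain ⟨i, hi, rfl⟩ := hz
    rw [List.mem_range] at hi
    rw [List.length_map, List.length_range] at hj
    rw [List.getD_eq_getElem _ _ (by simpa)]
    simp only [List.getElem_map, List.getElem_range]
    exact T.col_strict (by omega) (YoungDiagram.mem_iff_lt_rowLen.2 hj)

/-- Inserting a row word from right to left builds the tableau row by row from the top. The length
is recorded separately because `getD` does not see trailing empty columns. -/
theorem getD_insertionTableau_rowWordTop (T : SemistandardYoungTableau Λ) (r : ℕ) :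
    (∀ j, (insertionTableau (rowWordTop T r)).getD j [] =
      (List.range (min r (Λ.colLen j))).map fun i => T i j) ∧
    (insertionTableau (rowWordTop T r)).length = if r = 0 then 0 else Λ.rowLen 0 := by
  induction r with
  | zero => simp [rowWordTop]
  | succ r ih =>
    rw [rowWordTop_succ, insertionTableau_row (rowFits_of_getD ih.1)]
    constructor
    · intro j
      rw [getD_appendRow, ih.1]
      simp only [List.length_map, List.length_range]
      have : j < Λ.rowLen r ↔ r < Λ.colLen j := by
        rw [← YoungDiagram.mem_iff_lt_rowLen, YoungDiagram.mem_iff_lt_colLen]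
      by_cases hj : j < Λ.rowLen r
      · rw [if_pos hj, List.getD_eq_getElem _ _ (by simpa), min_eq_left (by omega),
          min_eq_left (by omega), List.range_succ]
        simp
      · rw [if_neg hj, min_eq_right (by omega), min_eq_right (by omega)]
        simp
    · rw [length_appendRow, ih.2]
      have := Λ.rowLen_anti 0 r (Nat.zero_le r)
      rw [if_neg (Nat.succ_ne_zero r), List.length_map, List.length_range]
      split_ifs with h
      · subst h; simp
      · omega

theorem rowWord_eq_rowWordTop (T : SemistandardYoungTableau Λ) :
    rowWord T = rowWordTop T (Λ.colLen 0) := rfl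

theorem colLen_eq_zero_iff {j : ℕ} : Λ.colLen j = 0 ↔ Λ.rowLen 0 ≤ j := by
  have h1 : (0, j) ∈ Λ ↔ _ := YoungDiagram.mem_iff_lt_colLen
  have h2 : (0, j) ∈ Λ ↔ _ := YoungDiagram.mem_iff_lt_rowLen
  rw [h1] at h2
  omega

theorem ext_getD {cs ds : List (List ℕ)} (hl : cs.length = ds.length)
    (h : ∀ j, cs.getD j [] = ds.getD j []) : cs = ds := by
  refine List.ext_getElem hl fun j h1 h2 => ?_
  have := h j
  rwa [List.getD_eq_getElem _ _ h1, List.getD_eq_getElem _ _ h2] at this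

theorem getD_colsOf (k : ℕ) (T : SemistandardYoungTableau Λ) (j : ℕ) :
    (colsOf k T).getD j [] = if j < k then colList T j else [] := by
  unfold colsOf
  split_ifs with h
  · rw [List.getD_eq_getElem _ _ (by simpa)]; simp
  · rw [List.getD_eq_default _ _ (by simpa using h)]

theorem insertionTableau_rowWord (T : SemistandardYoungTableau Λ) :
    insertionTableau (rowWord T) = colsOf (Λ.rowLen 0) T := by
  obtain ⟨h1, h2⟩ := getD_insertionTableau_rowWordTop T (Λ.colLen 0)
  rw [rowWord_eq_rowWordTop]
  refine ext_getD ?_ fun j => ?_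
  · rw [h2, colsOf, List.length_map, List.length_range]
    split_ifs with h
    · rw [colLen_eq_zero_iff] at h; omega
    · rfl
  · rw [h1, getD_colsOf, min_eq_right (Λ.colLen_anti 0 j (Nat.zero_le j))]
    split_ifs with h
    · rfl
    · rw [colLen_eq_zero_iff.2 (by omega)]; rfl

/-- Every row is added from its first column to its last, whatever its letters are, so the order of
the new cells depends on the shape alone. -/
theorem recordingTableau_rowWord (T T' : SemistandardYoungTableau Λ) :
    recordingTableau (rowWord T) = recordingTableau (rowWord T') := by
  rw [rowWord_eq_rowWordTop, rowWord_eq_rowWordTop]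
  suffices ∀ r, (rowWordTop T r).length = (rowWordTop T' r).length ∧
      recordingTableau (rowWordTop T r) = recordingTableau (rowWordTop T' r) from (this _).2
  intro r
  induction r with
  | zero => simp [rowWordTop]
  | succ r ih =>
    rw [rowWordTop_succ, rowWordTop_succ]
    refine ⟨by simp [ih.1], recordingTableau_row
      (rowFits_of_getD (getD_insertionTableau_rowWordTop T r).1)
      (rowFits_of_getD (getD_insertionTableau_rowWordTop T' r).1) (by simp) ih.1 ih.2⟩

/-! ### Tableaux from columns -/

theorem SS.getD_sorted {cs : List (List ℕ)} (h : SS cs) (j : ℕ) : Sorted (cs.getD j []) := by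
  by_cases hj : j < cs.length
  · rw [List.getD_eq_getElem _ _ hj]; exact h.1 _ (List.getElem_mem hj)
  · rw [List.getD_eq_default _ _ (by omega)]; exact .nil

theorem SS.getD_dom {cs : List (List ℕ)} (h : SS cs) {j₁ j₂ : ℕ} (hj : j₁ < j₂)
    (h2 : 0 < (cs.getD j₂ []).length) : Dom (cs.getD j₁ []) (cs.getD j₂ []) := by
  by_cases hj2 : j₂ < cs.length
  · rw [List.getD_eq_getElem _ _ hj2, List.getD_eq_getElem _ _ (by omega)]
    exact List.pairwise_iff_getElem.1 h.2 _ _ _ _ hj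
  · rw [List.getD_eq_default _ _ (by omega)] at h2; simp at h2

/-- The tableau with given columns. -/
def ofCols (Λ : YoungDiagram) (cs : List (List ℕ)) (h : SS cs)
    (hl : ∀ j, (cs.getD j []).length = Λ.colLen j) : SemistandardYoungTableau Λ where
  entry i j := (cs.getD j []).getD i 0
  row_weak' := by
    intro i j₁ j₂ hj hc
    rw [YoungDiagram.mem_iff_lt_colLen, ← hl] at hc
    exact (h.getD_dom hj (by omega)).2 i hc
  col_strict' := by
    intro i₁ i₂ j hi hc
    rw [YoungDiagram.mem_iff_lt_colLen, ← hl] at hc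
    rw [List.getD_eq_getElem _ _ hc, List.getD_eq_getElem _ _ (hi.trans hc)]
    exact List.pairwise_iff_getElem.1 (h.getD_sorted j) _ _ _ _ hi
  zeros' := by
    intro i j hc
    rw [YoungDiagram.mem_iff_lt_colLen, ← hl] at hc
    exact List.getD_eq_default _ _ (by omega)

theorem length_eq_rowLen {cs : List (List ℕ)} (hn : [] ∉ cs)
    (hl : ∀ j, (cs.getD j []).length = Λ.colLen j) : cs.length = Λ.rowLen 0 := by
  refine le_antisymm ?_ ?_
  · by_contra! h
    have h1 := hl (Λ.rowLen 0)
    rw [colLen_eq_zero_iff.2 le_rfl, List.getD_eq_getElem _ _ h, List.length_eq_zero_iff] at h1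
    exact hn (h1 ▸ List.getElem_mem h)
  · rw [← colLen_eq_zero_iff, ← hl, List.getD_eq_default _ _ le_rfl]; rfl

theorem colsOf_eq_of_isColumnsOf {cs : List (List ℕ)} (hn : [] ∉ cs)
    (hl : ∀ j, (cs.getD j []).length = Λ.colLen j) {T : SemistandardYoungTableau Λ}
    (h : IsColumnsOf cs T) : colsOf (Λ.rowLen 0) T = cs := by
  refine ext_getD ?_ fun j => ?_
  · rw [length_eq_rowLen hn hl]; simp [colsOf]
  · rw [getD_colsOf]
    split_ifs with hj
    · refine List.ext_getElem (by rw [hl]; simp [colList]) fun i h1 h2 => ?_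
      simp only [colList, List.getElem_map, List.getElem_range]
      rw [h i j, List.getD_eq_getElem _ _ h2]
    · symm
      rw [← List.length_eq_zero_iff, hl, colLen_eq_zero_iff]
      omega

theorem length_getD_eq (cs : List (List ℕ)) (j : ℕ) :
    (cs.getD j []).length = (lens cs).getD j 0 := by
  simp only [List.getD_eq_getElem?_getD, List.getElem?_map]
  cases cs[j]? <;> rfl

theorem length_getD_colsOf (T : SemistandardYoungTableau Λ) (j : ℕ) :
    ((colsOf (Λ.rowLen 0) T).getD j []).length = Λ.colLen j := by
  rw [getD_colsOf]
  split_ifs with h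
  · simp [colList]
  · exact (colLen_eq_zero_iff.2 (by omega)).symm

/-- A word with the recording tableau of a tableau of shape `Λ` is the word of such a tableau. -/
theorem exists_rowWord_eq (T : SemistandardYoungTableau Λ) {w : List ℕ}
    (hl : w.length = (rowWord T).length) (hQ : recordingTableau w = recordingTableau (rowWord T)) :
    ∃ T' : SemistandardYoungTableau Λ, rowWord T' = w := by
  have h1 : ∀ j, ((insertionTableau w).getD j []).length = Λ.colLen j := by
    intro j
    rw [length_getD_eq, ← lens_recordingTableau, hQ, lens_recordingTableau, ← length_getD_eq,
      insertionTableau_rowWord, length_getD_colsOf]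
  -- The tableau sought is the insertion tableau of w itself: its row word inserts to it and has the
  -- same recording tableau as w.
  refine ⟨ofCols Λ _ (ss_insertionTableau w) h1, ?_⟩
  refine columnRSK_inj (by rw [hl]; exact length_rowWord _ _) ?_ ?_
  · rw [insertionTableau_rowWord]
    exact colsOf_eq_of_isColumnsOf (nonempty_insertionTableau w) h1 fun i j => rfl
  · rw [hQ]; exact recordingTableau_rowWord _ _

/-- The lowering operators on tableaux. -/
def Step (i : ℕ) (T T' : SemistandardYoungTableau Λ) : Prop := Lower i (rowWord T) (rowWord T')

theorem exists_step {i : ℕ} {T : SemistandardYoungTableau Λ} (h : 0 < (sig i (rowWord T)).2) :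
    ∃ T', Step i T T' := by
  obtain ⟨w, hw⟩ := exists_lower h
  obtain ⟨T', rfl⟩ := exists_rowWord_eq T hw.length_eq.symm hw.insertionTableau.1.symm
  exact ⟨T', hw⟩

theorem exists_step_to {i : ℕ} {T : SemistandardYoungTableau Λ} (h : 0 < (sig i (rowWord T)).1) :
    ∃ T', Step i T' T := by
  obtain ⟨w, hw⟩ := exists_raise h
  obtain ⟨T', rfl⟩ := exists_rowWord_eq T hw.length_eq hw.insertionTableau.1
  exact ⟨T', hw⟩

theorem sig_colWord_colsOf (i : ℕ) (T : SemistandardYoungTableau Λ) :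
    sig i (colWord (colsOf (Λ.rowLen 0) T)) = sig i (rowWord T) := by
  rw [← insertionTableau_rowWord, sig_insertionTableau]

theorem perm_colWord_colsOf (T : SemistandardYoungTableau Λ) :
    (colWord (colsOf (Λ.rowLen 0) T)).Perm (rowWord T) := by
  rw [← insertionTableau_rowWord]; exact perm_insertionTableau _

/-- Row and column reading define the same operators. Conversely to `Lower.insertionTableau`, the
step that exists on row words has the prescribed effect on column words, as f_i is single-valued.
Column reading is the convenient form for complements. -/
theorem step_iff (i : ℕ) (T T' : SemistandardYoungTableau Λ) : Step i T T' ↔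
    Lower i (colWord (colsOf (Λ.rowLen 0) T)) (colWord (colsOf (Λ.rowLen 0) T')) := by
  rw [← insertionTableau_rowWord, ← insertionTableau_rowWord]
  refine ⟨fun h => h.insertionTableau.2, fun h => ?_⟩
  have h1 := h.snd_pos
  rw [sig_insertionTableau] at h1
  obtain ⟨T₁, h2⟩ := exists_step h1
  have h3 := h.unique h2.insertionTableau.2
  rw [insertionTableau_rowWord, insertionTableau_rowWord] at h3
  have h4 : colsOf (Λ.rowLen 0) T' = colsOf (Λ.rowLen 0) T₁ := by
    refine colWord_inj ?_ h3
    simp [colsOf, lens, colList, Function.comp_def]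
  rw [← insertionTableau_rowWord, ← insertionTableau_rowWord] at h4
  rwa [rowWord_injective (columnRSK_inj (length_rowWord _ _) h4 (recordingTableau_rowWord _ _))]

/-! ### Littlewood-Richardson tableaux and extremal words -/

theorem IsRectWord.of_sig {s a μ : ℕ} {w w' : List ℕ} (h : IsRectWord s a μ w)
    (hc : ∀ z, s < z → z ≤ s + a → w'.count z = w.count z)
    (hs : ∀ i, s < i → i < s + a → sig i w' = sig i w) : IsRectWord s a μ w' :=
  ⟨fun z h1 h2 => by rw [hc z h1 h2, h.count z h1 h2],
    fun i h1 h2 => by rw [hs i h1 h2, h.fst i h1 h2]⟩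

theorem isRectWord_insertionTableau {s a μ : ℕ} {w : List ℕ} :
    IsRectWord s a μ (colWord (insertionTableau w)) ↔ IsRectWord s a μ w :=
  ⟨fun h => h.of_sig (fun _ _ _ => ((perm_insertionTableau w).count_eq _).symm)
      fun _ _ _ => (sig_insertionTableau _ _).symm,
    fun h => h.of_sig (fun _ _ _ => (perm_insertionTableau w).count_eq _)
      fun _ _ _ => sig_insertionTableau _ _⟩

theorem isRectWord_filter {s a μ : ℕ} {w : List ℕ} {p : ℕ → Bool}
    (hp : ∀ z, s < z → z ≤ s + a → p z) :
    IsRectWord s a μ (w.filter p) ↔ IsRectWord s a μ w :=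
  ⟨fun h => h.of_sig (fun z h1 h2 => by rw [List.count_filter (hp z h1 h2)])
      fun i h1 h2 => (sig_filter i p (hp i h1 h2.le) (hp _ (by omega) (by omega)) w).symm,
    fun h => h.of_sig (fun z h1 h2 => by rw [List.count_filter (hp z h1 h2)])
      fun i h1 h2 => sig_filter i p (hp i h1 h2.le) (hp _ (by omega) (by omega)) w⟩

theorem mem_LRTin_iff {t a : ℕ} {R : Fin t → Rect} {T : SemistandardYoungTableau Λ} :
    T ∈ LRTin a R Λ ↔ (∀ x ∈ rowWord T, a < x ∧ x ≤ a + totalRows R) ∧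
      ∀ i, IsRectWord (a + start R i) (R i).rows (R i).cols (rowWord T) := by
  simp only [LRTin, Set.mem_ofPred_eq, mem_CST_iff, isLattice_filter_iff, mult_eq_count]
  simp only [subalphabet, Finset.mem_Icc, Nat.add_one_le_iff, and_congr_right_iff]
  intro _
  rw [← forall_and]
  refine forall_congr' fun i => ⟨fun h => ⟨fun z h1 h2 => h.1 z ⟨h1, h2⟩, fun z h1 h2 =>
    h.2 z ⟨h1, h2.le⟩ ⟨by omega, by omega⟩⟩, fun h => ⟨fun z hz => h.count z hz.1 hz.2,
    fun z h1 h2 => h.fst z h1.1 (by omega)⟩⟩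

/-! ### Connected components for an interval of letters -/

/-- The row-reading word of the restriction to the alphabet `[s + 1, t]`. -/
def intervalWord (s t : ℕ) (T : SemistandardYoungTableau Λ) : List ℕ :=
  (rowWord T).filter (· ∈ Finset.Icc (s + 1) t)

theorem mem_intervalWord {s t : ℕ} {T : SemistandardYoungTableau Λ} {z : ℕ}
    (h : z ∈ intervalWord s t T) : s < z ∧ z ≤ t := by
  rw [intervalWord, List.mem_filter] at h
  simpa [Nat.succ_le_iff] using h.2

theorem sig_intervalWord {s t i : ℕ} (hi : s < i) (hi' : i < t) (T : SemistandardYoungTableau Λ) :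
    sig i (intervalWord s t T) = sig i (rowWord T) :=
  sig_filter i _ (by simp; omega) (by simp; omega) _

theorem Step.intervalWord {s t i : ℕ} (hi : s < i) (hi' : i < t) {T T' : SemistandardYoungTableau Λ}
    (h : Step i T T') : Lower i (RectLR.intervalWord s t T) (RectLR.intervalWord s t T') :=
  Lower.filter h _ (by simp; omega) (by simp; omega)

/-- `T'` is obtained from `T` by crystal operators for the letters in `[s + 1, t]`. -/
def Conn (s t : ℕ) (T T' : SemistandardYoungTableau Λ) : Prop :=
  Relation.EqvGen (fun A B => ∃ i, s < i ∧ i < t ∧ Step i A B) T T'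

theorem Conn.symm {s t : ℕ} {T T' : SemistandardYoungTableau Λ} (h : Conn s t T T') :
    Conn s t T' T := Relation.EqvGen.symm _ _ h

theorem Conn.trans {s t : ℕ} {T T' T'' : SemistandardYoungTableau Λ} (h : Conn s t T T')
    (h' : Conn s t T' T'') : Conn s t T T'' := Relation.EqvGen.trans _ _ _ h h'

theorem Conn.of_step {s t i : ℕ} (hi : s < i) (hi' : i < t) {T T' : SemistandardYoungTableau Λ}
    (h : Step i T T') : Conn s t T T' := .rel _ _ ⟨i, hi, hi', h⟩

/-- The letters in `[s + 1, t]` of the two tableaux fill the same cells, and their other letters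
agree. -/
def Agree (s t : ℕ) (T T' : SemistandardYoungTableau Λ) : Prop :=
  ∀ c ∈ rowCells Λ, (T c.1 c.2 ∈ Finset.Icc (s + 1) t ↔ T' c.1 c.2 ∈ Finset.Icc (s + 1) t) ∧
    (T c.1 c.2 ∉ Finset.Icc (s + 1) t → T' c.1 c.2 = T c.1 c.2)

theorem Agree.symm {s t : ℕ} {T T' : SemistandardYoungTableau Λ} (h : Agree s t T T') :
    Agree s t T' T :=
  fun c hc => ⟨(h c hc).1.symm, fun hn => ((h c hc).2 fun h' => hn ((h c hc).1.1 h')).symm⟩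

theorem Agree.trans {s t : ℕ} {T T' T'' : SemistandardYoungTableau Λ} (h : Agree s t T T')
    (h' : Agree s t T' T'') : Agree s t T T'' :=
  fun c hc => ⟨(h c hc).1.trans (h' c hc).1, fun hn => by
    rw [(h' c hc).2 fun hm => hn ((h c hc).1.2 hm), (h c hc).2 hn]⟩

theorem Step.cells {i : ℕ} {T T' : SemistandardYoungTableau Λ} (h : Step i T T') :
    ∀ c ∈ rowCells Λ, T' c.1 c.2 = T c.1 c.2 ∨ (T c.1 c.2 = i ∧ T' c.1 c.2 = i + 1) := by
  have := Lower.forall₂ h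
  rw [rowWord_eq_map, rowWord_eq_map, List.forall₂_map_left_iff, List.forall₂_map_right_iff,
    List.forall₂_same] at this
  exact this

theorem Conn.agree {s t : ℕ} {T T' : SemistandardYoungTableau Λ} (h : Conn s t T T') :
    Agree s t T T' := by
  induction h with
  | rel T T' h =>
    obtain ⟨i, hi, hi', h⟩ := h
    intro c hc
    simp only [Finset.mem_Icc]
    rcases h.cells c hc with e | ⟨e, e'⟩
    · simp [e]
    · rw [e, e']; omega
  | refl T => exact fun c _ => ⟨Iff.rfl, fun _ => rfl⟩
  | symm _ _ _ ih => exact ih.symm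
  | trans _ _ _ _ _ ih ih' => exact ih.trans ih'

/-- Both restriction to the interval and insertion are compatible with each operator of the
interval. -/
theorem Conn.recordingTableau_eq {s t : ℕ} {T T' : SemistandardYoungTableau Λ}
    (h : Conn s t T T') :
    recordingTableau (intervalWord s t T) = recordingTableau (intervalWord s t T') := by
  induction h with
  | rel T T' h =>
    obtain ⟨i, hi, hi', h⟩ := h
    exact (h.intervalWord hi hi').insertionTableau.1
  | refl T => rfl
  | symm _ _ _ ih => exact ih.symm
  | trans _ _ _ _ _ ih ih' => exact ih.trans ih'

/-! ### Components and recording tableaux. -/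

theorem lens_eq_of_recordingTableau_eq {w w' : List ℕ}
    (h : recordingTableau w = recordingTableau w') :
    lens (insertionTableau w) = lens (insertionTableau w') := by
  rw [← lens_recordingTableau, h, lens_recordingTableau]

theorem length_eq_sum_lens (w : List ℕ) : w.length = (lens (insertionTableau w)).sum := by
  rw [← (perm_insertionTableau w).length_eq, colWord, List.length_flatMap]
  simp [lens]

theorem word_eq_of_recordingTableau_eq {w w' : List ℕ}
    (hQ : recordingTableau w = recordingTableau w')
    (hP : insertionTableau w = insertionTableau w') : w = w' :=
  columnRSK_inj (by rw [length_eq_sum_lens, length_eq_sum_lens, hP]) hP hQ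

theorem Agree.eq {s t : ℕ} {T T' : SemistandardYoungTableau Λ} (h : Agree s t T T')
    (hw : intervalWord s t T = intervalWord s t T') : T = T' := by
  apply rowWord_injective
  unfold intervalWord at hw
  rw [rowWord_eq_map, rowWord_eq_map] at *
  unfold Agree at h
  generalize rowCells Λ = l at h hw ⊢
  induction l with
  | nil => rfl
  | cons c l ih =>
    rw [List.forall_mem_cons] at h
    rw [List.map_cons, List.map_cons] at hw ⊢
    by_cases hc : T c.1 c.2 ∈ Finset.Icc (s + 1) t
    · have hc' := h.1.1.1 hc
      rw [List.filter_cons_of_pos (by simpa using hc),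
        List.filter_cons_of_pos (by simpa using hc')] at hw
      obtain ⟨h1, h2⟩ := List.cons.inj hw
      rw [h1, ih h.2 h2]
    · have hc' := fun h' => hc (h.1.1.2 h')
      rw [List.filter_cons_of_neg (by simpa using hc),
        List.filter_cons_of_neg (by simpa using hc')] at hw
      rw [h.1.2 hc, ih h.2 hw]

/-- Raising lowers the sum of the letters, so it stops at a tableau without unmatched i + 1. -/
theorem exists_highest (s t : ℕ) (T : SemistandardYoungTableau Λ) :
    ∃ Y, Conn s t T Y ∧ ∀ i, s < i → i < t → (sig i (rowWord Y)).1 = 0 := by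
  generalize hn : (rowWord T).sum = n
  induction n using Nat.strong_induction_on generalizing T with
  | _ n ih =>
    by_cases h : ∃ i, s < i ∧ i < t ∧ 0 < (sig i (rowWord T)).1
    · obtain ⟨i, hi, hi', h⟩ := h
      obtain ⟨T', hT'⟩ := exists_step_to h
      have := Lower.sum_eq hT'
      obtain ⟨Y, h1, h2⟩ := ih _ (by omega) T' rfl
      exact ⟨Y, (Conn.of_step hi hi' hT').symm.trans h1, h2⟩
    · push Not at h
      exact ⟨T, .refl _, fun i hi hi' => Nat.le_zero.1 (h i hi hi')⟩

/-- The words of highest weight, in the alphabet `[s + 1, t]`. -/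
structure IsHighest (s t : ℕ) (w : List ℕ) : Prop where
  mem : ∀ z ∈ w, s < z ∧ z ≤ t
  fst : ∀ i, s < i → i < t → (sig i w).1 = 0

theorem IsHighest.fst_eq {s t : ℕ} {w : List ℕ} (h : IsHighest s t w) (i : ℕ) (hi : s < i) :
    (sig i w).1 = 0 := by
  by_cases hit : i < t
  · exact h.fst i hi hit
  · exact sig_fst_of_notMem fun hm => by have := h.mem _ hm; omega

/-- In the insertion tableau of a highest weight word, row r is constant, so its shape says
everything. -/
theorem IsHighest.insertionTableau_eq {s t : ℕ} {w w' : List ℕ} (h : IsHighest s t w)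
    (h' : IsHighest s t w') (hl : lens (insertionTableau w) = lens (insertionTableau w')) :
    insertionTableau w = insertionTableau w' := by
  rw [insertionTableau_eq_of_highest (fun z hz => (h.mem z hz).1) h.fst_eq,
    insertionTableau_eq_of_highest (fun z hz => (h'.mem z hz).1) h'.fst_eq, hl]

theorem isHighest_intervalWord {s t : ℕ} {Y : SemistandardYoungTableau Λ}
    (h : ∀ i, s < i → i < t → (sig i (rowWord Y)).1 = 0) : IsHighest s t (intervalWord s t Y) :=
  ⟨fun _ => mem_intervalWord, fun i hi hi' => by rw [sig_intervalWord hi hi', h i hi hi']⟩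

/-- Two tableaux are connected if the words of their restrictions have the same recording
tableau. -/
theorem Agree.conn {s t : ℕ} {T T' : SemistandardYoungTableau Λ} (h : Agree s t T T')
    (hQ : recordingTableau (intervalWord s t T) = recordingTableau (intervalWord s t T')) :
    Conn s t T T' := by
  obtain ⟨Y, h1, h2⟩ := exists_highest s t T
  obtain ⟨Y', h1', h2'⟩ := exists_highest s t T'
  have hQ' : recordingTableau (intervalWord s t Y) = recordingTableau (intervalWord s t Y') := by
    rw [← h1.recordingTableau_eq, hQ, h1'.recordingTableau_eq]
  have hP := (isHighest_intervalWord h2).insertionTableau_eq (isHighest_intervalWord h2')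
    (lens_eq_of_recordingTableau_eq hQ')
  -- The two highest weight tableaux have the same restricted word, and the same cells and letters
  -- outside the interval.
  have hY : Y = Y' := ((h1.agree.symm.trans h).trans h1'.agree).eq
    (word_eq_of_recordingTableau_eq hQ' hP)
  subst hY
  exact h1.trans h1'.symm

theorem Lower.mem_Icc {s t i : ℕ} {w w' : List ℕ} (h : Lower i w' w) (hi : s < i) (hi' : i < t)
    (hw : ∀ z ∈ w, s < z ∧ z ≤ t) : ∀ z ∈ w', s < z ∧ z ≤ t := by
  obtain ⟨u, v, rfl, rfl, -, -⟩ := h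
  intro z hz
  rcases List.mem_append.1 hz with hz | hz
  · exact hw z (by simp [hz])
  · rcases List.mem_cons.1 hz with rfl | hz
    · omega
    · exact hw z (by simp [hz])

theorem Lower.mem_Icc' {s t i : ℕ} {w w' : List ℕ} (h : Lower i w w') (hi : s < i) (hi' : i < t)
    (hw : ∀ z ∈ w, s < z ∧ z ≤ t) : ∀ z ∈ w', s < z ∧ z ≤ t := by
  obtain ⟨u, v, rfl, rfl, -, -⟩ := h
  intro z hz
  rcases List.mem_append.1 hz with hz | hz
  · exact hw z (by simp [hz])
  · rcases List.mem_cons.1 hz with rfl | hz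
    · omega
    · exact hw z (by simp [hz])

/-- Every insertion tableau of the right shape occurs in the component of a tableau. -/
theorem exists_conn_insertionTableau {s t : ℕ} (T : SemistandardYoungTableau Λ) {w : List ℕ}
    (hw : ∀ z ∈ w, s < z ∧ z ≤ t)
    (hl : lens (insertionTableau (intervalWord s t T)) = lens (insertionTableau w)) :
    ∃ T', Conn s t T T' ∧ insertionTableau (intervalWord s t T') = insertionTableau w := by
  generalize hn : w.sum = n
  induction n using Nat.strong_induction_on generalizing w with
  | _ n ih =>
    by_cases h : ∃ i, s < i ∧ i < t ∧ 0 < (sig i w).1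
    · obtain ⟨i, hi, hi', h⟩ := h
      obtain ⟨w', hw'⟩ := exists_raise h
      have := hw'.sum_eq
      -- Climb from w to a highest weight word, match that with the highest weight tableau of the
      -- component, and retrace the path downwards; each step is available because signatures depend
      -- only on the insertion tableau.
      obtain ⟨T₁, h1, h2⟩ := ih _ (by omega) (hw'.mem_Icc hi hi' hw) (hl.trans hw'.lens_eq.symm) rfl
      have h3 : 0 < (sig i (rowWord T₁)).2 := by
        rw [← sig_intervalWord hi hi', ← sig_insertionTableau, h2, sig_insertionTableau]
        exact hw'.snd_pos
      obtain ⟨T', hT'⟩ := exists_step h3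
      refine ⟨T', h1.trans (.of_step hi hi' hT'), ?_⟩
      have h4 := hT'.intervalWord hi hi'
      have h5 := h4.insertionTableau.2
      rw [h2] at h5
      refine colWord_inj ?_ (h5.unique hw'.insertionTableau.2)
      rw [← h4.lens_eq, h2, hw'.lens_eq]
    · push Not at h
      obtain ⟨Y, h1, h2⟩ := exists_highest s t T
      refine ⟨Y, h1, (isHighest_intervalWord h2).insertionTableau_eq
        ⟨hw, fun i hi hi' => Nat.le_zero.1 (h i hi hi')⟩ ?_⟩
      rw [← hl, lens_eq_of_recordingTableau_eq h1.recordingTableau_eq]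

/-! ### Reversal of words -/

/-- Reverse a word and reverse the order of its letters, in the alphabet `[s + 1, t]`. -/
def star (s t : ℕ) (w : List ℕ) : List ℕ := (w.map fun x => s + t + 1 - x).reverse

theorem star_cons (s t x : ℕ) (w : List ℕ) :
    star s t (x :: w) = star s t w ++ [s + t + 1 - x] := by simp [star]

theorem star_append (s t : ℕ) (u v : List ℕ) : star s t (u ++ v) = star s t v ++ star s t u := by
  simp [star]

theorem mem_star {s t : ℕ} {w : List ℕ} (hw : ∀ z ∈ w, s < z ∧ z ≤ t) :
    ∀ z ∈ star s t w, s < z ∧ z ≤ t := by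
  intro z hz
  simp only [star, List.mem_reverse, List.mem_map] at hz
  obtain ⟨x, hx, rfl⟩ := hz
  have := hw x hx
  omega

theorem sigMul_swap (a b : ℕ × ℕ) : (sigMul a b).swap = sigMul b.swap a.swap := rfl

theorem sig_star {s t i : ℕ} (hi' : i < t) {w : List ℕ}
    (hw : ∀ z ∈ w, s < z ∧ z ≤ t) : sig (s + t - i) (star s t w) = (sig i w).swap := by
  induction w with
  | nil => rfl
  | cons x w ih =>
    rw [List.forall_mem_cons] at hw
    rw [star_cons, sig_append, sig_singleton, sig_cons, sigMul_swap, ih hw.2]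
    congr 1
    have := hw.1
    unfold letterSig
    split_ifs <;> first | rfl | omega

theorem count_star {s t z : ℕ} (hz' : z ≤ t) {w : List ℕ}
    (hw : ∀ z ∈ w, s < z ∧ z ≤ t) : (star s t w).count (s + t + 1 - z) = w.count z := by
  induction w with
  | nil => rfl
  | cons x w ih =>
    rw [List.forall_mem_cons] at hw
    rw [star_cons, List.count_append, ih hw.2, List.count_singleton, List.count_cons]
    have := hw.1
    congr 1
    by_cases h : x = z
    · simp [h]
    · rw [if_neg, if_neg] <;> simp <;> omega

theorem Lower.star {s t i : ℕ} (hi' : i < t) {w w' : List ℕ} (h : Lower i w w')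
    (hw : ∀ z ∈ w, s < z ∧ z ≤ t) :
    Lower (s + t - i) (RectLR.star s t w') (RectLR.star s t w) := by
  obtain ⟨u, v, rfl, rfl, hu, hv⟩ := h
  simp only [List.forall_mem_append, List.forall_mem_cons] at hw
  refine ⟨RectLR.star s t v, RectLR.star s t u, ?_, ?_, ?_, ?_⟩
  · rw [star_append, star_cons, List.append_assoc, List.singleton_append]
    congr 2
    omega
  · rw [star_append, star_cons, List.append_assoc, List.singleton_append]
    congr 2
    omega
  · rw [sig_star hi' hw.2.2]; exact hv
  · rw [sig_star hi' hw.1]; exact hu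

/-! ### Reversal preserves the insertion shape. -/

theorem eq_of_countP_eq {l l' : List ℕ} (h : l.Pairwise (· ≥ ·)) (h' : l'.Pairwise (· ≥ ·))
    (h0 : 0 ∉ l) (h0' : 0 ∉ l')
    (hc : ∀ r, 0 < r → l.countP (r ≤ ·) = l'.countP (r ≤ ·)) : l = l' := by
  refine List.Perm.eq_of_pairwise (fun a b _ _ h1 h2 => le_antisymm h2 h1) h h' ?_
  rw [List.perm_iff_count]
  intro r
  rcases Nat.eq_zero_or_pos r with rfl | hr
  · rw [List.count_eq_zero.2 h0, List.count_eq_zero.2 h0']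
  · have key : ∀ l : List ℕ, l.countP (r ≤ ·) = l.count r + l.countP (r + 1 ≤ ·) := by
      intro l
      induction l with
      | nil => rfl
      | cons x l ih =>
        simp only [List.countP_cons, List.count_cons, ih, decide_eq_true_eq, beq_iff_eq]
        split_ifs <;> omega
    have h1 := key l
    have h2 := key l'
    rw [hc r hr, hc (r + 1) (by omega)] at h1
    omega

theorem pairwise_lens {cs : List (List ℕ)} (h : SS cs) : (lens cs).Pairwise (· ≥ ·) := by
  rw [List.pairwise_map]; exact h.2.imp fun h => h.1

theorem zero_notMem_lens {cs : List (List ℕ)} (h : [] ∉ cs) : 0 ∉ lens cs := by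
  intro h0
  obtain ⟨c, hc, h1⟩ := List.mem_map.1 h0
  rw [List.length_eq_zero_iff] at h1
  exact h (h1 ▸ hc)

theorem sum_le_of_mem {t : ℕ} {w : List ℕ} (hw : ∀ z ∈ w, z ≤ t) : w.sum ≤ t * w.length := by
  have := List.sum_le_card_nsmul w t hw
  simpa [mul_comm] using this

theorem length_le_of_mem {s t : ℕ} {w : List ℕ} (hw : ∀ z ∈ w, s < z ∧ z ≤ t) :
    ∀ c ∈ insertionTableau w, c.length ≤ t - s :=
  fun c hc => length_le_of_sorted (sortedCols_insertionTableau w c hc)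
    (forall_mem_insertionTableau hw c hc)

theorem countP_lens_eq_zero {s t r : ℕ} (hr : t - s < r) {w : List ℕ}
    (hw : ∀ z ∈ w, s < z ∧ z ≤ t) : (lens (insertionTableau w)).countP (r ≤ ·) = 0 := by
  rw [List.countP_eq_zero]
  intro x hx
  obtain ⟨c, hc, rfl⟩ := List.mem_map.1 hx
  have := length_le_of_mem hw c hc
  simp; omega

/-- Lowering w corresponds to raising its reversal, and neither changes the shape. When w has
reached lowest weight its reversal has highest weight, and both row lengths are read from contents,
which correspond. The deficit from the maximal possible letter sum makes the induction terminate. -/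
theorem lens_insertionTableau_star {s t : ℕ} {w : List ℕ} (hw : ∀ z ∈ w, s < z ∧ z ≤ t) :
    lens (insertionTableau (star s t w)) = lens (insertionTableau w) := by
  generalize hn : t * w.length - w.sum = n
  induction n using Nat.strong_induction_on generalizing w with
  | _ n ih =>
    by_cases h : ∃ i, s < i ∧ i < t ∧ 0 < (sig i w).2
    · obtain ⟨i, hi, hi', h⟩ := h
      obtain ⟨w', hw'⟩ := exists_lower h
      have hwm := hw'.mem_Icc' hi hi' hw
      have h1 := hw'.sum_eq
      have h2 := hw'.length_eq
      have h3 := sum_le_of_mem fun z hz => (hwm z hz).2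
      rw [hw'.lens_eq, ← (hw'.star hi' hw).lens_eq]
      refine ih _ ?_ hwm rfl
      rw [← h2] at h3 ⊢
      omega
    · push Not at h
      have hs : IsHighest s t (star s t w) := ⟨mem_star hw, fun i hi hi' => by
        have := sig_star (i := s + t - i) (by omega) hw
        rw [show s + t - (s + t - i) = i by omega] at this
        rw [this]
        exact Nat.le_zero.1 (h _ (by omega) (by omega))⟩
      refine eq_of_countP_eq (pairwise_lens (ss_insertionTableau _))
        (pairwise_lens (ss_insertionTableau _)) (zero_notMem_lens (nonempty_insertionTableau _))
        (zero_notMem_lens (nonempty_insertionTableau _)) fun r hr => ?_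
      by_cases hrt : t - s < r
      · rw [countP_lens_eq_zero hrt hw, countP_lens_eq_zero hrt (mem_star hw)]
      · rw [← count_of_highest (fun z hz => (hs.mem z hz).1) hs.fst_eq hr,
          ← count_of_lowest hw (fun i hi hi' => Nat.le_zero.1 (h i hi hi')) hr (by omega),
          ← count_star (z := t + 1 - r) (by omega) hw]
        congr 1
        omega

/-- Reversal exchanges the two kinds of unmatched letters, and a rectangular word has neither, so it
stays rectangular in the reflected alphabet. -/
theorem IsRectWord.star {s t q a μ : ℕ} {w : List ℕ} (hw : ∀ z ∈ w, s < z ∧ z ≤ t)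
    (h : IsRectWord q a μ w) (hq : s ≤ q) (hq' : q + a ≤ t) :
    IsRectWord (s + t - (q + a)) a μ (RectLR.star s t w) := by
  constructor
  · intro z h1 h2
    rw [← h.count (s + t + 1 - z) (by omega) (by omega), ← count_star (by omega) hw]
    congr 1
    omega
  · intro i h1 h2
    have := sig_star (i := s + t - i) (by omega) hw
    rw [show s + t - (s + t - i) = i by omega] at this
    rw [this]
    exact h.snd _ (by omega) (by omega)

/-! ### Exchange of two rectangles -/

/-- Reversal exchanges the two rectangles and keeps the insertion shape, so the insertion tableau of
the reversed word occurs in the component of T. -/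
theorem exists_conn_exchange {s a b μ ν : ℕ} (T : SemistandardYoungTableau Λ)
    (h1 : IsRectWord s a μ (rowWord T)) (h2 : IsRectWord (s + a) b ν (rowWord T)) :
    ∃ T', Conn s (s + a + b) T T' ∧ IsRectWord s b ν (rowWord T') ∧
      IsRectWord (s + b) a μ (rowWord T') := by
  have hw : ∀ z ∈ intervalWord s (s + a + b) T, s < z ∧ z ≤ s + a + b :=
    fun _ => mem_intervalWord
  obtain ⟨T', h3, h4⟩ := exists_conn_insertionTableau T (mem_star hw)
    (lens_insertionTableau_star hw).symm
  have e : ∀ {q c κ : ℕ}, s ≤ q → q + c ≤ s + a + b → ∀ T : SemistandardYoungTableau Λ,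
      (IsRectWord q c κ (intervalWord s (s + a + b) T) ↔ IsRectWord q c κ (rowWord T)) :=
    fun h h' T => isRectWord_filter fun z hz hz' => by simp; omega
  refine ⟨T', h3, ?_, ?_⟩
  · rw [← e (by omega) (by omega), ← isRectWord_insertionTableau, h4, isRectWord_insertionTableau]
    have := ((e (by omega) (by omega) T).2 h2).star hw (by omega) (by omega)
    rwa [show s + (s + a + b) - (s + a + b) = s by omega] at this
  · rw [← e (by omega) (by omega), ← isRectWord_insertionTableau, h4, isRectWord_insertionTableau]
    have := ((e (by omega) (by omega) T).2 h1).star hw (by omega) (by omega)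
    rwa [show s + (s + a + b) - (s + a) = s + b by omega] at this

/-- Connected tableaux have equal recording tableaux, hence insertion tableaux of equal shape, and
these are equal by `SS.two_rectangles_unique`. -/
theorem Conn.eq_of_isRectWord {s a b μ ν : ℕ} (ha : 0 < a) {T T' : SemistandardYoungTableau Λ}
    (h : Conn s (s + a + b) T T')
    (h1 : IsRectWord s a μ (rowWord T)) (h2 : IsRectWord (s + a) b ν (rowWord T))
    (h1' : IsRectWord s a μ (rowWord T')) (h2' : IsRectWord (s + a) b ν (rowWord T')) :
    T = T' := by
  have e : ∀ {q c κ : ℕ}, s ≤ q → q + c ≤ s + a + b → ∀ T : SemistandardYoungTableau Λ,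
      IsRectWord q c κ (rowWord T) →
      IsRectWord q c κ (colWord (insertionTableau (intervalWord s (s + a + b) T))) :=
    fun h h' T hT => isRectWord_insertionTableau.2
      ((isRectWord_filter fun z hz hz' => by simp; omega).2 hT)
  refine h.agree.eq (word_eq_of_recordingTableau_eq h.recordingTableau_eq ?_)
  exact SS.two_rectangles_unique ha (ss_insertionTableau _) (ss_insertionTableau _)
    (forall_mem_insertionTableau fun _ => mem_intervalWord)
    (forall_mem_insertionTableau fun _ => mem_intervalWord)
    (e (by omega) (by omega) T h1) (e (by omega) (by omega) T h2)
    (e (by omega) (by omega) T' h1') (e (by omega) (by omega) T' h2')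
    (lens_eq_of_recordingTableau_eq h.recordingTableau_eq)

/-! ### Subalphabets -/

section Positions

variable {t : ℕ} (R : Fin t → Rect) (p : Fin (t - 1))

theorem start_add_rows_le {i j : Fin t} (h : i < j) : start R i + (R i).rows ≤ start R j := by
  unfold start
  rw [add_comm, ← Finset.sum_insert (s := Finset.univ.filter (· < i)) (a := i)
    (f := fun j => (R j).rows) (by simp)]
  refine Finset.sum_le_sum_of_subset fun x hx => ?_
  simp only [Finset.mem_insert, Finset.mem_filter, Finset.mem_univ, true_and] at hx ⊢
  rcases hx with rfl | hx
  · exact h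
  · exact hx.trans h

theorem start_add_rows_le_totalRows (i : Fin t) : start R i + (R i).rows ≤ totalRows R := by
  unfold start totalRows
  rw [add_comm, ← Finset.sum_insert (s := Finset.univ.filter (· < i)) (a := i)
    (f := fun j => (R j).rows) (by simp)]
  exact Finset.sum_le_sum_of_subset (Finset.subset_univ _)

theorem start_hi : start R (hi p) = start R (lo p) + (R (lo p)).rows := by
  unfold start
  have : Finset.univ.filter (· < hi p) = insert (lo p) (Finset.univ.filter (· < lo p)) := by
    ext x
    simp only [Finset.mem_insert, Finset.mem_filter, Finset.mem_univ, true_and, hi, lo,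
      Fin.lt_def, Fin.ext_iff]
    omega
  rw [this, Finset.sum_insert (by simp), add_comm]

theorem lo_ne_hi : lo p ≠ hi p := by simp [lo, hi]

theorem permute_adj (i : Fin t) : permute (adj p) R i = R (adj p i) := by
  simp [permute, adj]

theorem permute_adj_lo : permute (adj p) R (lo p) = R (hi p) := by
  rw [permute_adj, adj, Equiv.swap_apply_left]

theorem permute_adj_hi : permute (adj p) R (hi p) = R (lo p) := by
  rw [permute_adj, adj, Equiv.swap_apply_right]

theorem permute_adj_of_ne {i : Fin t} (h : i ≠ lo p) (h' : i ≠ hi p) :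
    permute (adj p) R i = R i := by
  rw [permute_adj, adj, Equiv.swap_apply_of_ne_of_ne h h']

theorem start_permute_adj {i : Fin t} (h : i ≠ hi p) :
    start (permute (adj p) R) i = start R i := by
  unfold start
  refine Finset.sum_equiv (adj p) (fun j => ?_) fun j _ => by rw [permute_adj]
  simp only [Finset.mem_filter, Finset.mem_univ, true_and]
  have h1 : lo p < i ↔ hi p < i := by
    simp only [ne_eq, Fin.ext_iff, Fin.lt_def, lo, hi] at *
    omega
  unfold adj
  rw [Equiv.swap_apply_def]
  split_ifs with h2 h3
  · rw [h2]; exact h1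
  · rw [h3]; exact h1.symm
  · rfl

theorem totalRows_permute (u : Equiv.Perm (Fin t)) : totalRows (permute u R) = totalRows R :=
  Equiv.sum_comp u⁻¹ fun i => (R i).rows

theorem permute_mul (u v : Equiv.Perm (Fin t)) : permute (u * v) R = permute u (permute v R) := by
  ext i
  all_goals simp [permute]

/-- The last letter of the alphabet `A_p ∪ A_{p+1}`. -/
abbrev pairEnd : ℕ := start R (lo p) + (R (lo p)).rows + (R (hi p)).rows

theorem pairAlphabet_eq : pairAlphabet R p = Finset.Icc (start R (lo p) + 1) (pairEnd R p) := by
  have := (R (lo p)).rows_pos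
  ext x
  simp only [pairAlphabet, subalphabet, start_hi, Finset.mem_union, Finset.mem_Icc, pairEnd]
  omega

theorem pairWord_eq (T : SemistandardYoungTableau Λ) :
    pairWord R p T = intervalWord (start R (lo p)) (pairEnd R p) T := by
  unfold pairWord intervalWord
  rw [pairAlphabet_eq]

theorem pairEnd_le : pairEnd R p ≤ totalRows R := by
  have := start_add_rows_le_totalRows R (hi p)
  rw [start_hi] at this
  exact this

end Positions

/-! ### Rectangle switching -/

/-- The shape of a list of columns. -/
def shapeOf (cs : List (List ℕ)) (h : SS cs) : YoungDiagram :=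
  (YoungDiagram.ofRowLens (lens cs) (pairwise_lens h).sortedGE).transpose

theorem colLen_shapeOf {cs : List (List ℕ)} (h : SS cs) (j : ℕ) :
    (cs.getD j []).length = (shapeOf cs h).colLen j := by
  have key : ∀ i, i < (cs.getD j []).length ↔ i < (shapeOf cs h).colLen j := by
    intro i
    rw [← YoungDiagram.mem_iff_lt_colLen, shapeOf, YoungDiagram.mem_transpose,
      YoungDiagram.mem_ofRowLens, length_getD_eq]
    simp only [Prod.swap]
    constructor
    · intro hi
      by_cases hj : j < (lens cs).length
      · exact ⟨hj, by rwa [List.getD_eq_getElem _ _ hj] at hi⟩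
      · rw [List.getD_eq_default _ _ (by omega)] at hi; omega
    · rintro ⟨hj, hi⟩
      rwa [List.getD_eq_getElem _ _ hj]
  have h1 := key (cs.getD j []).length
  have h2 := key ((shapeOf cs h).colLen j)
  omega

/-- `IsColumnsOf` compares entries with default 0. As 0 is never a letter here, the nonzero entries
also fix the shape. -/
theorem insertionTableau_rowWord_eq {w : List ℕ} (hw : 0 ∉ w) {T : SemistandardYoungTableau Λ}
    (h0 : 0 ∉ rowWord T) (h : IsColumnsOf (insertionTableau w) T) :
    insertionTableau (rowWord T) = insertionTableau w := by
  rw [insertionTableau_rowWord]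
  refine colsOf_eq_of_isColumnsOf (nonempty_insertionTableau w) (fun j => ?_) h
  have key : ∀ i, i < ((insertionTableau w).getD j []).length ↔ i < Λ.colLen j := by
    intro i
    rw [← YoungDiagram.mem_iff_lt_colLen]
    constructor
    · intro hi
      by_contra hc
      have h1 := h i j
      rw [T.zeros hc] at h1
      have h2 := getD_mem hi
      rw [← h1] at h2
      have hj : j < (insertionTableau w).length := by
        by_contra hj
        rw [List.getD_eq_default _ _ (by omega)] at hi
        simp at hi
      rw [List.getD_eq_getElem _ _ hj] at h2
      exact hw (mem_insertionTableau.1 ⟨_, List.getElem_mem hj, h2⟩)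
    · intro hc
      by_contra hi
      have h1 := h i j
      rw [List.getD_eq_default _ _ (by omega)] at h1
      exact h0 (mem_rowWord.2 ⟨i, j, hc, h1⟩)
  have h1 := key ((insertionTableau w).getD j []).length
  have h2 := key (Λ.colLen j)
  omega

theorem mem_LRTin_pair_iff {a : ℕ} {X Y : Rect} {T : SemistandardYoungTableau Λ} :
    T ∈ LRTin a ![X, Y] Λ ↔ (∀ x ∈ rowWord T, a < x ∧ x ≤ a + X.rows + Y.rows) ∧
      IsRectWord a X.rows X.cols (rowWord T) ∧
      IsRectWord (a + X.rows) Y.rows Y.cols (rowWord T) := by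
  have h0 : start ![X, Y] 0 = 0 := by simp [start]
  have h1 : start ![X, Y] 1 = X.rows := by
    have : Finset.univ.filter (· < (1 : Fin 2)) = {0} := by decide
    rw [start, this]
    simp
  have h2 : totalRows ![X, Y] = X.rows + Y.rows := by simp [totalRows]
  rw [mem_LRTin_iff, Fin.forall_fin_two, h0, h1, h2, ← add_assoc]
  rfl

section Switch

variable {t : ℕ} {R : Fin t → Rect} {p : Fin (t - 1)} {T T' : SemistandardYoungTableau Λ}

theorem isRectWord_intervalWord {s e q c κ : ℕ} (h : s ≤ q) (h' : q + c ≤ e) :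
    IsRectWord q c κ (intervalWord s e T) ↔ IsRectWord q c κ (rowWord T) :=
  isRectWord_filter fun z hz hz' => by simp; omega

/-- The description of rectangle switching by crystal operators. -/
theorem isSwitch_iff : IsSwitch R p T T' ↔ Conn (start R (lo p)) (pairEnd R p) T T' ∧
    IsRectWord (start R (lo p)) (R (hi p)).rows (R (hi p)).cols (rowWord T') ∧
    IsRectWord (start R (lo p) + (R (hi p)).rows) (R (lo p)).rows (R (lo p)).cols
      (rowWord T') := by
  unfold IsSwitch
  rw [pairWord_eq, pairWord_eq, pairAlphabet_eq]
  constructor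
  · rintro ⟨h1, h2, h3, ρ, P', h4, h5⟩
    have hag : Agree (start R (lo p)) (pairEnd R p) T T' := by
      rintro ⟨i, j⟩ hc
      rw [mem_rowCells] at hc
      refine ⟨⟨h2 i j hc, fun h => ?_⟩, h1 i j hc⟩
      by_contra hn
      rw [h1 i j hc hn] at h
      exact hn h
    rw [mem_LRTin_pair_iff] at h4
    have h6 := insertionTableau_rowWord_eq (fun h => by have := mem_intervalWord h; omega)
      (fun h => by have := h4.1 0 h; omega) h5
    refine ⟨hag.conn h3.symm, ?_, ?_⟩
    · rw [← isRectWord_intervalWord le_rfl (show _ ≤ pairEnd R p by unfold pairEnd; omega),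
        ← isRectWord_insertionTableau, ← h6, isRectWord_insertionTableau]
      exact h4.2.1
    · rw [← isRectWord_intervalWord (s := start R (lo p)) (e := pairEnd R p) (by omega)
          (by unfold pairEnd; omega),
        ← isRectWord_insertionTableau, ← h6, isRectWord_insertionTableau]
      exact h4.2.2
  · rintro ⟨h1, h2, h3⟩
    refine ⟨fun i j hc => (h1.agree (i, j) (mem_rowCells.2 hc)).2,
      fun i j hc => (h1.agree (i, j) (mem_rowCells.2 hc)).1.1, h1.recordingTableau_eq.symm, ?_⟩
    set w := intervalWord (start R (lo p)) (pairEnd R p) T' with hw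
    have hss := ss_insertionTableau w
    refine ⟨shapeOf _ hss, ofCols _ _ hss (colLen_shapeOf hss), ?_, fun i j => rfl⟩
    set P' := ofCols _ _ hss (colLen_shapeOf hss)
    have h4 : insertionTableau (rowWord P') = insertionTableau w := by
      rw [insertionTableau_rowWord]
      exact colsOf_eq_of_isColumnsOf (nonempty_insertionTableau w) (colLen_shapeOf hss)
        fun i j => rfl
    rw [mem_LRTin_pair_iff]
    refine ⟨fun x hx => ?_, ?_, ?_⟩
    · rw [← mem_insertionTableau, h4, mem_insertionTableau] at hx
      have := mem_intervalWord hx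
      unfold pairEnd at this
      omega
    · rw [← isRectWord_insertionTableau, h4, isRectWord_insertionTableau, hw,
        isRectWord_intervalWord le_rfl (by unfold pairEnd; omega)]
      exact h2
    · rw [← isRectWord_insertionTableau, h4, isRectWord_insertionTableau, hw,
        isRectWord_intervalWord (by omega) (by unfold pairEnd; omega)]
      exact h3

theorem mem_LRT_iff : T ∈ LRT R Λ ↔ (∀ x ∈ rowWord T, 0 < x ∧ x ≤ totalRows R) ∧
    ∀ i, IsRectWord (start R i) (R i).rows (R i).cols (rowWord T) := by
  rw [LRT, mem_LRTin_iff]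
  simp only [zero_add]

theorem isRectWord_hi (h : T ∈ LRT R Λ) :
    IsRectWord (start R (lo p) + (R (lo p)).rows) (R (hi p)).rows (R (hi p)).cols
      (rowWord T) := by
  rw [← start_hi]; exact (mem_LRT_iff.1 h).2 _

theorem isSwitch_switch (h : T ∈ LRT R Λ) : IsSwitch R p T (switch R p T) := by
  have : ∃ T', IsSwitch R p T T' := by
    obtain ⟨T', h1⟩ := exists_conn_exchange T ((mem_LRT_iff.1 h).2 (lo p)) (isRectWord_hi h)
    exact ⟨T', isSwitch_iff.2 h1⟩
  rw [switch, dif_pos this]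
  exact this.choose_spec

/-- Both results lie in one component and are extremal for the same exchanged rectangles. With
`isSwitch_switch` this makes the choice in `switch` canonical. -/
theorem IsSwitch.unique {T'' : SemistandardYoungTableau Λ} (h : IsSwitch R p T T')
    (h' : IsSwitch R p T T'') : T' = T'' := by
  rw [isSwitch_iff] at h h'
  have h1 := h.1.symm.trans h'.1
  rw [show pairEnd R p = start R (lo p) + (R (hi p)).rows + (R (lo p)).rows by
    unfold pairEnd; omega] at h1
  exact h1.eq_of_isRectWord (R (hi p)).rows_pos h.2.1 h.2.2 h'.2.1 h'.2.2

theorem Agree.filter_eq {s e : ℕ} (h : Agree s e T T') {q : ℕ → Bool}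
    (hq : ∀ z, q z → z ∉ Finset.Icc (s + 1) e) :
    (rowWord T').filter q = (rowWord T).filter q := by
  rw [rowWord_eq_map, rowWord_eq_map]
  unfold Agree at h
  generalize rowCells Λ = l at h ⊢
  induction l with
  | nil => rfl
  | cons c l ih =>
    rw [List.forall_mem_cons] at h
    rw [List.map_cons, List.map_cons]
    by_cases hc : T c.1 c.2 ∈ Finset.Icc (s + 1) e
    · have hc' := h.1.1.1 hc
      rw [List.filter_cons_of_neg fun h1 => hq _ h1 hc,
        List.filter_cons_of_neg fun h1 => hq _ h1 hc', ih h.2]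
    · rw [h.1.2 hc, List.filter_cons, List.filter_cons, ih h.2]

/-- The two exchanged subalphabets are handled by `isSwitch_iff`; the other ones keep their position
and are disjoint from the interval where T changes. -/
theorem switch_mem_LRT (h : T ∈ LRT R Λ) : switch R p T ∈ LRT (permute (adj p) R) Λ := by
  obtain ⟨h1, h2, h3⟩ := isSwitch_iff.1 (isSwitch_switch (p := p) h)
  have hT := mem_LRT_iff.1 h
  have hag := h1.agree
  have hlo : start (permute (adj p) R) (lo p) = start R (lo p) :=
    start_permute_adj R p (lo_ne_hi p)
  rw [mem_LRT_iff]
  constructor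
  · rw [totalRows_permute]
    intro x hx
    obtain ⟨i, j, hc, rfl⟩ := mem_rowWord.1 hx
    have h4 := hag (i, j) (mem_rowCells.2 hc)
    dsimp only at h4
    by_cases hm : T i j ∈ Finset.Icc (start R (lo p) + 1) (pairEnd R p)
    · have h5 := Finset.mem_Icc.1 (h4.1.1 hm)
      have := pairEnd_le R p
      omega
    · rw [h4.2 hm]
      exact hT.1 _ (mem_rowWord.2 ⟨i, j, hc, rfl⟩)
  · intro i
    by_cases hi1 : i = lo p
    · subst hi1
      rw [hlo, permute_adj_lo]
      exact h2
    by_cases hi2 : i = hi p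
    · subst hi2
      rw [start_hi, hlo, permute_adj_lo, permute_adj_hi]
      exact h3
    rw [start_permute_adj R p hi2, permute_adj_of_ne R p hi1 hi2]
    have hd : ∀ z, start R i < z ∧ z ≤ start R i + (R i).rows →
        z ∉ Finset.Icc (start R (lo p) + 1) (pairEnd R p) := by
      intro z hz hm
      rw [Finset.mem_Icc] at hm
      rcases lt_or_ge i (lo p) with h4 | h4
      · have := start_add_rows_le R h4
        omega
      · have h5 : hi p < i := by
          simp only [Fin.ext_iff, Fin.lt_def, Fin.le_def, lo, hi] at *
          omega
        have := start_add_rows_le R h5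
        rw [start_hi] at this
        unfold pairEnd at hm
        omega
    rw [← isRectWord_filter (p := fun z => decide (start R i < z ∧ z ≤ start R i + (R i).rows))
      (fun z h1 h2 => by simp [h1, h2]), hag.filter_eq (fun z hz => hd z (by simpa using hz)),
      isRectWord_filter (fun z h1 h2 => by simp [h1, h2])]
    exact hT.2 i

theorem switchWord_mem_LRT (h : T ∈ LRT R Λ) (w : List (Fin (t - 1))) :
    switchWord R w T ∈ LRT (permute (wordPerm w) R) Λ := by
  induction w with
  | nil => exact h
  | cons p w ih =>
    have := switch_mem_LRT (p := p) ih
    rwa [← permute_mul] at this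

end Switch

/-! ### Complements of columns -/

/-- The complement of a column in `[n]`. -/
def complList (n : ℕ) (c : List ℕ) : List ℕ := (List.range' 1 n).filter (· ∉ c)

/-- The complements of the columns, in the opposite order. -/
def dualCols (n : ℕ) (cs : List (List ℕ)) : List (List ℕ) := (cs.map (complList n)).reverse

theorem mem_complList {n : ℕ} {c : List ℕ} {z : ℕ} :
    z ∈ complList n c ↔ (1 ≤ z ∧ z ≤ n) ∧ z ∉ c := by
  simp [complList]; omega

theorem sorted_complList (n : ℕ) (c : List ℕ) : Sorted (complList n c) :=
  (sorted_range' 1 n).filter _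

theorem sorted_ext {c d : List ℕ} (hc : Sorted c) (hd : Sorted d) (h : ∀ z, z ∈ c ↔ z ∈ d) :
    c = d :=
  List.Perm.eq_of_pairwise (fun _ _ _ _ h1 h2 => absurd (h1.trans h2) (lt_irrefl _)) hc hd
    ((List.perm_ext_iff_of_nodup (hc.imp fun h => h.ne) (hd.imp fun h => h.ne)).2 h)

theorem complList_complList {n : ℕ} {c : List ℕ} (hc : Sorted c) (h : ∀ z ∈ c, 1 ≤ z ∧ z ≤ n) :
    complList n (complList n c) = c := by
  refine sorted_ext (sorted_complList _ _) hc fun z => ?_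
  rw [mem_complList, mem_complList]
  have := h z
  tauto

theorem sig_sorted {i : ℕ} {c : List ℕ} (hc : Sorted c) : sig i c.reverse =
    (if i + 1 ∈ c ∧ i ∉ c then 1 else 0, if i ∈ c ∧ i + 1 ∉ c then 1 else 0) := by
  induction c with
  | nil => simp
  | cons x c ih =>
    rw [Sorted, List.pairwise_cons] at hc
    have h1 := hc.1 i
    have h2 := hc.1 (i + 1)
    rw [List.reverse_cons, sig_append, sig_singleton, ih hc.2]
    simp only [List.mem_cons]
    unfold letterSig sigMul
    by_cases h5 : x = i
    · subst h5
      have h3 : x ∉ c := fun h => (h1 h).false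
      by_cases h4 : x + 1 ∈ c <;> simp [h3, h4]
    · by_cases h6 : x = i + 1
      · subst h6
        have h3 : i ∉ c := fun h => absurd (h1 h) (by omega)
        have h4 : i + 1 ∉ c := fun h => (h2 h).false
        simp [h3, h4]
      · simp [h5, h6, Ne.symm h5, Ne.symm h6]

/-- A column has nontrivial signature only if it contains exactly one of i and i + 1; its complement
contains exactly the other. -/
theorem sig_complList {i n : ℕ} (hi : 1 ≤ i) (hi' : i < n) {c : List ℕ} (hc : Sorted c) :
    sig i (complList n c).reverse = (sig i c.reverse).swap := by
  rw [sig_sorted hc, sig_sorted (sorted_complList n c)]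
  simp only [mem_complList, Prod.swap]
  by_cases h1 : i ∈ c <;> by_cases h2 : i + 1 ∈ c <;> simp [h1, h2] <;> omega

theorem dualCols_cons (n : ℕ) (c : List ℕ) (cs : List (List ℕ)) :
    dualCols n (c :: cs) = dualCols n cs ++ [complList n c] := by simp [dualCols]

/-- Swapping the two components is an anti-automorphism of the bicyclic monoid, which is why the
order of the columns must be reversed as well. -/
theorem sig_dualCols {i n : ℕ} (hi : 1 ≤ i) (hi' : i < n) {cs : List (List ℕ)}
    (hc : SortedCols cs) : sig i (colWord (dualCols n cs)) = (sig i (colWord cs)).swap := by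
  induction cs with
  | nil => rfl
  | cons c cs ih =>
    rw [SortedCols, List.forall_mem_cons] at hc
    rw [dualCols_cons, colWord_append, sig_append, ih hc.2, colWord_cons, colWord_nil,
      List.append_nil, sig_complList hi hi' hc.1, colWord_cons, sig_append, sigMul_swap]

/-- Replacing i by i + 1 in a column replaces i + 1 by i in its complement. -/
theorem Lower.complList {i n : ℕ} (hi : 1 ≤ i) (hi' : i < n) {c d : List ℕ} (hc : Sorted c)
    (hd : Sorted d) (h : Lower i c.reverse d.reverse) :
    Lower i (RectLR.complList n d).reverse (RectLR.complList n c).reverse := by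
  obtain ⟨u, v, h1, h2, -, -⟩ := h
  obtain rfl : c = v.reverse ++ i :: u.reverse := by
    apply List.reverse_injective; simp [h1]
  obtain rfl : d = v.reverse ++ (i + 1) :: u.reverse := by
    apply List.reverse_injective; simp [h2]
  obtain ⟨-, -, h3, h4⟩ := sorted_split hc
  obtain ⟨-, -, h3', h4'⟩ := sorted_split hd
  have hr : List.range' 1 n =
      List.range' 1 (i - 1) ++ i :: (i + 1) :: List.range' (i + 2) (n - i - 1) := by
    have e1 : List.range' 1 n = List.range' 1 ((i - 1) + ((n - i - 1) + 1 + 1)) := by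
      congr 1; omega
    rw [e1, ← List.range'_append_1, List.range'_succ, List.range'_succ,
      show 1 + (i - 1) = i by omega]
  set c := v.reverse ++ i :: u.reverse with hcd
  set d := v.reverse ++ (i + 1) :: u.reverse with hdd
  have hic : i ∈ c := by simp [hcd]
  have hid : i + 1 ∈ d := by simp [hdd]
  have hic' : i + 1 ∉ c := by
    intro hm
    rw [hcd, List.mem_append, List.mem_cons] at hm
    rcases hm with hm | hm | hm
    · have := h3 _ hm; omega
    · omega
    · have := h4' _ hm; omega
  have hid' : i ∉ d := by
    intro hm
    rw [hdd, List.mem_append, List.mem_cons] at hm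
    rcases hm with hm | hm | hm
    · have := h3 _ hm; omega
    · omega
    · have := h4' _ hm; omega
  have hiff : ∀ z, z ≠ i → z ≠ i + 1 → (z ∈ c ↔ z ∈ d) := by
    intro z hz hz'
    simp [hcd, hdd, hz, hz']
  set A := (List.range' 1 (i - 1)).filter (· ∉ c) with hA
  set B := (List.range' (i + 2) (n - i - 1)).filter (· ∉ c) with hB
  have hA' : (List.range' 1 (i - 1)).filter (· ∉ d) = A := by
    refine List.filter_congr fun z hz => ?_
    rw [List.mem_range'_1] at hz
    simp only [hiff z (by omega) (by omega)]
  have hB' : (List.range' (i + 2) (n - i - 1)).filter (· ∉ d) = B := by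
    refine List.filter_congr fun z hz => ?_
    rw [List.mem_range'_1] at hz
    simp only [hiff z (by omega) (by omega)]
  have ec : RectLR.complList n c = A ++ (i + 1) :: B := by
    rw [RectLR.complList, hr, List.filter_append, List.filter_cons_of_neg (by simpa),
      List.filter_cons_of_pos (by simpa)]
  have ed : RectLR.complList n d = A ++ i :: B := by
    rw [RectLR.complList, hr, List.filter_append, List.filter_cons_of_pos (by simpa),
      List.filter_cons_of_neg (by simpa), hA', hB']
  rw [ec, ed]
  refine ⟨B.reverse, A.reverse, by simp, by simp, sig_fst_of_notMem fun hm => ?_,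
    sig_snd_of_notMem fun hm => ?_⟩
  · rw [List.mem_reverse, hB, List.mem_filter, List.mem_range'_1] at hm
    omega
  · rw [List.mem_reverse, hA, List.mem_filter, List.mem_range'_1] at hm
    omega

/-- Under swap and reversal the tensor product rule at the target of f_i becomes the rule at the
source of the dual step. The strict and weak inequalities trade places because f_i moves one unit
from unmatched i to unmatched i + 1. -/
theorem Lower.dualCols {i n : ℕ} (hi : 1 ≤ i) (hi' : i < n) {cs ds : List (List ℕ)}
    (hc : SortedCols cs) (hd : SortedCols ds) (hl : lens cs = lens ds)
    (h : Lower i (colWord cs) (colWord ds)) :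
    Lower i (colWord (RectLR.dualCols n ds)) (colWord (RectLR.dualCols n cs)) := by
  induction cs generalizing ds with
  | nil => obtain ⟨u, v, h, -⟩ := h; simp at h
  | cons c cs ih =>
    cases ds with
    | nil => simp at hl
    | cons d ds =>
      rw [SortedCols, List.forall_mem_cons] at hc hd
      simp only [List.map_cons, List.cons.injEq] at hl
      rw [colWord_cons, colWord_cons] at h
      rw [dualCols_cons, dualCols_cons, colWord_append, colWord_append]
      simp only [colWord_cons, colWord_nil, List.append_nil]
      rcases lower_append h with ⟨h1, v', h2, e⟩ | ⟨h1, u', h2, e⟩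
      · obtain ⟨e1, rfl⟩ := List.append_inj e (by simp [hl])
        obtain rfl := List.reverse_injective e1
        refine (ih hc.2 hd.2 hl.2 h2).append_right ?_
        obtain ⟨e, f, s1, s2⟩ := h2.sig_eq
        rw [sig_complList hi hi' hc.1, sig_dualCols hi hi' hd.2, s2]
        rw [s1] at h1
        simpa using Nat.lt_succ_iff.1 h1
      · obtain ⟨rfl, e1⟩ := List.append_inj e (by rw [← h2.length_eq]; simp [hl])
        obtain rfl := colWord_inj hl.2 e1.symm
        refine (h2.complList hi hi' hc.1 hd.1).append_left ?_
        obtain ⟨e, f, s1, s2⟩ := h2.sig_eq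
        rw [sig_complList hi hi' hd.1, sig_dualCols hi hi' hc.2, s2]
        rw [s1] at h1
        simpa using Nat.lt_succ_iff.2 h1

theorem count_dualCols {n z : ℕ} (hz : 1 ≤ z) (hz' : z ≤ n) {cs : List (List ℕ)}
    (hc : SortedCols cs) :
    (colWord (dualCols n cs)).count z = cs.length - (colWord cs).count z := by
  have hd : SortedCols (dualCols n cs) := by
    intro d hd
    simp only [dualCols, List.mem_reverse, List.mem_map] at hd
    obtain ⟨c, -, rfl⟩ := hd
    exact sorted_complList n c
  rw [count_eq_countP hd, count_eq_countP hc, dualCols, List.countP_reverse, List.countP_map,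
    List.length_eq_countP_add_countP (z ∈ ·) (l := cs), Nat.add_sub_cancel_left]
  refine List.countP_congr fun c _ => ?_
  simp [mem_complList, hz, hz']

theorem dualCols_dualCols {n : ℕ} {cs : List (List ℕ)} (hc : SortedCols cs)
    (h : ∀ c ∈ cs, ∀ z ∈ c, 1 ≤ z ∧ z ≤ n) : dualCols n (dualCols n cs) = cs := by
  rw [dualCols, dualCols, List.map_reverse, List.reverse_reverse, List.map_map]
  exact (List.map_congr_left fun c hcs => complList_complList (hc c hcs) (h c hcs)).trans
    (List.map_id' _)

/-! ### The columns of the dual tableau -/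

theorem sorted_colList (T : SemistandardYoungTableau Λ) (j : ℕ) : Sorted (colList T j) := by
  rw [colList, Sorted, List.pairwise_map]
  refine List.pairwise_lt_range.imp_of_mem fun {a b} _ hb hab => ?_
  exact T.col_strict hab (YoungDiagram.mem_iff_lt_colLen.2 (List.mem_range.1 hb))

theorem sortedCols_colsOf (k : ℕ) (T : SemistandardYoungTableau Λ) : SortedCols (colsOf k T) := by
  intro c hc
  obtain ⟨j, -, rfl⟩ := List.mem_map.1 hc
  exact sorted_colList T j

theorem mem_colList {T : SemistandardYoungTableau Λ} {j z : ℕ} :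
    z ∈ colList T j ↔ ∃ i, (i, j) ∈ Λ ∧ T i j = z := by
  simp [colList, YoungDiagram.mem_iff_lt_colLen]

theorem mem_columnSet {T : SemistandardYoungTableau Λ} {j z : ℕ} :
    z ∈ columnSet T j ↔ z ∈ colList T j := by
  simp [columnSet, colList]

theorem card_columnSet (T : SemistandardYoungTableau Λ) (j : ℕ) :
    (columnSet T j).card = Λ.colLen j := by
  have : columnSet T j = (colList T j).toFinset := by ext; simp [mem_columnSet]
  rw [this, List.toFinset_card_of_nodup ((sorted_colList T j).imp fun h => h.ne)]
  simp [colList]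

theorem colWord_colsOf {k : ℕ} (hk : Λ.rowLen 0 ≤ k) (T : SemistandardYoungTableau Λ) :
    colWord (colsOf k T) = colWord (colsOf (Λ.rowLen 0) T) := by
  induction k, hk using Nat.le_induction with
  | base => rfl
  | succ k hk ih =>
    have : colList T k = [] := by rw [colList, colLen_eq_zero_iff.2 hk]; rfl
    rw [← ih, colsOf, List.range_succ, List.map_append, colWord_append]
    simp [this, colsOf]

theorem colsOf_injective {k : ℕ} (hk : Λ.rowLen 0 ≤ k) {T T' : SemistandardYoungTableau Λ}
    (h : colsOf k T = colsOf k T') : T = T' := by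
  ext i j
  by_cases hc : (i, j) ∈ Λ
  · have hj : j < k := by
      have := YoungDiagram.mem_iff_lt_rowLen.1 (Λ.up_left_mem (Nat.zero_le i) le_rfl hc)
      omega
    have h1 := List.map_inj_left.1 h j (List.mem_range.2 hj)
    exact List.map_inj_left.1 h1 i (List.mem_range.2 (YoungDiagram.mem_iff_lt_colLen.1 hc))
  · rw [T.zeros hc, T'.zeros hc]

theorem rowLen_dualShape (n k : ℕ) (Λ : YoungDiagram) : (dualShape n k Λ).rowLen 0 ≤ k := by
  by_contra! h
  have := mem_dualShape.1 (YoungDiagram.mem_iff_lt_rowLen.2 h)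
  omega

theorem colLen_dualShape_zero (n k : ℕ) (Λ : YoungDiagram) : (dualShape n k Λ).colLen 0 ≤ n := by
  by_contra! h
  have := mem_dualShape.1 (YoungDiagram.mem_iff_lt_colLen.2 h)
  omega

theorem colLen_dualShape {n k j : ℕ} (hrows : Λ.colLen 0 ≤ n) (hj : j < k) :
    (dualShape n k Λ).colLen j = n - Λ.colLen (k - 1 - j) := by
  have hle := (Λ.colLen_anti 0 (k - 1 - j) (Nat.zero_le _)).trans hrows
  have key : ∀ i, i < (dualShape n k Λ).colLen j ↔ i < n - Λ.colLen (k - 1 - j) := by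
    intro i
    rw [← YoungDiagram.mem_iff_lt_colLen, mem_dualShape, YoungDiagram.mem_iff_lt_colLen]
    omega
  have h1 := key ((dualShape n k Λ).colLen j)
  have h2 := key (n - Λ.colLen (k - 1 - j))
  omega

theorem dualShape_dualShape {n k : ℕ} (hrows : Λ.colLen 0 ≤ n) (hcols : Λ.rowLen 0 ≤ k) :
    dualShape n k (dualShape n k Λ) = Λ := by
  ext ⟨i, j⟩
  rw [YoungDiagram.mem_cells, YoungDiagram.mem_cells, mem_dualShape, mem_dualShape]
  constructor
  · rintro ⟨⟨h1, h2⟩, h3⟩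
    by_contra hc
    refine h3 ⟨⟨by omega, by omega⟩, ?_⟩
    rwa [show n - 1 - (n - 1 - i) = i by omega, show k - 1 - (k - 1 - j) = j by omega]
  · intro hc
    have h1 := YoungDiagram.mem_iff_lt_rowLen.1 (Λ.up_left_mem (Nat.zero_le i) le_rfl hc)
    have h2 := YoungDiagram.mem_iff_lt_colLen.1 (Λ.up_left_mem le_rfl (Nat.zero_le j) hc)
    refine ⟨⟨by omega, by omega⟩, fun h => h.2 ?_⟩
    rwa [show n - 1 - (n - 1 - i) = i by omega, show k - 1 - (k - 1 - j) = j by omega]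

theorem dualTableau_apply {n k : ℕ} {T : SemistandardYoungTableau Λ}
    (hT : T ∈ CST (Finset.Icc 1 n) Λ) (i j : ℕ) : dualTableau n k T i j = dualEntry n k T i j := by
  rw [dualTableau, dif_pos hT]; rfl

theorem dualTableau_mem {n k : ℕ} {T : SemistandardYoungTableau Λ}
    (hT : T ∈ CST (Finset.Icc 1 n) Λ) {i j : ℕ} (h : (i, j) ∈ dualShape n k Λ) :
    dualTableau n k T i j ∈ Finset.Icc 1 n \ columnSet T (k - 1 - j) := by
  rw [dualTableau_apply hT, dualEntry, if_pos h]
  have hf : (Set.ofPred fun x => x ∈ Finset.Icc 1 n \ columnSet T (k - 1 - j)).Finite :=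
    (Finset.Icc 1 n \ columnSet T (k - 1 - j)).finite_toSet
  refine Nat.nth_mem_of_lt_card hf ?_
  have : hf.toFinset = Finset.Icc 1 n \ columnSet T (k - 1 - j) := by ext; simp
  rw [this]
  exact lt_card_compl T h

theorem dualTableau_mem_CST {n k : ℕ} {T : SemistandardYoungTableau Λ}
    (hT : T ∈ CST (Finset.Icc 1 n) Λ) :
    dualTableau n k T ∈ CST (Finset.Icc 1 n) (dualShape n k Λ) :=
  fun _ _ h => (Finset.mem_sdiff.1 (dualTableau_mem hT h)).1

/-- The letters of the dual column lie in the complement and have the right number, so they exhaust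
it; a strictly increasing list is determined by its set of letters. -/
theorem colList_dualTableau {n k j : ℕ} (hrows : Λ.colLen 0 ≤ n) (hj : j < k)
    {T : SemistandardYoungTableau Λ} (hT : T ∈ CST (Finset.Icc 1 n) Λ) :
    colList (dualTableau n k T) j = complList n (colList T (k - 1 - j)) := by
  refine sorted_ext (sorted_colList _ _) (sorted_complList _ _) fun z => ?_
  have h1 : columnSet (dualTableau n k T) j = Finset.Icc 1 n \ columnSet T (k - 1 - j) := by
    refine Finset.eq_of_subset_of_card_le ?_ ?_
    · intro z hz
      rw [mem_columnSet, mem_colList] at hz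
      obtain ⟨i, hc, rfl⟩ := hz
      exact dualTableau_mem hT hc
    · rw [card_columnSet, colLen_dualShape hrows hj, Finset.card_sdiff_of_subset, card_columnSet]
      · simp
      · intro z hz
        rw [mem_columnSet, mem_colList] at hz
        obtain ⟨i, hc, rfl⟩ := hz
        exact hT _ _ hc
  rw [← mem_columnSet, h1, mem_complList, Finset.mem_sdiff, mem_columnSet, Finset.mem_Icc]

theorem colsOf_dualTableau {n k : ℕ} (hrows : Λ.colLen 0 ≤ n)
    {T : SemistandardYoungTableau Λ} (hT : T ∈ CST (Finset.Icc 1 n) Λ) :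
    colsOf k (dualTableau n k T) = dualCols n (colsOf k T) := by
  refine List.ext_getElem (by simp [colsOf, dualCols]) fun j h1 h2 => ?_
  have hj : j < k := by simpa [colsOf] using h1
  simp only [colsOf, dualCols, List.getElem_map, List.getElem_range, List.getElem_reverse,
    List.length_map, List.length_range]
  exact colList_dualTableau hrows hj hT

/-! ### Duality and crystal operators -/

section Dual

variable {n k : ℕ} {T T' : SemistandardYoungTableau Λ}

theorem sig_rowWord_eq (hcols : Λ.rowLen 0 ≤ k) (i : ℕ) (T : SemistandardYoungTableau Λ) :
    sig i (rowWord T) = sig i (colWord (colsOf k T)) := by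
  rw [colWord_colsOf hcols, sig_colWord_colsOf]

theorem count_rowWord_eq (hcols : Λ.rowLen 0 ≤ k) (z : ℕ) (T : SemistandardYoungTableau Λ) :
    (rowWord T).count z = (colWord (colsOf k T)).count z := by
  rw [colWord_colsOf hcols, (perm_colWord_colsOf T).count_eq]

theorem step_iff_colsOf (hcols : Λ.rowLen 0 ≤ k) (i : ℕ) : Step i T T' ↔
    Lower i (colWord (colsOf k T)) (colWord (colsOf k T')) := by
  rw [step_iff, colWord_colsOf hcols, colWord_colsOf hcols]

theorem sig_dualTableau (hrows : Λ.colLen 0 ≤ n) (hcols : Λ.rowLen 0 ≤ k)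
    (hT : T ∈ CST (Finset.Icc 1 n) Λ) {i : ℕ} (hi : 1 ≤ i) (hi' : i < n) :
    sig i (rowWord (dualTableau n k T)) = (sig i (rowWord T)).swap := by
  rw [sig_rowWord_eq (rowLen_dualShape n k Λ), colsOf_dualTableau hrows hT,
    sig_dualCols hi hi' (sortedCols_colsOf k T), sig_rowWord_eq hcols]

theorem count_dualTableau (hrows : Λ.colLen 0 ≤ n) (hcols : Λ.rowLen 0 ≤ k)
    (hT : T ∈ CST (Finset.Icc 1 n) Λ) {z : ℕ} (hz : 1 ≤ z) (hz' : z ≤ n) :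
    (rowWord (dualTableau n k T)).count z = k - (rowWord T).count z := by
  rw [count_rowWord_eq (rowLen_dualShape n k Λ), colsOf_dualTableau hrows hT,
    count_dualCols hz hz' (sortedCols_colsOf k T), count_rowWord_eq hcols]
  simp [colsOf]

theorem count_rowWord_le (hcols : Λ.rowLen 0 ≤ k) (z : ℕ) : (rowWord T).count z ≤ k := by
  rw [count_rowWord_eq hcols, count_eq_countP (sortedCols_colsOf k T)]
  refine List.countP_le_length.trans ?_
  simp [colsOf]

theorem Step.dual (hrows : Λ.colLen 0 ≤ n) (hcols : Λ.rowLen 0 ≤ k)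
    (hT : T ∈ CST (Finset.Icc 1 n) Λ) (hT' : T' ∈ CST (Finset.Icc 1 n) Λ) {i : ℕ} (hi : 1 ≤ i)
    (hi' : i < n) (h : Step i T T') : Step i (dualTableau n k T') (dualTableau n k T) := by
  rw [step_iff_colsOf hcols] at h
  rw [step_iff_colsOf (rowLen_dualShape n k Λ), colsOf_dualTableau hrows hT,
    colsOf_dualTableau hrows hT']
  refine h.dualCols hi hi' (sortedCols_colsOf k T) (sortedCols_colsOf k T') ?_
  simp [colsOf, lens, colList, Function.comp_def]

theorem Agree.mem_CST {s e : ℕ} (he : e ≤ n) (h : Agree s e T T')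
    (hT : T ∈ CST (Finset.Icc 1 n) Λ) : T' ∈ CST (Finset.Icc 1 n) Λ := by
  intro i j hc
  have h4 := h (i, j) (mem_rowCells.2 hc)
  dsimp only at h4
  by_cases hm : T i j ∈ Finset.Icc (s + 1) e
  · have h5 := Finset.mem_Icc.1 (h4.1.1 hm)
    rw [Finset.mem_Icc]
    omega
  · rw [h4.2 hm]; exact hT i j hc

theorem Conn.dual (hrows : Λ.colLen 0 ≤ n) (hcols : Λ.rowLen 0 ≤ k) {s e : ℕ} (he : e ≤ n)
    (h : Conn s e T T') (hT : T ∈ CST (Finset.Icc 1 n) Λ) :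
    Conn s e (dualTableau n k T) (dualTableau n k T') := by
  induction h with
  | rel T T' h =>
    have hT' := (Conn.agree (.rel _ _ h)).mem_CST he hT
    obtain ⟨i, hi, hi', h⟩ := h
    exact (Conn.of_step hi hi' (h.dual hrows hcols hT hT' (by omega) (by omega))).symm
  | refl T => exact .refl _
  | symm _ _ h ih => exact (ih ((Conn.agree (Relation.EqvGen.symm _ _ h)).mem_CST he hT)).symm
  | trans _ _ _ h _ ih ih' => exact (ih hT).trans (ih' ((Conn.agree h).mem_CST he hT))

/-- Complementing and reversing twice is the identity on lists of columns, and such a list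
determines the tableau once k columns suffice. -/
theorem bijOn_CST (hrows : Λ.colLen 0 ≤ n) (hcols : Λ.rowLen 0 ≤ k) :
    Set.BijOn (dualTableau n k (Λ := Λ)) (CST (Finset.Icc 1 n) Λ)
      (CST (Finset.Icc 1 n) (dualShape n k Λ)) := by
  have hmem : ∀ {Λ : YoungDiagram} {T : SemistandardYoungTableau Λ},
      T ∈ CST (Finset.Icc 1 n) Λ → ∀ c ∈ colsOf k T, ∀ z ∈ c, 1 ≤ z ∧ z ≤ n := by
    intro Λ T hT c hc z hz
    obtain ⟨j, -, rfl⟩ := List.mem_map.1 hc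
    obtain ⟨i, hc, rfl⟩ := mem_colList.1 hz
    exact Finset.mem_Icc.1 (hT _ _ hc)
  refine ⟨fun T hT => dualTableau_mem_CST hT, fun T hT T' hT' h => ?_, fun U hU => ?_⟩
  · have h1 := congrArg (colsOf k) h
    rw [colsOf_dualTableau hrows hT, colsOf_dualTableau hrows hT'] at h1
    have h2 := congrArg (dualCols n) h1
    rw [dualCols_dualCols (sortedCols_colsOf k T) (hmem hT),
      dualCols_dualCols (sortedCols_colsOf k T') (hmem hT')] at h2
    exact colsOf_injective hcols h2
  -- The double dual has a shape equal to Λ only propositionally; comparing lists of columns avoids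
  -- transporting tableaux.
  · have key : ∀ (Λ' : YoungDiagram) (_ : Λ' = Λ) (V : SemistandardYoungTableau Λ'),
        V ∈ CST (Finset.Icc 1 n) Λ' →
        ∃ T ∈ CST (Finset.Icc 1 n) Λ, colsOf k T = colsOf k V := by
      rintro _ rfl V hV
      exact ⟨V, hV, rfl⟩
    obtain ⟨T, hT, e⟩ := key _ (dualShape_dualShape hrows hcols) (dualTableau n k U)
      (dualTableau_mem_CST hU)
    refine ⟨T, hT, colsOf_injective (rowLen_dualShape n k Λ) ?_⟩
    rw [colsOf_dualTableau hrows hT, e, colsOf_dualTableau (colLen_dualShape_zero n k Λ) hU,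
      dualCols_dualCols (sortedCols_colsOf k U) (hmem hU)]

/-! ### Duality on LR tableaux and rectangle switching. -/

variable {t : ℕ} {R : Fin t → Rect}

theorem LRT_subset_CST (hn : n = totalRows R) (h : T ∈ LRT R Λ) : T ∈ CST (Finset.Icc 1 n) Λ := by
  have := h.1
  rwa [zero_add, zero_add, ← hn] at this

/-- Multiplicities become k minus themselves and signatures are swapped. The absence of unmatched i
+ 1 in the dual is the absence of unmatched i in T, which also holds as the content is rectangular.
-/
theorem dualTableau_mem_LRT_iff (hn : n = totalRows R) (hrows : Λ.colLen 0 ≤ n)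
    (hcols : Λ.rowLen 0 ≤ k) (hR : ∀ i, (R i).cols ≤ k) (hT : T ∈ CST (Finset.Icc 1 n) Λ) :
    dualTableau n k T ∈ LRT (dualRects k R) (dualShape n k Λ) ↔ T ∈ LRT R Λ := by
  have hT1 := mem_CST_iff.1 hT
  have hT2 := mem_CST_iff.1 (dualTableau_mem_CST (k := k) hT)
  have e1 : totalRows (dualRects k R) = n := hn.symm
  have e2 : ∀ i, start (dualRects k R) i = start R i := fun _ => rfl
  rw [mem_LRT_iff, mem_LRT_iff, e1, ← hn]
  simp only [Finset.mem_Icc, Nat.succ_le_iff] at hT1 hT2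
  refine and_congr (iff_of_true hT2 hT1) (forall_congr' fun i => ?_)
  have hle := start_add_rows_le_totalRows R i
  rw [← hn] at hle
  rw [e2]
  change IsRectWord (start R i) (R i).rows (k - (R i).cols) _ ↔ _
  constructor
  · intro h
    constructor
    · intro z h1 h2
      have h3 := h.count z h1 h2
      rw [count_dualTableau hrows hcols hT (by omega) (by omega)] at h3
      have h4 := count_rowWord_le (T := T) hcols z
      have h5 := hR i
      omega
    · intro j h1 h2
      have h3 := h.snd j h1 h2
      rwa [sig_dualTableau hrows hcols hT (by omega) (by omega)] at h3
  · intro h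
    constructor
    · intro z h1 h2
      rw [count_dualTableau hrows hcols hT (by omega) (by omega), h.count z h1 h2]
    · intro j h1 h2
      rw [sig_dualTableau hrows hcols hT (by omega) (by omega)]
      exact h.snd j h1 h2

theorem bijOn_LRT (hn : n = totalRows R) (hrows : Λ.colLen 0 ≤ n)
    (hcols : Λ.rowLen 0 ≤ k) (hR : ∀ i, (R i).cols ≤ k) :
    Set.BijOn (dualTableau n k (Λ := Λ)) (LRT R Λ) (LRT (dualRects k R) (dualShape n k Λ)) := by
  have hb := bijOn_CST hrows hcols
  refine ⟨fun T hT => (dualTableau_mem_LRT_iff hn hrows hcols hR (LRT_subset_CST hn hT)).2 hT,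
    hb.injOn.mono fun T hT => LRT_subset_CST hn hT, fun U hU => ?_⟩
  obtain ⟨T, hT, rfl⟩ := hb.surjOn (LRT_subset_CST (R := dualRects k R) hn hU)
  exact ⟨T, (dualTableau_mem_LRT_iff hn hrows hcols hR hT).1 hU, rfl⟩

/-- Duality commutes with rectangle switching. -/
theorem switch_dualTableau (hn : n = totalRows R) (hrows : Λ.colLen 0 ≤ n)
    (hcols : Λ.rowLen 0 ≤ k) (hR : ∀ i, (R i).cols ≤ k) (hT : T ∈ LRT R Λ) (p : Fin (t - 1)) :
    switch (dualRects k R) p (dualTableau n k T) = dualTableau n k (switch R p T) := by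
  have hT1 := LRT_subset_CST hn hT
  have h1 := (dualTableau_mem_LRT_iff hn hrows hcols hR hT1).2 hT
  -- By uniqueness it suffices that the dual of s_p T is a switch of the dual of T: it is connected
  -- to it and extremal for the exchanged dual rectangles.
  refine (isSwitch_switch h1).unique ?_
  obtain ⟨h2, h3, h4⟩ := isSwitch_iff.1 (isSwitch_switch (p := p) hT)
  have hn' : n = totalRows (permute (adj p) R) := by rw [totalRows_permute, hn]
  have h5 := switch_mem_LRT (p := p) hT
  have h6 := (dualTableau_mem_LRT_iff hn' hrows hcols (fun i => hR _) (LRT_subset_CST hn' h5)).2 h5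
  have h7 := (mem_LRT_iff.1 h6).2 (lo p)
  have h8 := isRectWord_hi (p := p) h6
  have e : ∀ i, start (dualRects k (permute (adj p) R)) i = start (permute (adj p) R) i :=
    fun _ => rfl
  rw [e, start_permute_adj R p (lo_ne_hi p)] at h7 h8
  refine isSwitch_iff.2 ⟨h2.dual hrows hcols (hn ▸ pairEnd_le R p) hT1, ?_, ?_⟩
  · simp only [dualRects, permute_adj_lo] at h7
    exact h7
  · simp only [dualRects, permute_adj_lo, permute_adj_hi] at h8
    exact h8

theorem switchWord_dualTableau (hn : n = totalRows R) (hrows : Λ.colLen 0 ≤ n)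
    (hcols : Λ.rowLen 0 ≤ k) (hR : ∀ i, (R i).cols ≤ k) (hT : T ∈ LRT R Λ)
    (w : List (Fin (t - 1))) :
    switchWord (dualRects k R) w (dualTableau n k T) = dualTableau n k (switchWord R w T) := by
  induction w with
  | nil => rfl
  | cons p w ih =>
    rw [switchWord, switchWord, ih]
    exact switch_dualTableau (R := permute (wordPerm w) R) (by rw [totalRows_permute, hn]) hrows
      hcols (fun i => hR _) (switchWord_mem_LRT hT w) p

end Dual

/-! ### Row lengths of insertion tableaux -/

/-- The length of the `r`-th row (zero-based) of the insertion tableau of the restriction of `T` to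
the letters of `[s + 1, e]`. -/
def rowLength (s e : ℕ) (T : SemistandardYoungTableau Λ) (r : ℕ) : ℕ :=
  (lens (insertionTableau (intervalWord s e T))).countP (r + 1 ≤ ·)

theorem rowLength_anti (s e : ℕ) (T : SemistandardYoungTableau Λ) {r r' : ℕ} (h : r ≤ r') :
    rowLength s e T r' ≤ rowLength s e T r :=
  List.countP_mono_left fun x _ hx => by simp at hx ⊢; omega

theorem Conn.rowLength_eq {s e : ℕ} {T T' : SemistandardYoungTableau Λ} (h : Conn s e T T')
    (r : ℕ) : rowLength s e T r = rowLength s e T' r := by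
  rw [rowLength, rowLength, lens_eq_of_recordingTableau_eq h.recordingTableau_eq]

theorem sum_count_eq_length {s m : ℕ} {w : List ℕ} (h : ∀ z ∈ w, s < z ∧ z ≤ s + m) :
    ∑ r ∈ Finset.range m, w.count (s + 1 + r) = w.length := by
  have h1 := Multiset.sum_count_eq_card (s := Finset.Ico (s + 1) (s + 1 + m))
    (m := (w : Multiset ℕ)) fun z hz => by have := h z hz; rw [Finset.mem_Ico]; omega
  rw [Finset.sum_Ico_eq_sum_range] at h1
  simpa using h1

theorem sum_rowLength (s m : ℕ) (T : SemistandardYoungTableau Λ) :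
    ∑ r ∈ Finset.range m, rowLength s (s + m) T r = (intervalWord s (s + m) T).length := by
  have h := sum_drop_lens (ss_insertionTableau (intervalWord s (s + m) T)) (m := m)
    (fun c hc => (length_le_of_mem (fun z => mem_intervalWord) c hc).trans (by omega)) 0
  rw [length_eq_sum_lens]
  exact h.symm

theorem sum_rowLength_eq {s a b μ ν : ℕ} {T : SemistandardYoungTableau Λ}
    (h1 : IsRectWord s a μ (rowWord T)) (h2 : IsRectWord (s + a) b ν (rowWord T)) :
    ∑ r ∈ Finset.range (a + b), rowLength s (s + (a + b)) T r = a * μ + b * ν := by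
  rw [sum_rowLength, ← sum_count_eq_length fun z => mem_intervalWord, Finset.sum_range_add]
  rw [← isRectWord_intervalWord (s := s) (e := s + (a + b)) le_rfl (by omega)] at h1
  rw [← isRectWord_intervalWord (s := s) (e := s + (a + b)) (by omega) (by omega)] at h2
  congr 1
  · rw [Finset.sum_congr rfl fun r hr => h1.count _ (by omega)
      (by have := Finset.mem_range.1 hr; omega)]
    simp
  · rw [Finset.sum_congr rfl fun r hr => h2.count _ (by omega)
      (by have := Finset.mem_range.1 hr; omega)]
    simp

/-- `SS.two_rectangles_rows` bounds rows a and a + 1; monotonicity of the row lengths extends this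
to all rows. -/
theorem rowLength_bounds {s a b μ ν : ℕ} {T : SemistandardYoungTableau Λ} (ha : 0 < a)
    (hb : 0 < b) (h1 : IsRectWord s a μ (rowWord T)) (h2 : IsRectWord (s + a) b ν (rowWord T)) :
    (∀ r < a, μ ≤ rowLength s (s + (a + b)) T r) ∧
      (ν < μ → ∀ r, a ≤ r → rowLength s (s + (a + b)) T r ≤ ν) := by
  rw [← isRectWord_intervalWord (s := s) (e := s + (a + b)) le_rfl (by omega),
    ← isRectWord_insertionTableau] at h1
  rw [← isRectWord_intervalWord (s := s) (e := s + (a + b)) (by omega) (by omega),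
    ← isRectWord_insertionTableau] at h2
  obtain ⟨h3, h4⟩ := (ss_insertionTableau _).two_rectangles_rows ha
    (forall_mem_insertionTableau fun z hz => by have := mem_intervalWord hz; omega) h1 h2
  refine ⟨fun r hr => ?_, fun h r hr => (rowLength_anti _ _ _ hr).trans (h4 hb h)⟩
  refine le_trans ?_ (rowLength_anti _ _ _ (Nat.le_sub_one_of_lt hr))
  rwa [rowLength, Nat.sub_add_cancel ha]

/-- The sum of ρ is what it would be with a rows of length μ and b rows of length ν, so gains
balance losses. For ν < μ gains occur only in the first a rows and losses only in the others; for ν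
= μ one compares positive and negative parts. -/
theorem sum_sub_eq_sum_sub {a b μ ν : ℕ} {ρ : ℕ → ℕ} (hνμ : ν ≤ μ) (h1 : ∀ r < a, μ ≤ ρ r)
    (h2 : ν < μ → ∀ r, a ≤ r → ρ r ≤ ν)
    (hs : ∑ r ∈ Finset.range (a + b), ρ r = a * μ + b * ν) :
    ∑ r ∈ Finset.range (a + b), (ρ r - μ) = ∑ r ∈ Finset.range (a + b), (ν - ρ r) := by
  rcases hνμ.eq_or_lt with rfl | hlt
  · have h : ∑ r ∈ Finset.range (a + b), ((ρ r - ν) + ν) =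
        ∑ r ∈ Finset.range (a + b), ((ν - ρ r) + ρ r) :=
      Finset.sum_congr rfl fun r _ => by omega
    rw [Finset.sum_add_distrib, Finset.sum_add_distrib, hs] at h
    simp only [Finset.sum_const, Finset.card_range, smul_eq_mul, add_mul] at h
    omega
  · rw [Finset.sum_range_add] at hs ⊢
    rw [Finset.sum_range_add]
    have e1 : ∑ r ∈ Finset.range b, (ρ (a + r) - μ) = 0 :=
      Finset.sum_eq_zero fun r _ => by have := h2 hlt (a + r) (by omega); omega
    have e2 : ∑ r ∈ Finset.range a, (ν - ρ r) = 0 :=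
      Finset.sum_eq_zero fun r hr => by have := h1 r (Finset.mem_range.1 hr); omega
    have e3 : ∑ r ∈ Finset.range a, ρ r = ∑ r ∈ Finset.range a, ((ρ r - μ) + μ) :=
      Finset.sum_congr rfl fun r hr => by have := h1 r (Finset.mem_range.1 hr); omega
    have e4 : ∑ r ∈ Finset.range b, (ρ (a + r) + (ν - ρ (a + r))) = ∑ r ∈ Finset.range b, ν :=
      Finset.sum_congr rfl fun r _ => by have := h2 hlt (a + r) (by omega); omega
    simp only [Finset.sum_add_distrib, Finset.sum_const, Finset.card_range, smul_eq_mul] at e3 e4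
    omega

/-! ### Row lengths from extremal tableaux, and under duality. -/

variable {n k : ℕ} {T : SemistandardYoungTableau Λ}

theorem rowLength_eq_count {s e : ℕ} (h : ∀ i, s < i → i < e → (sig i (rowWord T)).1 = 0) {r : ℕ}
    (hr : s + r < e) : rowLength s e T r = (rowWord T).count (s + (r + 1)) := by
  have h1 := count_of_highest (fun z hz => ((isHighest_intervalWord h).1 z hz).1)
    (fun i hi => (isHighest_intervalWord h).fst_eq i hi) r.succ_pos
  rw [rowLength, ← h1, intervalWord, List.count_filter (by simp; omega)]

theorem rowLength_eq_count_of_lowest {s e : ℕ}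
    (h : ∀ i, s < i → i < e → (sig i (rowWord T)).2 = 0) {r : ℕ} (hr : s + r < e) :
    rowLength s e T r = (rowWord T).count (e - r) := by
  have h1 := count_of_lowest (y := intervalWord s e T) (fun z => mem_intervalWord)
    (fun i hi hi' => by rw [sig_intervalWord hi hi', h i hi hi']) r.succ_pos (by omega)
  rw [rowLength, ← h1, intervalWord, List.count_filter (by simp; omega)]
  congr 1
  omega

theorem rowLength_le (hcols : Λ.rowLen 0 ≤ k) {s e r : ℕ} (hr : s + r < e) :
    rowLength s e T r ≤ k := by
  obtain ⟨Y, h1, h2⟩ := exists_highest s e T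
  rw [h1.rowLength_eq, rowLength_eq_count h2 hr]
  exact count_rowWord_le hcols _

/-- Move T to highest weight; its dual moves along and reaches lowest weight. Row lengths are then
multiplicities, read from opposite ends of the interval, and duality replaces a multiplicity by k
minus it. -/
theorem rowLength_dualTableau (hrows : Λ.colLen 0 ≤ n) (hcols : Λ.rowLen 0 ≤ k)
    (hT : T ∈ CST (Finset.Icc 1 n) Λ) {s m r : ℕ} (he : s + m ≤ n) (hr : r < m) :
    rowLength s (s + m) (dualTableau n k T) r = k - rowLength s (s + m) T (m - 1 - r) := by
  obtain ⟨Y, h1, h2⟩ := exists_highest s (s + m) T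
  have hY := h1.agree.mem_CST he hT
  rw [h1.rowLength_eq, rowLength_eq_count h2 (by omega), (h1.dual hrows hcols he hT).rowLength_eq,
    rowLength_eq_count_of_lowest _ (by omega), count_dualTableau hrows hcols hY (by omega)
    (by omega)]
  · congr 2
    omega
  · intro i hi hi'
    rw [sig_dualTableau hrows hcols hY (by omega) (by omega)]
    exact h2 i hi hi'

/-! ### The statistics -/

variable {t : ℕ} {R : Fin t → Rect}

theorem dPair_eq_sum (p : Fin (t - 1)) (T : SemistandardYoungTableau Λ) : dPair R p T =
    ∑ r ∈ Finset.range ((R (lo p)).rows + (R (hi p)).rows),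
      (rowLength (start R (lo p)) (start R (lo p) + ((R (lo p)).rows + (R (hi p)).rows)) T r -
        max (R (lo p)).cols (R (hi p)).cols) := by
  rw [dPair, pairWord_eq, show pairEnd R p =
    start R (lo p) + ((R (lo p)).rows + (R (hi p)).rows) from add_assoc _ _ _]
  exact sum_drop_lens (ss_insertionTableau _)
    (fun c hc => (length_le_of_mem (fun z => mem_intervalWord) c hc).trans (by omega)) _

/-- If the second rectangle is not wider than the first one, then as many cells of the insertion
tableau are to the right of the first rectangle as are missing to the width of the second one. -/
theorem sum_rowLength_sub (h : T ∈ LRT R Λ) (p : Fin (t - 1))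
    (hle : (R (hi p)).cols ≤ (R (lo p)).cols) :
    ∑ r ∈ Finset.range ((R (lo p)).rows + (R (hi p)).rows),
      (rowLength (start R (lo p)) (start R (lo p) + ((R (lo p)).rows + (R (hi p)).rows)) T r -
        (R (lo p)).cols) =
    ∑ r ∈ Finset.range ((R (lo p)).rows + (R (hi p)).rows), ((R (hi p)).cols -
      rowLength (start R (lo p)) (start R (lo p) + ((R (lo p)).rows + (R (hi p)).rows)) T r) := by
  have h1 := (mem_LRT_iff.1 h).2 (lo p)
  have h2 := isRectWord_hi (p := p) h
  have h3 := rowLength_bounds (R (lo p)).rows_pos (R (hi p)).rows_pos h1 h2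
  exact sum_sub_eq_sum_sub hle h3.1 h3.2 (sum_rowLength_eq h1 h2)

theorem dPair_dualTableau (hn : n = totalRows R) (hrows : Λ.colLen 0 ≤ n)
    (hcols : Λ.rowLen 0 ≤ k) (hR : ∀ i, (R i).cols ≤ k) (hT : T ∈ LRT R Λ) (p : Fin (t - 1)) :
    dPair (dualRects k R) p (dualTableau n k T) = dPair R p T := by
  have hT1 := LRT_subset_CST hn hT
  have hT2 := (dualTableau_mem_LRT_iff hn hrows hcols hR hT1).2 hT
  have he := pairEnd_le R p
  rw [← hn, show pairEnd R p =
    start R (lo p) + ((R (lo p)).rows + (R (hi p)).rows) from add_assoc _ _ _] at he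
  have hd := fun r => rowLength_dualTableau (r := r) hrows hcols hT1 he
  have hl : ∀ r < (R (lo p)).rows + (R (hi p)).rows, rowLength (start R (lo p))
      (start R (lo p) + ((R (lo p)).rows + (R (hi p)).rows)) T r ≤ k :=
    fun r hr => rowLength_le hcols (by omega)
  have hμ := hR (lo p)
  have hν := hR (hi p)
  have h1 := sum_rowLength_sub (p := p) hT
  have h2 := sum_rowLength_sub (p := p) hT2
  have es : start (dualRects k R) (lo p) = start R (lo p) := rfl
  rw [dPair_eq_sum, dPair_eq_sum, es]
  rw [es] at h2
  simp only [dualRects] at h2 ⊢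
  generalize start R (lo p) = s at *
  generalize (R (lo p)).rows + (R (hi p)).rows = m at *
  generalize (R (lo p)).cols = μ at *
  generalize (R (hi p)).cols = ν at *
  rcases le_total ν μ with h | h
  -- The dual threshold is k - ν, and a dual row k - ρ exceeds it by ν - ρ: the cells counted for
  -- the dual are the deficit below ν, which equals the surplus of T over μ.
  · rw [max_eq_right (by omega), max_eq_left h, h1 h, ← Finset.sum_range_reflect]
    refine Finset.sum_congr rfl fun r hr => ?_
    rw [Finset.mem_range] at hr
    rw [hd _ (by omega), show m - 1 - (m - 1 - r) = r by omega]
    have := hl r hr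
    omega
  -- Here the dual of R_p is the wider of the two dual rectangles, so surplus and deficit are
  -- compared for the dual tableau.
  · rw [max_eq_left (by omega), max_eq_right h, h2 (by omega), ← Finset.sum_range_reflect]
    refine Finset.sum_congr rfl fun r hr => ?_
    rw [Finset.mem_range] at hr
    rw [hd _ (by omega), show m - 1 - (m - 1 - r) = r by omega]
    have := hl r hr
    omega

theorem dStat_dualTableau (hn : n = totalRows R) (hrows : Λ.colLen 0 ≤ n)
    (hcols : Λ.rowLen 0 ≤ k) (hR : ∀ i, (R i).cols ≤ k) (hT : T ∈ LRT R Λ) :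
    dStat (dualRects k R) (dualTableau n k T) = dStat R T :=
  Finset.sum_congr rfl fun p _ => by rw [dPair_dualTableau hn hrows hcols hR hT]

/-- Duality commutes with the whole chain of switches along the word of u and preserves d at its
end, so the averages agree summand by summand. -/
theorem charge_dualTableau (hn : n = totalRows R) (hrows : Λ.colLen 0 ≤ n)
    (hcols : Λ.rowLen 0 ≤ k) (hR : ∀ i, (R i).cols ≤ k) (hT : T ∈ LRT R Λ)
    {a : Equiv.Perm (Fin t) → List (Fin (t - 1))} (ha : ∀ u, wordPerm (a u) = u) :
    charge a (dualRects k R) (dualTableau n k T) = charge a R T := by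
  rw [charge, charge]
  congr 1
  refine Finset.sum_congr rfl fun u _ => ?_
  have h := switchWord_mem_LRT hT (a u)
  rw [ha u] at h
  rw [switchWord_dualTableau hn hrows hcols hR hT]
  exact congrArg Nat.cast (dStat_dualTableau (R := permute u R) (by rw [totalRows_permute, hn])
    hrows hcols (fun i => hR _) h)

theorem LRTgen_dual (hn : n = totalRows R) (hrows : Λ.colLen 0 ≤ n)
    (hcols : Λ.rowLen 0 ≤ k) (hR : ∀ i, (R i).cols ≤ k)
    {a : Equiv.Perm (Fin t) → List (Fin (t - 1))} (ha : ∀ u, wordPerm (a u) = u) :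
    LRTgen a R Λ = LRTgen a (dualRects k R) (dualShape n k Λ) := by
  have hb := bijOn_LRT hn hrows hcols hR
  refine Finset.sum_bij (fun T _ => dualTableau n k T) ?_ ?_ ?_ ?_
  · intro T hT
    rw [Set.Finite.mem_toFinset] at hT ⊢
    exact hb.mapsTo hT
  · intro T hT T' hT' h
    rw [Set.Finite.mem_toFinset] at hT hT'
    exact hb.injOn hT hT' h
  · intro U hU
    rw [Set.Finite.mem_toFinset] at hU
    obtain ⟨T, hT, h⟩ := hb.surjOn hU
    exact ⟨T, (Set.Finite.mem_toFinset _).2 hT, h⟩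
  · intro T hT
    rw [Set.Finite.mem_toFinset] at hT
    rw [charge_dualTableau hn hrows hcols hR hT ha]

end RectLR

theorem mainTheorem5 {t : ℕ} (R : Fin t → RectLR.Rect) (Λ : YoungDiagram) (n k : ℕ)
    (hn : n = RectLR.totalRows R) (hrows : Λ.colLen 0 ≤ n) (hcols : Λ.rowLen 0 ≤ k)
    (hR : ∀ i, (R i).cols ≤ k) :
    -- duality is a bijection of column strict tableaux, and restricts to one of LR tableaux
    Set.BijOn (RectLR.dualTableau n k (Λ := Λ)) (RectLR.CST (Finset.Icc 1 n) Λ)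
      (RectLR.CST (Finset.Icc 1 n) (RectLR.dualShape n k Λ)) ∧
    Set.BijOn (RectLR.dualTableau n k (Λ := Λ)) (RectLR.LRT R Λ)
      (RectLR.LRT (RectLR.dualRects k R) (RectLR.dualShape n k Λ)) ∧
    -- for every choice of a reduced word of each permutation
    ∀ a : Equiv.Perm (Fin t) → List (Fin (t - 1)), (∀ u, RectLR.IsReducedWord (a u) u) →
      (∀ T ∈ RectLR.LRT R Λ, RectLR.charge a R T =
        RectLR.charge a (RectLR.dualRects k R) (RectLR.dualTableau n k T)) ∧
      RectLR.LRTgen a R Λ =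
        RectLR.LRTgen a (RectLR.dualRects k R) (RectLR.dualShape n k Λ) :=
  ⟨RectLR.bijOn_CST hrows hcols, RectLR.bijOn_LRT hn hrows hcols hR, fun _ ha =>
    ⟨fun _ hT => (RectLR.charge_dualTableau hn hrows hcols hR hT fun u => (ha u).1).symm,
      RectLR.LRTgen_dual hn hrows hcols hR fun u => (ha u).1⟩⟩
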